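/- **Setting.** Let $\ell,k,r$ be positive integers with $k<\ell$ and $r\ge 2$, and let $\mathcal M\subset\mathbb R^\ell$ be an embedded $k$-dimensional submanifold (without boundary) of class $C^r$. Let $\mathcal U\subset\mathbb R^\ell$ be open and let $\phi:\mathcal U\to\mathcal M$ be a map of class $C^{r-1}$ such that, for every $x\in\mathcal U$, the vector $x-\phi(x)$ is orthogonal to $T_{\phi(x)}\mathcal M$ and $\epsilon x+(1-\epsilon)\phi(x)\in\mathcal U$ for all $\epsilon\in[0,1]$ (for instance, the normal projection of a tubular neighbourhood of $\mathcal M$). Let $\Omega\subset\mathbb R^\ell$ be a nonempty bounded domain (open connected set) with $\operatorname{Cl}\Omega\subset\mathcal U$. For $x\in\mathcal U$ let $P(x)$ be the orthogonal projection of $\mathbb R^\ell$ onto the orthogonal complement of $T_{\phi(x)}\mathcal M$. Put $$H^1_s(\Omega)=\{u\in H^1(\Omega) : P(x)\nabla u(x)=0\ \text{for a.e. }x\in\Omega\},$$ and let $L^2_s(\Omega)$ be the closure of $H^1_s(\Omega)$ in $L^2(\Omega)$. For $p\in\mathcal M$ let $\Omega_p=\{x\in\Omega:\phi(x)=p\}$.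 We say that $\Omega$ has *connected normal sections* if $\Omega_p$ is connected (possibly empty) for every $p\in\mathcal M$. Let $\mathcal H^m$ be the $m$-dimensional Hausdorff measure on $\mathbb R^\ell$ (normalized to agree with Lebesgue measure when $m=\ell$, and generally on $m$-dimensional subspaces). Put $\mathcal G=\phi(\Omega)$, a relatively open subset of $\mathcal M$, and $\mu(p)=\mathcal H^{\ell-k}(\Omega_p)$ for $p\in\mathcal G$. Let $L^2(\mathcal G)$ (respectively $L^2_{\rm loc}(\mathcal G)$) be the $\mathcal H^k$-measurable functions on $\mathcal G$ that are square integrable on $\mathcal G$ (respectively on every compact subset of $\mathcal G$) with respect to $\mathcal H^k$, and let $\mathbb L^2(\mathcal G)$, $\mathbb L^2_{\rm loc}(\mathcal G)$ be the corresponding spaces of tangent vector fields. A function $v\in L^2_{\rm loc}(\mathcal G)$ belongs to $H^1_{\rm loc}(\mathcal G)$, with weak gradient $\nabla v\in\mathbb L^2_{\rm loc}(\mathcal G)$, if for every chart of $\mathcal M$ of class $C^r$ with domain contained in $\mathcal G$ and inverse $\sigma:O\to\mathcal G$, $O\subset\mathbb R^k$ open, the function $v\circ\sigma$ is in $H^1_{\rm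 loc}(O)$ and has weak gradient $D\sigma(\xi)^T\,\nabla v(\sigma(\xi))$ for a.e. $\xi\in O$. **Theorem.** Assume that $\Omega$ has connected normal sections. 1. Let $u\in L^2_s(\Omega)$. Then there exist a Lebesgue null set $S\subset\mathbb R^\ell$ and a function $v\in L^2_{\rm loc}(\mathcal G)$ such that $u(x)=v(\phi(x))$ for all $x\in\Omega\setminus S$; moreover $\mu^{1/2}v\in L^2(\mathcal G)$. If in addition $u\in H^1_s(\Omega)$, then $v\in H^1_{\rm loc}(\mathcal G)$, $$\nabla u(x)=D\phi(x)^T\,\nabla v(\phi(x))\quad\text{for a.e. }x\in\Omega,$$ and $\mu^{1/2}\nabla v\in\mathbb L^2(\mathcal G)$. 2. Conversely, let $v\in L^2_{\rm loc}(\mathcal G)$ satisfy $\mu^{1/2}v\in L^2(\mathcal G)$, and set $u(x)=v(\phi(x))$ for $x\in\Omega$. Then $u\in L^2_s(\Omega)$. If in addition $v\in H^1_{\rm loc}(\mathcal G)$ and $\mu^{1/2}\nabla v\in\mathbb L^2(\mathcal G)$, then $u\in H^1_s(\Omega)$. -/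

import Mathlib

open MeasureTheory Set
open scoped InnerProductSpace ContDiff

noncomputable section

namespace ThinDomain

/-- Euclidean space of dimension `n`, with its Euclidean norm. -/
abbrev Euc (n : ℕ) : Type := EuclideanSpace ℝ (Fin n)

/-! ### Sobolev spaces on open subsets of Euclidean space -/

/-- `f` is locally square integrable on `S` with respect to `ν`, that is, square integrable on
every compact subset of `S`. -/
def MemL2Loc {n : ℕ} {F : Type*} [NormedAddCommGroup F]
    (ν : Measure (Euc n)) (S : Set (Euc n)) (f : Euc n → F) : Prop :=
  ∀ K : Set (Euc n), IsCompact K → K ⊆ S → MemLp f 2 (ν.restrict K)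

/-- On the open set `Ω`, the function `u` belongs to `H¹_loc(Ω)` and `g` is its weak
(distributional) gradient. -/
structure HasWeakGradient {n : ℕ} (Ω : Set (Euc n)) (u : Euc n → ℝ) (g : Euc n → Euc n) :
    Prop where
  memL2Loc : MemL2Loc volume Ω u
  memL2Loc_grad : MemL2Loc volume Ω g
  integral_eq : ∀ ψ : Euc n → ℝ, ContDiff ℝ ∞ ψ → HasCompactSupport ψ → tsupport ψ ⊆ Ω →
    ∀ h : Euc n,
      ∫ x in Ω, u x * fderiv ℝ ψ x h = - ∫ x in Ω, ⟪g x, h⟫_ℝ * ψ x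

/-! ### Embedded submanifolds of Euclidean space -/

/-- `σ`, restricted to the open set `O ⊆ ℝᵏ`, is a local parametrization of class `C^r`
(the inverse of a chart) of `M`: it is a `C^r` immersion and a homeomorphism of `O` onto a
relatively open subset of `M`. -/
structure IsLocalParam {k l : ℕ} (r : ℕ) (M : Set (Euc l)) (O : Set (Euc k))
    (σ : Euc k → Euc l) : Prop where
  isOpen : IsOpen O
  contDiffOn : ContDiffOn ℝ r σ O
  injective_fderiv : ∀ ξ ∈ O, Function.Injective (fderiv ℝ σ ξ)
  isEmbedding : Topology.IsEmbedding (O.domRestrict σ)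
  image_eq : ∃ W : Set (Euc l), IsOpen W ∧ σ '' O = M ∩ W

/-- `M` is an embedded `k`-dimensional submanifold (without boundary) of class `C^r`. -/
def IsSubmanifold {l : ℕ} (k r : ℕ) (M : Set (Euc l)) : Prop :=
  ∀ p ∈ M, ∃ (O : Set (Euc k)) (σ : Euc k → Euc l), IsLocalParam r M O σ ∧ p ∈ σ '' O

/-- The tangent space of `M` at `p`, spanned by the velocities at `p` of the curves in `M`
through `p`. (For a submanifold these velocities already form a linear subspace.) -/
def tangentSpace {l : ℕ} (M : Set (Euc l)) (p : Euc l) : Submodule ℝ (Euc l) :=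
  Submodule.span ℝ {w | ∃ γ : ℝ → Euc l, (∀ t, γ t ∈ M) ∧ γ 0 = p ∧ HasDerivAt γ w 0}

/-- `φ : U → M` is the normal projection of class `C^(r-1)` of a tubular neighbourhood: `x - φ x`
is orthogonal to the tangent space of `M` at `φ x`, and `U` contains the segment from `φ x`
to `x`. -/
structure IsNormalProjection {l : ℕ} (r : ℕ) (M U : Set (Euc l)) (φ : Euc l → Euc l) :
    Prop where
  isOpen : IsOpen U
  contDiffOn : ContDiffOn ℝ (r - 1 : ℕ) φ U
  mapsTo : MapsTo φ U M
  sub_mem_orthogonal : ∀ x ∈ U, x - φ x ∈ (tangentSpace M (φ x))ᗮ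
  segment_mem : ∀ x ∈ U, ∀ ε ∈ Icc (0 : ℝ) 1, ε • x + (1 - ε) • φ x ∈ U

/-! ### Sobolev spaces on relatively open subsets of a submanifold -/

/-- For `S` relatively open in the `k`-dimensional `C^r` submanifold `M`: the function `v` belongs
to `H¹_loc(S)` and the tangent vector field `V` is its weak gradient. Both are locally square
integrable with respect to the `k`-dimensional Hausdorff measure and, in every chart with
domain in `S` and inverse `σ : O → S`, the function `v ∘ σ` is in `H¹_loc(O)` and
its weak derivative in the direction `η` is `⟨V(σ(ξ)), Dσ(ξ) η⟩`, that is, its weak gradient is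
`Dσ(ξ)ᵀ V(σ(ξ))`. -/
structure HasWeakGradientOn {l : ℕ} (k r : ℕ) (M S : Set (Euc l)) (v : Euc l → ℝ)
    (V : Euc l → Euc l) : Prop where
  memL2Loc : MemL2Loc μHE[k] S v
  memL2Loc_grad : MemL2Loc μHE[k] S V
  tangent : ∀ p ∈ S, V p ∈ tangentSpace M p
  chart : ∀ (O : Set (Euc k)) (σ : Euc k → Euc l), IsLocalParam r M O σ → σ '' O ⊆ S →
    HasWeakGradient O (fun ξ => v (σ ξ))
      (fun ξ => ContinuousLinearMap.adjoint (fderiv ℝ σ ξ) (V (σ ξ)))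

/-- `v ∈ H¹_loc(S)`. -/
def MemH1Loc {l : ℕ} (k r : ℕ) (M S : Set (Euc l)) (v : Euc l → ℝ) : Prop :=
  ∃ V : Euc l → Euc l, HasWeakGradientOn k r M S v V

/-! ### The spaces `H¹_s(Ω)` and `L²_s(Ω)` -/

/-- The orthogonal projection `P(x)` onto the orthogonal complement of `T_{φ(x)} M`. -/
def normalProj {l : ℕ} (M : Set (Euc l)) (φ : Euc l → Euc l) (x : Euc l) : Euc l →L[ℝ] Euc l :=
  ContinuousLinearMap.id ℝ (Euc l) - (tangentSpace M (φ x)).starProjection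

/-- `u ∈ H¹_s(Ω)`: `u ∈ H¹(Ω)` and `P(x) ∇u(x) = 0` for almost every `x ∈ Ω`. -/
def MemH1s {l : ℕ} (M : Set (Euc l)) (φ : Euc l → Euc l) (Ω : Set (Euc l)) (u : Euc l → ℝ) :
    Prop :=
  MemLp u 2 (volume.restrict Ω) ∧
    ∃ g : Euc l → Euc l, HasWeakGradient Ω u g ∧ MemLp g 2 (volume.restrict Ω) ∧
      ∀ᵐ x ∂(volume.restrict Ω), normalProj M φ x (g x) = 0

/-- `u ∈ L²_s(Ω)`: the class of `u` lies in the closure of `H¹_s(Ω)` in `L²(Ω)`. -/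
def MemL2s {l : ℕ} (M : Set (Euc l)) (φ : Euc l → Euc l) (Ω : Set (Euc l)) (u : Euc l → ℝ) :
    Prop :=
  ∃ hu : MemLp u 2 (volume.restrict Ω),
    hu.toLp u ∈ closure {f : Lp ℝ 2 (volume.restrict Ω) | MemH1s M φ Ω f}

/-! ### Normal sections -/

/-- The normal section `Ω_p` of `Ω` at `p`. -/
def normalSection {l : ℕ} (φ : Euc l → Euc l) (Ω : Set (Euc l)) (p : Euc l) : Set (Euc l) :=
  {x ∈ Ω | φ x = p}

/-- `Ω` has connected normal sections. The empty section (at points `p ∉ φ(Ω)`) counts as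
connected. -/
def HasConnectedNormalSections {l : ℕ} (M : Set (Euc l)) (φ : Euc l → Euc l)
    (Ω : Set (Euc l)) : Prop :=
  ∀ p ∈ M, IsPreconnected (normalSection φ Ω p)

/-- `μ(p)`, the `(l - k)`-dimensional Hausdorff measure of the normal section at `p`. -/
def sectionMeasure {l : ℕ} (k : ℕ) (φ : Euc l → Euc l) (Ω : Set (Euc l)) (p : Euc l) : ℝ :=
  (μHE[l - k] (normalSection φ Ω p)).toReal

end ThinDomain

end

open ThinDomain

section

open Filter Topology Metric
open scoped Convolution ENNReal NNReal Gradient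

/-! ### Mollification in `L¹` -/

/-! Everything happens in charts that straighten the fibres of `φ`. Differentiating `⟪x - φ x, Dσ η⟫
= 0` in a local parametrization `σ` of `M` shows that the coordinate expression of `φ` is a
submersion whose derivative has exactly the normal space as kernel
(`IsNormalProjection.fderiv_coord`). The inverse function theorem then gives bi-Lipschitz `C¹`
charts in which an open set becomes a product `A × B` and `φ` becomes the projection to `A` followed
by `σ` (`IsFiberChart`).

In such a chart the condition `P ∇u = 0` says that `u` has no derivative along `B`. Mollification,
translation and Fubini show that `u` depends on the `A`-variable alone (`IsSlicing.ae_eq_slice`),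
and a good slice provides the weak gradient of the resulting function
(`IsSlicing.ae_hasWeakGradient`). Local factors agree almost everywhere on the `φ`-image of an
overlap, so along almost every section the value of the local factor is locally constant;
connectedness of the section makes it constant, and the factors glue
(`exists_measurable_comp_ae_eq`). The gradient descends in the same way: `Dφ(x)ᵀ` is injective on
the tangent space, so `∇u` determines a tangent field pointwise, and a lower bound uniform on the
closure of `Ω` transfers square integrability from `∇u` to that field.

Measures are only compared up to constants. Fubini in the charts and compactness of the closure of
`Ω` show that the image of Lebesgue measure under `φ` is comparable with the measure of density `μ`
with respect to `μHE[k]` (`exists_map_comparable`). Hence `√μ v ∈ L²` means `v ∘ φ ∈ L²(Ω)`, without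
any exact coarea Jacobian; local square integrability of `v` follows because `μ` is bounded below
near each point of `φ(Ω)`.

For the `L²` statements, composition with `φ` is an isometry of the `L²` space of the image measure
into `L²(Ω)`, so its range is closed. The range contains `H¹_s`, hence `L²_s`. Conversely, smooth
compactly supported functions are dense in the source and pull back into `H¹_s`, so the range is
contained in `L²_s`. -/

theorem lintegral_enorm_convolution_le {n : ℕ} {F : Type*} [NormedAddCommGroup F] [NormedSpace ℝ F]
    (φ : ContDiffBump (0 : Euc n)) {f : Euc n → F} (hf : AEStronglyMeasurable f volume) :
    ∫⁻ x, ‖(φ.normed volume ⋆[ContinuousLinearMap.lsmul ℝ ℝ, volume] f) x‖ₑ ≤ ∫⁻ x, ‖f x‖ₑ := by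
  have h1 : ∀ x, ‖(φ.normed volume ⋆[ContinuousLinearMap.lsmul ℝ ℝ, volume] f) x‖ₑ
      ≤ ∫⁻ t, ‖φ.normed volume t • f (x - t)‖ₑ := fun x =>
    enorm_integral_le_lintegral_enorm _
  refine (lintegral_mono h1).trans ?_
  have hm : AEStronglyMeasurable (fun p : Euc n × Euc n => φ.normed volume p.2 • f (p.1 - p.2))
      (volume.prod volume) :=
    AEStronglyMeasurable.convolution_integrand (ContinuousLinearMap.lsmul ℝ ℝ)
      φ.continuous_normed.aestronglyMeasurable hf
  rw [lintegral_lintegral_swap hm.enorm]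
  simp only [enorm_smul]
  have h2 : ∀ t, ∫⁻ x, ‖φ.normed volume t‖ₑ * ‖f (x - t)‖ₑ
      = ‖φ.normed volume t‖ₑ * ∫⁻ x, ‖f x‖ₑ := fun t => by
    rw [lintegral_const_mul' _ _ enorm_ne_top,
      lintegral_sub_right_eq_self (fun x => ‖f x‖ₑ) t]
  simp only [h2]
  rw [lintegral_mul_const _ (φ.continuous_normed.enorm.measurable)]
  have h3 : ∫⁻ t, ‖φ.normed (volume : Measure (Euc n)) t‖ₑ = 1 := by
    have : ∀ t, ‖φ.normed (volume : Measure (Euc n)) t‖ₑ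
        = ENNReal.ofReal (φ.normed (volume : Measure (Euc n)) t) := fun t =>
      Real.enorm_of_nonneg (φ.nonneg_normed t)
    simp only [this]
    rw [← ofReal_integral_eq_lintegral_ofReal φ.integrable_normed
      (Eventually.of_forall φ.nonneg_normed), φ.integral_normed, ENNReal.ofReal_one]
  rw [h3, one_mul]

/-- The mollifications of a continuous function with compact support converge in `L¹`. -/
theorem tendsto_lintegral_convolution_sub_of_continuous {n : ℕ} {F : Type*} [NormedAddCommGroup F]
    [NormedSpace ℝ F] [CompleteSpace F] {φ : ℕ → ContDiffBump (0 : Euc n)}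
    (hφ : Tendsto (fun i => (φ i).rOut) atTop (𝓝 0)) {f : Euc n → F} (hf : Continuous f)
    (hc : HasCompactSupport f) :
    Tendsto (fun i => ∫⁻ x,
      ‖((φ i).normed volume ⋆[ContinuousLinearMap.lsmul ℝ ℝ, volume] f) x - f x‖ₑ)
      atTop (𝓝 0) := by
  -- The unit thickening contains the support of every mollification of radius below one, so the
  -- error lives on a fixed set of finite measure, where uniform continuity bounds it.
  set K := cthickening 1 (tsupport f)
  have hK : IsCompact K := hc.isCompact.cthickening
  rw [ENNReal.tendsto_nhds_zero]
  intro ε hε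
  obtain ⟨δ, hδ0, hδ⟩ : ∃ δ : ℝ≥0, 0 < δ ∧ δ * volume K ≤ ε := by
    obtain ⟨δ, h0, h1⟩ := ENNReal.exists_nnreal_pos_mul_lt (hK.measure_lt_top (μ := volume)).ne hε.ne'
    exact ⟨δ, h0, h1.le⟩
  obtain ⟨η, hη0, hη⟩ := Metric.uniformContinuous_iff.1 (hc.uniformContinuous_of_continuous hf) δ hδ0
  filter_upwards [hφ.eventually (gt_mem_nhds hη0), hφ.eventually (gt_mem_nhds one_pos)]
    with i hi hi1
  have hb : ∀ x, ‖((φ i).normed volume ⋆[ContinuousLinearMap.lsmul ℝ ℝ, volume] f) x - f x‖ₑ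
      ≤ K.indicator (fun _ => (δ : ℝ≥0∞)) x := by
    intro x
    by_cases hx : x ∈ K
    · rw [indicator_of_mem hx]
      have := (φ i).dist_normed_convolution_le (μ := volume) (x₀ := x) (ε := δ)
        hf.aestronglyMeasurable (fun y hy => (hη ((mem_ball.1 hy).trans hi)).le)
      rw [dist_eq_norm] at this
      rw [← ofReal_norm, ← ENNReal.ofReal_coe_nnreal]
      exact ENNReal.ofReal_le_ofReal this
    · rw [indicator_of_notMem hx]
      have hz : ∀ y ∈ ball x (φ i).rOut, f y = 0 := by
        intro y hy
        by_contra hne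
        exact hx (mem_cthickening_of_dist_le x y 1 _ (subset_tsupport _ hne)
          ((dist_comm x y).trans_le ((mem_ball.1 hy).trans hi1).le))
      have hx0 := hz x (mem_ball_self (φ i).rOut_pos)
      have := (φ i).dist_normed_convolution_le (μ := volume) (x₀ := x) (ε := 0)
        hf.aestronglyMeasurable (fun y hy => by rw [hz y hy, hx0, dist_self])
      rw [dist_eq_norm] at this
      rw [← ofReal_norm, le_antisymm this (norm_nonneg _), ENNReal.ofReal_zero]
  calc _ ≤ ∫⁻ x, K.indicator (fun _ => (δ : ℝ≥0∞)) x := lintegral_mono hb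
    _ = δ * volume K := by rw [lintegral_indicator_const hK.measurableSet]
    _ ≤ ε := hδ

/-- The mollifications of an integrable function converge in `L¹`. -/
theorem tendsto_lintegral_convolution_sub {n : ℕ} {F : Type*} [NormedAddCommGroup F]
    [NormedSpace ℝ F] [CompleteSpace F] {φ : ℕ → ContDiffBump (0 : Euc n)}
    (hφ : Tendsto (fun i => (φ i).rOut) atTop (𝓝 0)) {f : Euc n → F} (hf : Integrable f) :
    Tendsto (fun i => ∫⁻ x,
      ‖((φ i).normed volume ⋆[ContinuousLinearMap.lsmul ℝ ℝ, volume] f) x - f x‖ₑ)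
      atTop (𝓝 0) := by
  rw [ENNReal.tendsto_nhds_zero]
  intro ε hε
  have hε3 : ε / 3 ≠ 0 := (ENNReal.div_pos hε.ne' (by simp)).ne'
  -- Mollification is an `L¹` contraction, so replacing `f` by a continuous compactly supported `g`
  -- costs `ε / 3` before and `ε / 3` after mollifying.
  obtain ⟨g, hgc, hfg, hg, hgi⟩ := hf.exists_hasCompactSupport_lintegral_sub_le hε3
  filter_upwards [ENNReal.tendsto_nhds_zero.1
    (tendsto_lintegral_convolution_sub_of_continuous hφ hg hgc) _ hε3.bot_lt] with i hi
  have hfgm : Integrable (f - g) := hf.sub hgi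
  set L : ℝ →L[ℝ] F →L[ℝ] F := ContinuousLinearMap.lsmul ℝ ℝ
  have hex : ∀ h : Euc n → F, LocallyIntegrable h →
      ∀ x, ConvolutionExistsAt ((φ i).normed volume) h x L volume := fun h hh x =>
    (φ i).hasCompactSupport_normed.convolutionExists_left L (φ i).continuous_normed hh x
  have hpt : ∀ x, ((φ i).normed volume ⋆[L, volume] f) x - f x =
      ((φ i).normed volume ⋆[L, volume] (f - g)) x
        + (((φ i).normed volume ⋆[L, volume] g) x - g x) + (g x - f x) := by
    intro x
    have : ((φ i).normed volume ⋆[L, volume] f) x = ((φ i).normed volume ⋆[L, volume] (f - g)) x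
        + ((φ i).normed volume ⋆[L, volume] g) x := by
      rw [← (hex _ hfgm.locallyIntegrable x).distrib_add (hex _ hgi.locallyIntegrable x),
        sub_add_cancel]
    rw [this]; abel
  calc _ ≤ ∫⁻ x, (‖((φ i).normed volume ⋆[L, volume] (f - g)) x‖ₑ
        + ‖((φ i).normed volume ⋆[L, volume] g) x - g x‖ₑ + ‖f x - g x‖ₑ) := by
        refine lintegral_mono fun x => ?_
        rw [hpt x]
        refine (enorm_add_le _ _).trans (add_le_add (enorm_add_le _ _) ?_)
        rw [← enorm_neg, neg_sub]
    _ = (∫⁻ x, ‖((φ i).normed volume ⋆[L, volume] (f - g)) x‖ₑ)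
        + (∫⁻ x, ‖((φ i).normed volume ⋆[L, volume] g) x - g x‖ₑ) + ∫⁻ x, ‖f x - g x‖ₑ := by
        have hm : AEMeasurable (fun x => ‖f x - g x‖ₑ) volume := hfgm.aestronglyMeasurable.enorm
        rw [lintegral_add_right' _ hm, lintegral_add_left']
        have hc : Continuous ((φ i).normed volume ⋆[L, volume] (f - g)) :=
          (φ i).hasCompactSupport_normed.continuous_convolution_left L (φ i).continuous_normed
            hfgm.locallyIntegrable
        exact hc.enorm.measurable.aemeasurable
    _ ≤ ε / 3 + ε / 3 + ε / 3 := by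
        refine add_le_add (add_le_add ?_ hi) hfg
        exact (lintegral_enorm_convolution_le (φ i) hfgm.aestronglyMeasurable).trans hfg
    _ = ε := ENNReal.add_thirds ε

/-! ### Basic properties of weak gradients -/

theorem exists_contDiffBump_seq (n : ℕ) {δ : ℝ} (hδ : 0 < δ) :
    ∃ φ : ℕ → ContDiffBump (0 : Euc n), Tendsto (fun i => (φ i).rOut) atTop (𝓝 0) ∧
      ∀ i, (φ i).rOut ≤ δ := by
  refine ⟨fun i => ⟨δ / (2 * (i + 1)), δ / (i + 1), by positivity, ?_⟩, ?_, fun i => ?_⟩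
  · apply div_lt_div_of_pos_left hδ (by positivity); nlinarith [(Nat.cast_nonneg i : (0:ℝ) ≤ i)]
  · exact tendsto_const_div_atTop_nhds_zero_nat δ |>.comp (tendsto_add_atTop_nat 1) |>.congr
      (by intro i; simp)
  · exact div_le_self hδ.le (by linarith [(Nat.cast_nonneg i : (0:ℝ) ≤ i)])

theorem MemLp.integrable_of_isCompact {n : ℕ} {F : Type*} [NormedAddCommGroup F]
    {K : Set (Euc n)} (hK : IsCompact K) {f : Euc n → F} (hf : MemLp f 2 (volume.restrict K)) :
    IntegrableOn f K := by
  have : IsFiniteMeasure (volume.restrict K) := ⟨by simpa using hK.measure_lt_top⟩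
  exact hf.integrable (by norm_num)

theorem ThinDomain.MemL2Loc.locallyIntegrableOn {n : ℕ} {F : Type*} [NormedAddCommGroup F]
    {Ω : Set (Euc n)} (hΩ : IsOpen Ω) {f : Euc n → F} (hf : MemL2Loc volume Ω f) :
    LocallyIntegrableOn f Ω := by
  rw [locallyIntegrableOn_iff hΩ.isLocallyClosed]
  exact fun K hK hc => MemLp.integrable_of_isCompact hc (hf K hc hK)

/-- A function which is weakly differentiable is approximated by smooth functions, in `W^{1,1}` of
compact sets. -/
theorem ThinDomain.HasWeakGradient.exists_contDiff_tendsto {n : ℕ} {Ω : Set (Euc n)}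
    (hΩ : IsOpen Ω) {u : Euc n → ℝ} {g : Euc n → Euc n} (h : HasWeakGradient Ω u g)
    {K : Set (Euc n)} (hK : IsCompact K) (hKΩ : K ⊆ Ω) :
    ∃ w : ℕ → Euc n → ℝ, (∀ i, ContDiff ℝ ∞ (w i)) ∧
      Tendsto (fun i => ∫⁻ x in K, ‖w i x - u x‖ₑ) atTop (𝓝 0) ∧
      Tendsto (fun i => ∫⁻ x in K, ‖∇ (w i) x - g x‖ₑ) atTop (𝓝 0) := by
  -- With radii at most `δ`, mollified values on `K` involve only the compact set `K' ⊆ Ω`, so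
  -- cutting off outside `K'` does not affect them.
  obtain ⟨δ, hδ, hδΩ⟩ := hK.exists_cthickening_subset_open hΩ hKΩ
  set K' := cthickening δ K
  have hK' : IsCompact K' := hK.cthickening
  have hKK' : K ⊆ K' := self_subset_cthickening K
  obtain ⟨φ, hφ, hφδ⟩ := exists_contDiffBump_seq n hδ
  set L : ℝ →L[ℝ] ℝ →L[ℝ] ℝ := ContinuousLinearMap.lsmul ℝ ℝ
  have hui : Integrable (K'.indicator u) :=
    (integrable_indicator_iff hK'.measurableSet).2
      (MemLp.integrable_of_isCompact hK' (h.memL2Loc K' hK' hδΩ))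
  have hgi : Integrable (K'.indicator g) :=
    (integrable_indicator_iff hK'.measurableSet).2
      (MemLp.integrable_of_isCompact hK' (h.memL2Loc_grad K' hK' hδΩ))
  refine ⟨fun i => (φ i).normed volume ⋆[L, volume] (K'.indicator u), fun i => ?_, ?_, ?_⟩
  · exact (φ i).hasCompactSupport_normed.contDiff_convolution_left L (φ i).contDiff_normed
      hui.locallyIntegrable
  · refine tendsto_of_tendsto_of_tendsto_of_le_of_le tendsto_const_nhds
      (tendsto_lintegral_convolution_sub hφ hui) (fun _ => zero_le) fun i => ?_
    refine le_trans (le_of_eq ?_) (setLIntegral_le_lintegral K _)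
    refine setLIntegral_congr_fun hK.measurableSet fun x hx => ?_
    simp only [indicator_of_mem (hKK' hx)]; rfl
  · refine tendsto_of_tendsto_of_tendsto_of_le_of_le tendsto_const_nhds
      (tendsto_lintegral_convolution_sub hφ hgi) (fun _ => zero_le) fun i => ?_
    refine le_trans (le_of_eq ?_) (setLIntegral_le_lintegral K _)
    refine setLIntegral_congr_fun hK.measurableSet fun x hx => ?_
    simp only
    congr 1
    rw [indicator_of_mem (hKK' hx)]
    congr 1
    refine ext_inner_right ℝ fun v => ?_
    rw [inner_gradient_left]
    have hd := (φ i).hasCompactSupport_normed.hasFDerivAt_convolution_left (μ := volume) L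
      ((φ i).contDiff_normed (μ := volume) (n := 1)) hui.locallyIntegrable x
    rw [hd.fderiv]
    have hball : ∀ y, (φ i).normed volume (x - y) ≠ 0 → y ∈ closedBall x (φ i).rOut := by
      intro y hy
      have : x - y ∈ Function.support ((φ i).normed volume) := hy
      rw [(φ i).support_normed_eq, mem_ball_zero_iff] at this
      rw [mem_closedBall, dist_eq_norm, norm_sub_rev]; exact this.le
    have hsub : closedBall x (φ i).rOut ⊆ K' := fun y hy =>
      mem_cthickening_of_dist_le y x δ K hx ((mem_closedBall.1 hy).trans (hφδ i))
    -- The reflected mollifier is an admissible test function; tested against it, the weak gradient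
    -- identity says that the gradient of the mollified `u` at `x` is the mollified `g`. The
    -- reflection supplies the sign.
    set ψ : Euc n → ℝ := fun y => (φ i).normed volume (x - y)
    have hψ : ContDiff ℝ ∞ ψ := ((φ i).contDiff_normed (μ := volume)).comp (contDiff_const.sub contDiff_id)
    have hψt : tsupport ψ ⊆ closedBall x (φ i).rOut :=
      closure_minimal (fun y hy => hball y hy) isClosed_closedBall
    have hψc : HasCompactSupport ψ :=
      HasCompactSupport.of_support_subset_isCompact (isCompact_closedBall x (φ i).rOut)
        (fun y hy => hball y hy)
    have hψΩ : tsupport ψ ⊆ Ω := hψt.trans (hsub.trans hδΩ)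
    have hψd : ∀ y, fderiv ℝ ψ y v = - fderiv ℝ ((φ i).normed volume) (x - y) v := by
      intro y
      have h1 : HasFDerivAt ((φ i).normed volume) (fderiv ℝ ((φ i).normed volume) (x - y)) (x - y) :=
        (((φ i).contDiff_normed (μ := volume) (n := 1)).differentiable one_ne_zero _).hasFDerivAt
      have h2 : HasFDerivAt (fun y : Euc n => x - y) (-ContinuousLinearMap.id ℝ (Euc n)) y :=
        (hasFDerivAt_id y).const_sub x
      have h3 : HasFDerivAt ψ _ y := h1.comp y h2
      rw [h3.fderiv]; simp
    have key := h.integral_eq ψ hψ hψc hψΩ v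
    have hint : ConvolutionExistsAt (fderiv ℝ ((φ i).normed volume)) (K'.indicator u) x
        (L.precompL (Euc n)) volume :=
      ((φ i).hasCompactSupport_normed.fderiv ℝ).convolutionExists_left _
        (((φ i).contDiff_normed (μ := volume) (n := 1)).continuous_fderiv one_ne_zero) hui.locallyIntegrable x
    have hz : ∀ y ∉ K', ψ y = 0 := fun y hy => by
      by_contra hne; exact hy (hsub (hball y hne))
    have hz' : ∀ y ∉ K', fderiv ℝ ψ y v = 0 := fun y hy => by
      have : y ∉ tsupport ψ := fun hyt => hy (hsub (hψt hyt))
      rw [fderiv_of_notMem_tsupport (𝕜 := ℝ) this]; rfl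
    have e1 : ((fderiv ℝ ((φ i).normed volume)) ⋆[L.precompL (Euc n), volume] (K'.indicator u)) x v
        = - ∫ y in Ω, u y * fderiv ℝ ψ y v := by
      rw [convolution_eq_swap, ← ContinuousLinearMap.apply_apply v,
        ← ContinuousLinearMap.integral_comp_comm]
      · rw [← integral_neg, ← integral_indicator hΩ.measurableSet]
        refine integral_congr_ae (Eventually.of_forall fun y => ?_)
        simp only [ContinuousLinearMap.apply_apply, L, ContinuousLinearMap.precompL_apply,
          ContinuousLinearMap.lsmul_apply, smul_eq_mul]
        by_cases hy : y ∈ K'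
        · rw [indicator_of_mem hy, indicator_of_mem (hδΩ hy), hψd]; ring
        · rw [indicator_of_notMem hy]
          by_cases hy' : y ∈ Ω
          · rw [indicator_of_mem hy', hz' y hy]; simp
          · rw [indicator_of_notMem hy']; simp
      · exact hint.integrable_swap
    have e2 : ((φ i).normed volume ⋆[ContinuousLinearMap.lsmul ℝ ℝ, volume] (K'.indicator g)) x
        = ∫ y, ψ y • K'.indicator g y := by
      rw [convolution_eq_swap]; rfl
    have hgi' : Integrable (fun y => ψ y • K'.indicator g y) :=
      hgi.locallyIntegrable.integrable_smul_left_of_hasCompactSupport hψ.continuous hψc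
    rw [e1, key, neg_neg, e2, ← real_inner_comm, ← integral_inner hgi' v,
      ← integral_indicator hΩ.measurableSet]
    refine integral_congr_ae (Eventually.of_forall fun y => ?_)
    simp only
    by_cases hy : y ∈ K'
    · rw [indicator_of_mem hy, indicator_of_mem (hδΩ hy), inner_smul_right, real_inner_comm,
        mul_comm]
    · rw [indicator_of_notMem hy, smul_zero, inner_zero_right]
      by_cases hy' : y ∈ Ω
      · rw [indicator_of_mem hy', hz y hy, mul_zero]
      · rw [indicator_of_notMem hy']

/-! ### Local square integrability and the calculus of weak gradients. -/

theorem MeasureTheory.MemLp.two_add_measure {α F : Type*} [MeasurableSpace α] [NormedAddCommGroup F]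
    {μ ν : Measure α} {f : α → F} (hμ : MemLp f 2 μ) (hν : MemLp f 2 ν) : MemLp f 2 (μ + ν) := by
  refine ⟨hμ.1.add_measure hν.1, ?_⟩
  have h1 := hμ.2
  have h2 := hν.2
  rw [eLpNorm_lt_top_iff_lintegral_rpow_enorm_lt_top (by norm_num) (by norm_num)] at h1 h2 ⊢
  rw [lintegral_add_measure]
  exact ENNReal.add_lt_top.2 ⟨h1, h2⟩

theorem MeasureTheory.MemLp.two_union {α F : Type*} [MeasurableSpace α] [NormedAddCommGroup F]
    {μ : Measure α} {f : α → F} {s t : Set α} (hs : MemLp f 2 (μ.restrict s))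
    (ht : MemLp f 2 (μ.restrict t)) : MemLp f 2 (μ.restrict (s ∪ t)) :=
  (hs.two_add_measure ht).mono_measure (Measure.restrict_union_le s t)

theorem ThinDomain.MemL2Loc.mono {n : ℕ} {F : Type*} [NormedAddCommGroup F] {ν : Measure (Euc n)}
    {S T : Set (Euc n)} {f : Euc n → F} (h : MemL2Loc ν S f) (hT : T ⊆ S) : MemL2Loc ν T f :=
  fun K hK hKT => h K hK (hKT.trans hT)

theorem ThinDomain.MemL2Loc.congr_ae {n : ℕ} {F : Type*} [NormedAddCommGroup F]
    {ν : Measure (Euc n)} {S : Set (Euc n)} {f f' : Euc n → F} (h : MemL2Loc ν S f)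
    (hf : f =ᵐ[ν.restrict S] f') : MemL2Loc ν S f' :=
  fun K hK hKS => (h K hK hKS).ae_eq (ae_restrict_of_ae_restrict_of_subset hKS hf)

/-- Local square integrability may be checked near each point. -/
theorem memL2Loc_of_forall_mem {n : ℕ} {F : Type*} [NormedAddCommGroup F] {ν : Measure (Euc n)}
    {S : Set (Euc n)} {f : Euc n → F}
    (h : ∀ x ∈ S, ∃ V ∈ 𝓝[S] x, MemLp f 2 (ν.restrict V)) : MemL2Loc ν S f := by
  intro K hK hKS
  refine hK.induction_on (p := fun s => MemLp f 2 (ν.restrict s)) ?_ ?_ ?_ ?_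
  · simp
  · exact fun s t hst ht => ht.mono_measure (Measure.restrict_mono hst le_rfl)
  · exact fun s t hs ht => hs.two_union ht
  · intro x hx
    obtain ⟨V, hV, hf⟩ := h x (hKS hx)
    exact ⟨V, nhdsWithin_mono x hKS hV, hf⟩

theorem ContinuousOn.memLp_restrict_of_isCompact {n : ℕ} {F : Type*} [NormedAddCommGroup F]
    {K : Set (Euc n)} (hK : IsCompact K) {f : Euc n → F} (hf : ContinuousOn f K) :
    MemLp f 2 (volume.restrict K) := by
  have : IsFiniteMeasure (volume.restrict K) := ⟨by simpa using hK.measure_lt_top⟩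
  obtain ⟨C, hC⟩ := hK.exists_bound_of_continuousOn hf
  exact MemLp.of_bound (hf.aestronglyMeasurable_of_isCompact hK hK.measurableSet) C
    ((ae_restrict_mem hK.measurableSet).mono hC)

theorem ContinuousOn.memL2Loc {n : ℕ} {F : Type*} [NormedAddCommGroup F]
    {Ω : Set (Euc n)} {f : Euc n → F} (hf : ContinuousOn f Ω) : MemL2Loc volume Ω f :=
  fun _ hK hKΩ => (hf.mono hKΩ).memLp_restrict_of_isCompact hK

/-- The product of a locally integrable function and a continuous function with compact support. -/
theorem integrable_mul_of_tsupport_subset {n : ℕ} {Ω : Set (Euc n)} {f θ : Euc n → ℝ}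
    (hf : MemL2Loc volume Ω f) (hθ : Continuous θ) (hc : HasCompactSupport θ)
    (hs : tsupport θ ⊆ Ω) : Integrable (fun x => f x * θ x) := by
  have h1 : IntegrableOn (fun x => f x * θ x) (tsupport θ) :=
    (MemLp.integrable_of_isCompact hc.isCompact (hf _ hc.isCompact hs)).mul_continuousOn
      hθ.continuousOn hc.isCompact
  refine (integrableOn_iff_integrable_of_support_subset fun x hx => ?_).1 h1
  refine subset_tsupport _ fun h0 => hx ?_
  simp [h0]

theorem setIntegral_eq_integral_mul_of_tsupport_subset {n : ℕ} {Ω : Set (Euc n)} {f θ : Euc n → ℝ}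
    (hs : tsupport θ ⊆ Ω) : ∫ x in Ω, f x * θ x = ∫ x, f x * θ x := by
  refine setIntegral_eq_integral_of_forall_compl_eq_zero fun x hx => ?_
  rw [image_eq_zero_of_notMem_tsupport fun h => hx (hs h), mul_zero]

/-- The defining identity of the weak gradient, as an identity between integrals over the whole
space. -/
theorem hasWeakGradient_iff {n : ℕ} {Ω : Set (Euc n)} {u : Euc n → ℝ} {g : Euc n → Euc n} :
    HasWeakGradient Ω u g ↔ MemL2Loc volume Ω u ∧ MemL2Loc volume Ω g ∧
      ∀ ψ : Euc n → ℝ, ContDiff ℝ ∞ ψ → HasCompactSupport ψ → tsupport ψ ⊆ Ω →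
        ∀ h : Euc n, ∫ x, u x * fderiv ℝ ψ x h = - ∫ x, ⟪g x, h⟫_ℝ * ψ x := by
  have key : ∀ ψ : Euc n → ℝ, tsupport ψ ⊆ Ω → ∀ h : Euc n,
      (∫ x in Ω, u x * fderiv ℝ ψ x h = - ∫ x in Ω, ⟪g x, h⟫_ℝ * ψ x) ↔
      ∫ x, u x * fderiv ℝ ψ x h = - ∫ x, ⟪g x, h⟫_ℝ * ψ x := fun ψ hs h => by
    rw [setIntegral_eq_integral_mul_of_tsupport_subset hs,
      setIntegral_eq_integral_mul_of_tsupport_subset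
        ((tsupport_fderiv_apply_subset ℝ h (f := ψ)).trans hs)]
  constructor
  · exact fun H => ⟨H.1, H.2, fun ψ h1 h2 h3 h => (key ψ h3 h).1 (H.3 ψ h1 h2 h3 h)⟩
  · exact fun H => ⟨H.1, H.2.1, fun ψ h1 h2 h3 h => (key ψ h3 h).2 (H.2.2 ψ h1 h2 h3 h)⟩

namespace ThinDomain.HasWeakGradient

variable {n : ℕ} {Ω : Set (Euc n)} {u : Euc n → ℝ} {g : Euc n → Euc n}

theorem mono (H : HasWeakGradient Ω u g) {Ω' : Set (Euc n)} (h : Ω' ⊆ Ω) :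
    HasWeakGradient Ω' u g := by
  rw [hasWeakGradient_iff] at H ⊢
  exact ⟨H.1.mono h, H.2.1.mono h, fun ψ h1 h2 h3 => H.2.2 ψ h1 h2 (h3.trans h)⟩

theorem congr_ae (H : HasWeakGradient Ω u g) {u' : Euc n → ℝ} {g' : Euc n → Euc n}
    (hu : u =ᵐ[volume.restrict Ω] u') (hg : g =ᵐ[volume.restrict Ω] g') :
    HasWeakGradient Ω u' g' := by
  refine ⟨H.1.congr_ae hu, H.2.congr_ae hg, fun ψ h1 h2 h3 h => ?_⟩
  have := H.3 ψ h1 h2 h3 h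
  rw [integral_congr_ae (hu.mono fun x hx => show u x * fderiv ℝ ψ x h = u' x * _ by rw [hx]),
    integral_congr_ae (hg.mono fun x hx => show ⟪g x, h⟫_ℝ * ψ x = ⟪g' x, h⟫_ℝ * _ by rw [hx])]
    at this
  exact this

theorem memL2Loc_inner (hg : MemL2Loc volume Ω g) (h : Euc n) :
    MemL2Loc volume Ω (fun x => ⟪g x, h⟫_ℝ) := by
  intro K hK hKΩ
  simpa only [real_inner_comm] using (hg K hK hKΩ).const_inner h

theorem integrable_mul_fderiv (hu : MemL2Loc volume Ω u) {ψ : Euc n → ℝ} (h1 : ContDiff ℝ ∞ ψ)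
    (h2 : HasCompactSupport ψ) (h3 : tsupport ψ ⊆ Ω) (h : Euc n) :
    Integrable (fun x => u x * fderiv ℝ ψ x h) := by
  refine integrable_mul_of_tsupport_subset hu ?_ ?_ ((tsupport_fderiv_apply_subset ℝ h (f := ψ)).trans h3)
  · exact (h1.continuous_fderiv (by simp)).clm_apply continuous_const
  · exact h2.mono' ((subset_tsupport _).trans (tsupport_fderiv_apply_subset ℝ h (f := ψ)))

/-- Weak gradients are unique. -/
theorem ae_eq (hΩ : IsOpen Ω) (H : HasWeakGradient Ω u g) {g' : Euc n → Euc n}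
    (H' : HasWeakGradient Ω u g') : g =ᵐ[volume.restrict Ω] g' := by
  have hl := (H.2.locallyIntegrableOn hΩ).sub (H'.2.locallyIntegrableOn hΩ)
  have key : ∀ᵐ x, x ∈ Ω → (g - g') x = 0 := by
    refine hΩ.ae_eq_zero_of_integral_contDiff_smul_eq_zero hl fun ψ h1 h2 h3 => ?_
    refine ext_inner_left ℝ fun h => ?_
    have e1 := (hasWeakGradient_iff.1 H).2.2 ψ h1 h2 h3 h
    have e2 := (hasWeakGradient_iff.1 H').2.2 ψ h1 h2 h3 h
    have i1 := integrable_mul_of_tsupport_subset (memL2Loc_inner H.2 h) h1.continuous h2 h3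
    have i2 := integrable_mul_of_tsupport_subset (memL2Loc_inner H'.2 h) h1.continuous h2 h3
    have hK : IntegrableOn (fun x => ψ x • (g - g') x) (tsupport ψ) :=
      ((MemLp.integrable_of_isCompact h2.isCompact (H.2 _ h2.isCompact h3)).sub
        (MemLp.integrable_of_isCompact h2.isCompact (H'.2 _ h2.isCompact h3))).continuousOn_smul
        h1.continuous.continuousOn h2.isCompact
    have hI : Integrable (fun x => ψ x • (g - g') x) := by
      refine (integrableOn_iff_integrable_of_support_subset fun x hx => ?_).1 hK
      exact subset_tsupport _ fun h0 => hx (by simp [h0])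
    rw [← integral_inner hI h, inner_zero_right]
    have : ∀ x, ⟪h, ψ x • (g - g') x⟫_ℝ = ⟪g x, h⟫_ℝ * ψ x - ⟪g' x, h⟫_ℝ * ψ x := fun x => by
      rw [inner_smul_right, Pi.sub_apply, inner_sub_right, real_inner_comm, real_inner_comm h (g' x)]
      ring
    simp only [this]
    rw [integral_sub i1 i2]
    linarith
  rw [EventuallyEq, ae_restrict_iff' hΩ.measurableSet]
  exact key.mono fun x hx hxΩ => sub_eq_zero.1 (hx hxΩ)

/-- A function of class `C¹` is weakly differentiable. -/
theorem of_contDiffOn (hΩ : IsOpen Ω) (hu : ContDiffOn ℝ 1 u Ω) :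
    HasWeakGradient Ω u (∇ u) := by
  have hd : ContinuousOn (fderiv ℝ u) Ω := hu.continuousOn_fderiv_of_isOpen hΩ le_rfl
  have hg : ContinuousOn (∇ u) Ω :=
    (InnerProductSpace.toDual ℝ (Euc n)).symm.continuous.comp_continuousOn hd
  have h1 := hu.continuousOn.memL2Loc
  have h2 := hg.memL2Loc
  rw [hasWeakGradient_iff]
  refine ⟨h1, h2, fun ψ hψ hc hs h => ?_⟩
  simp only [inner_gradient_left]
  refine integral_mul_fderiv_eq_neg_fderiv_mul_of_integrable ?_ ?_ ?_ ?_ ?_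
  · simpa only [inner_gradient_left] using
      integrable_mul_of_tsupport_subset (memL2Loc_inner h2 h) hψ.continuous hc hs
  · exact integrable_mul_fderiv h1 hψ hc hs h
  · exact integrable_mul_of_tsupport_subset h1 hψ.continuous hc hs
  · exact fun x hx => (hu.contDiffAt (hΩ.mem_nhds (hs hx))).differentiableAt one_ne_zero
  · exact fun x _ => (hψ.differentiable (by simp)) x

/-- The weak gradient is a closed operator. -/
theorem of_tendsto (hu : MemL2Loc volume Ω u) (hg : MemL2Loc volume Ω g)
    {f : ℕ → Euc n → ℝ} {f' : ℕ → Euc n → Euc n} (hf : ∀ i, HasWeakGradient Ω (f i) (f' i))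
    (h1 : ∀ K, IsCompact K → K ⊆ Ω → Tendsto (fun i => ∫⁻ x in K, ‖f i x - u x‖ₑ) atTop (𝓝 0))
    (h2 : ∀ K, IsCompact K → K ⊆ Ω → Tendsto (fun i => ∫⁻ x in K, ‖f' i x - g x‖ₑ) atTop (𝓝 0)) :
    HasWeakGradient Ω u g := by
  -- Test functions are bounded with compact support, so local `L¹` convergence is enough to pass to
  -- the limit.
  have key : ∀ (F : ℕ → Euc n → ℝ) (v θ : Euc n → ℝ), (∀ i, MemL2Loc volume Ω (F i)) →
      MemL2Loc volume Ω v → Continuous θ → HasCompactSupport θ → tsupport θ ⊆ Ω →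
      Tendsto (fun i => ∫⁻ x in tsupport θ, ‖F i x - v x‖ₑ) atTop (𝓝 0) →
      Tendsto (fun i => ∫ x, F i x * θ x) atTop (𝓝 (∫ x, v x * θ x)) := by
    intro F v θ hF hv hθ hc hs hlim
    refine tendsto_integral_of_L1 _
      (integrable_mul_of_tsupport_subset hv hθ hc hs).aestronglyMeasurable
      (Eventually.of_forall fun i => integrable_mul_of_tsupport_subset (hF i) hθ hc hs) ?_
    obtain ⟨C, hC⟩ := hc.exists_bound_of_continuous hθ
    have hl : Tendsto (fun i => ENNReal.ofReal C * ∫⁻ x in tsupport θ, ‖F i x - v x‖ₑ) atTop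
        (𝓝 0) := by
      simpa using ENNReal.Tendsto.const_mul hlim (Or.inr ENNReal.ofReal_ne_top)
    refine tendsto_of_tendsto_of_tendsto_of_le_of_le tendsto_const_nhds hl (fun _ => zero_le)
      fun i => ?_
    rw [← lintegral_const_mul' _ _ ENNReal.ofReal_ne_top,
      ← lintegral_indicator (isClosed_tsupport θ).measurableSet]
    refine lintegral_mono fun x => ?_
    by_cases hx : x ∈ tsupport θ
    · rw [indicator_of_mem hx, ← sub_mul, enorm_mul, mul_comm]
      gcongr
      rw [← ofReal_norm]
      exact ENNReal.ofReal_le_ofReal (hC x)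
    · rw [image_eq_zero_of_notMem_tsupport hx]; simp
  rw [hasWeakGradient_iff]
  refine ⟨hu, hg, fun ψ hψ hc hs h => ?_⟩
  have hs' := (tsupport_fderiv_apply_subset ℝ h (f := ψ)).trans hs
  have hc' : HasCompactSupport (fun x => fderiv ℝ ψ x h) :=
    hc.mono' ((subset_tsupport _).trans (tsupport_fderiv_apply_subset ℝ h (f := ψ)))
  have l1 := key f u _ (fun i => (hf i).1) hu
    ((hψ.continuous_fderiv (by simp)).clm_apply (continuous_const (y := h))) hc' hs'
    (h1 _ hc'.isCompact hs')
  have l2 := key (fun i x => ⟪f' i x, h⟫_ℝ) _ ψ (fun i => memL2Loc_inner (hf i).2 h)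
    (memL2Loc_inner hg h) hψ.continuous hc hs (by
      have hl : Tendsto (fun i => ‖h‖ₑ * ∫⁻ x in tsupport ψ, ‖f' i x - g x‖ₑ) atTop (𝓝 0) := by
        simpa using ENNReal.Tendsto.const_mul (h2 _ hc.isCompact hs) (Or.inr enorm_ne_top)
      refine tendsto_of_tendsto_of_tendsto_of_le_of_le tendsto_const_nhds hl (fun _ => zero_le)
        fun i => ?_
      rw [← lintegral_const_mul' _ _ enorm_ne_top]
      refine lintegral_mono fun x => ?_
      rw [← inner_sub_left, mul_comm, ← ofReal_norm, ← ofReal_norm, ← ofReal_norm,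
        ← ENNReal.ofReal_mul (norm_nonneg _)]
      exact ENNReal.ofReal_le_ofReal (norm_inner_le_norm _ _))
  refine tendsto_nhds_unique l1 (l2.neg.congr fun i => ?_)
  exact ((hasWeakGradient_iff.1 (hf i)).2.2 ψ hψ hc hs h).symm

/-- Weak differentiability is a local property. -/
theorem of_forall_mem (h : ∀ x ∈ Ω, ∃ N, IsOpen N ∧ x ∈ N ∧ HasWeakGradient N u g) :
    HasWeakGradient Ω u g := by
  have hloc : ∀ x ∈ Ω, ∃ V ∈ 𝓝[Ω] x, MemLp u 2 (volume.restrict V) ∧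
      MemLp g 2 (volume.restrict V) := by
    intro x hx
    obtain ⟨N, hN, hxN, H⟩ := h x hx
    obtain ⟨ε, hε, hεN⟩ := Metric.nhds_basis_closedBall.mem_iff.1 (hN.mem_nhds hxN)
    exact ⟨_, mem_nhdsWithin_of_mem_nhds (closedBall_mem_nhds x hε),
      H.1 _ (isCompact_closedBall x ε) hεN, H.2 _ (isCompact_closedBall x ε) hεN⟩
  have hu : MemL2Loc volume Ω u :=
    memL2Loc_of_forall_mem fun x hx => let ⟨V, h1, h2, _⟩ := hloc x hx; ⟨V, h1, h2⟩
  have hg : MemL2Loc volume Ω g :=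
    memL2Loc_of_forall_mem fun x hx => let ⟨V, h1, _, h2⟩ := hloc x hx; ⟨V, h1, h2⟩
  rw [hasWeakGradient_iff]
  refine ⟨hu, hg, fun ψ hψ hc hs v => ?_⟩
  choose! N hNo hxN hN using h
  -- A partition of unity on the support of `ψ` splits `ψ` into test functions, each supported in
  -- one of the sets `N`; by compactness only finitely many are nonzero.
  obtain ⟨ρ, hρ⟩ := SmoothPartitionOfUnity.exists_isSubordinate (modelWithCornersSelf ℝ (Euc n))
    (isClosed_tsupport ψ) (fun x : tsupport ψ => N x) (fun x => hNo x (hs x.2))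
    (fun x hx => mem_iUnion.2 ⟨⟨x, hx⟩, hxN x (hs hx)⟩)
  set I := (ρ.locallyFinite.finite_nonempty_inter_compact hc.isCompact).toFinset
  have hρs : ∀ i, ContDiff ℝ ∞ (ρ i) := fun i => (ρ i).contMDiff.contDiff
  have hsum : ∀ x, ψ x = ∑ i ∈ I, ρ i x * ψ x := by
    intro x
    by_cases hx : x ∈ tsupport ψ
    · have : ∑ i ∈ I, ρ i x = 1 := by
        rw [← ρ.sum_eq_one hx, finsum_eq_sum_of_support_subset]
        intro i hi
        simp only [I, Finite.coe_toFinset, mem_ofPred_eq]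
        exact ⟨x, hi, hx⟩
      rw [← Finset.sum_mul, this, one_mul]
    · simp [image_eq_zero_of_notMem_tsupport hx]
  set χ : tsupport ψ → Euc n → ℝ := fun i x => ρ i x * ψ x
  have hχ : ∀ i, ContDiff ℝ ∞ (χ i) := fun i => (hρs i).mul hψ
  have hχc : ∀ i, HasCompactSupport (χ i) := fun i => hc.mul_left
  have hχs : ∀ i, tsupport (χ i) ⊆ N i := fun i => (tsupport_mul_subset_left).trans (hρ i)
  have hχΩ : ∀ i, tsupport (χ i) ⊆ Ω := fun i => (tsupport_mul_subset_right).trans hs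
  have hd : ∀ x, fderiv ℝ ψ x v = ∑ i ∈ I, fderiv ℝ (χ i) x v := by
    intro x
    have : ψ = fun x => ∑ i ∈ I, χ i x := funext hsum
    conv_lhs => rw [this]
    rw [fderiv_fun_sum fun i _ => ((hχ i).differentiable (by simp)) x]
    simp
  have e1 : ∫ x, u x * fderiv ℝ ψ x v = ∑ i ∈ I, ∫ x, u x * fderiv ℝ (χ i) x v := by
    rw [← integral_finsetSum _ fun i _ => integrable_mul_fderiv hu (hχ i) (hχc i) (hχΩ i) v]
    simp only [hd, Finset.mul_sum]
  have e2 : ∫ x, ⟪g x, v⟫_ℝ * ψ x = ∑ i ∈ I, ∫ x, ⟪g x, v⟫_ℝ * χ i x := by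
    rw [← integral_finsetSum _ fun i _ => integrable_mul_of_tsupport_subset (memL2Loc_inner hg v)
      (hχ i).continuous (hχc i) (hχΩ i)]
    refine integral_congr_ae (Eventually.of_forall fun x => ?_)
    simp only
    rw [← Finset.mul_sum, ← hsum]
  rw [e1, e2, ← Finset.sum_neg_distrib]
  exact Finset.sum_congr rfl fun i _ =>
    (hasWeakGradient_iff.1 (hN i (hs i.2))).2.2 _ (hχ i) (hχc i) (hχs i) v

end ThinDomain.HasWeakGradient

/-! ### Composition with maps of bounded distortion -/

section Pushforward

variable {X Y : Type*} [MeasurableSpace X] [MeasurableSpace Y] {κ : Measure X} {ν : Measure Y}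
  {Ψ : X → Y} {C : ℝ≥0∞}

/-- The one-sided bound on the image measure stands in for a change of variables formula: it
controls integrals, `L²` membership and null sets, and requires no Jacobian. -/
theorem lintegral_comp_le_of_map_le (hΨ : AEMeasurable Ψ κ) (hC : κ.map Ψ ≤ C • ν)
    {F : Y → ℝ≥0∞} (hF : AEMeasurable F ν) : ∫⁻ q, F (Ψ q) ∂κ ≤ C * ∫⁻ x, F x ∂ν := by
  rw [← lintegral_map' (hF.mono_ac (Measure.absolutelyContinuous_of_le_smul hC)) hΨ,
    ← smul_eq_mul, ← lintegral_smul_measure]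
  exact lintegral_mono' hC le_rfl

theorem MeasureTheory.MemLp.comp_of_map_le {F : Type*} [NormedAddCommGroup F]
    (hΨ : AEMeasurable Ψ κ) (hC : κ.map Ψ ≤ C • ν) (hC' : C ≠ ⊤) {f : Y → F} {p : ℝ≥0∞}
    (hf : MemLp f p ν) : MemLp (fun q => f (Ψ q)) p κ := by
  have h1 : MemLp f p (κ.map Ψ) := hf.of_measure_le_smul hC' hC
  exact (memLp_map_measure_iff h1.1 hΨ).1 h1

theorem MeasureTheory.AEStronglyMeasurable.comp_of_map_le {F : Type*} [NormedAddCommGroup F]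
    (hΨ : AEMeasurable Ψ κ) (hC : κ.map Ψ ≤ C • ν) {f : Y → F}
    (hf : AEStronglyMeasurable f ν) : AEStronglyMeasurable (fun q => f (Ψ q)) κ :=
  (hf.mono_ac (Measure.absolutelyContinuous_of_le_smul hC)).comp_aemeasurable hΨ

theorem map_restrict_le_smul_restrict {N : Set X} {K : Set Y} (hΨ : AEMeasurable Ψ (κ.restrict N))
    (hN : MeasurableSet N) (hK : MeasurableSet K) (hNK : MapsTo Ψ N K)
    (h : ∀ E, MeasurableSet E → κ (N ∩ Ψ ⁻¹' E) ≤ C * ν E) :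
    (κ.restrict N).map Ψ ≤ C • ν.restrict K := by
  refine Measure.le_iff.2 fun E hE => ?_
  rw [Measure.map_apply_of_aemeasurable hΨ hE, Measure.restrict_apply₀' hN.nullMeasurableSet,
    Measure.smul_apply, Measure.restrict_apply hE, smul_eq_mul]
  refine (measure_mono fun x hx => ?_).trans (h _ (hE.inter hK))
  exact ⟨hx.2, hx.1, hNK hx.2⟩

end Pushforward

theorem MeasureTheory.MemLp.clm_apply_of_bound {X E F : Type*} [MeasurableSpace X]
    [NormedAddCommGroup E] [NormedSpace ℝ E] [NormedAddCommGroup F] [NormedSpace ℝ F]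
    {κ : Measure X} {A : X → E →L[ℝ] F} (hA : AEStronglyMeasurable A κ) {c : ℝ}
    (hc : ∀ᵐ x ∂κ, ‖A x‖ ≤ c) {f : X → E} {p : ℝ≥0∞} (hf : MemLp f p κ) :
    MemLp (fun x => A x (f x)) p κ := by
  refine hf.of_le_mul (c := c) ?_ (hc.mono fun x hx => ?_)
  · exact (ContinuousLinearMap.id ℝ (E →L[ℝ] F)).aestronglyMeasurable_comp₂ hA hf.1
  · exact ((A x).le_opNorm _).trans (by gcongr)

theorem gradient_comp_eq_adjoint {m n : ℕ} {f : Euc n → ℝ} {θ : Euc m → Euc n} {x : Euc m}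
    (hf : DifferentiableAt ℝ f (θ x)) (hθ : DifferentiableAt ℝ θ x) :
    ∇ (fun y => f (θ y)) x = ContinuousLinearMap.adjoint (fderiv ℝ θ x) (∇ f (θ x)) := by
  refine ext_inner_right ℝ fun v => ?_
  rw [inner_gradient_left, ContinuousLinearMap.adjoint_inner_left, inner_gradient_left]
  have := (hf.hasFDerivAt.comp x hθ.hasFDerivAt).fderiv
  rw [show (fun y => f (θ y)) = f ∘ θ from rfl, this]; rfl

/-- Chain rule for a weakly differentiable function and a map of class `C¹` under which preimages
of small sets are small. -/
theorem ThinDomain.HasWeakGradient.comp {m n : ℕ} {N : Set (Euc m)} (hN : IsOpen N)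
    {O : Set (Euc n)} (hO : IsOpen O) {θ : Euc m → Euc n} (hθ : ContDiffOn ℝ 1 θ N)
    (hθO : MapsTo θ N O) {C : ℝ≥0∞} (hC : C ≠ ⊤)
    (hpush : ∀ E, MeasurableSet E → volume (N ∩ θ ⁻¹' E) ≤ C * volume E)
    {w : Euc n → ℝ} {γ : Euc n → Euc n} (H : HasWeakGradient O w γ) :
    HasWeakGradient N (fun x => w (θ x))
      (fun x => ContinuousLinearMap.adjoint (fderiv ℝ θ x) (γ (θ x))) := by
  have hd : ContinuousOn (fderiv ℝ θ) N := hθ.continuousOn_fderiv_of_isOpen hN le_rfl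
  have hA : ContinuousOn (fun x => ContinuousLinearMap.adjoint (fderiv ℝ θ x)) N :=
    ContinuousLinearMap.adjoint.continuous.comp_continuousOn hd
  have hmap : ∀ K, IsCompact K → K ⊆ N → AEMeasurable θ (volume.restrict K) ∧
      (volume.restrict K).map θ ≤ C • volume.restrict (θ '' K) := by
    intro K hK hKN
    have hm : AEMeasurable θ (volume.restrict K) :=
      (hθ.continuousOn.mono hKN).aemeasurable hK.measurableSet
    refine ⟨hm, map_restrict_le_smul_restrict hm hK.measurableSet
      (hK.image_of_continuousOn (hθ.continuousOn.mono hKN)).measurableSet (mapsTo_image θ K)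
      fun E hE => ?_⟩
    exact (measure_mono (inter_subset_inter_left _ hKN)).trans (hpush E hE)
  have hb : ∀ K, IsCompact K → K ⊆ N → AEStronglyMeasurable
      (fun x => ContinuousLinearMap.adjoint (fderiv ℝ θ x)) (volume.restrict K) ∧
      ∃ c : ℝ, ∀ x ∈ K, ‖ContinuousLinearMap.adjoint (fderiv ℝ θ x)‖ ≤ c := fun K hK hKN =>
    ⟨(hA.mono hKN).aestronglyMeasurable hK.measurableSet,
      hK.exists_bound_of_continuousOn (hA.mono hKN)⟩
  have hLu : MemL2Loc volume N (fun x => w (θ x)) := by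
    intro K hK hKN
    exact (H.1 _ (hK.image_of_continuousOn (hθ.continuousOn.mono hKN))
      ((image_mono hKN).trans hθO.image_subset)).comp_of_map_le (hmap K hK hKN).1
      (hmap K hK hKN).2 hC
  have hLg : MemL2Loc volume N
      (fun x => ContinuousLinearMap.adjoint (fderiv ℝ θ x) (γ (θ x))) := by
    intro K hK hKN
    obtain ⟨h1, c, h2⟩ := hb K hK hKN
    exact ((H.2 _ (hK.image_of_continuousOn (hθ.continuousOn.mono hKN))
      ((image_mono hKN).trans hθO.image_subset)).comp_of_map_le (hmap K hK hKN).1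
      (hmap K hK hKN).2 hC).clm_apply_of_bound h1 ((ae_restrict_mem hK.measurableSet).mono h2)
  -- By locality a ball with closure in `N` suffices. The image of the closed ball is compact, so
  -- `w` has smooth approximations there; they obey the classical chain rule, which survives the
  -- limit.
  refine HasWeakGradient.of_forall_mem fun x hx => ?_
  obtain ⟨ε, hε, hεN⟩ := Metric.nhds_basis_closedBall.mem_iff.1 (hN.mem_nhds hx)
  refine ⟨ball x ε, isOpen_ball, mem_ball_self hε, ?_⟩
  set B := closedBall x ε
  have hB : IsCompact B := isCompact_closedBall x ε
  have hBN : ball x ε ⊆ N := ball_subset_closedBall.trans hεN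
  have hθB : IsCompact (θ '' B) := hB.image_of_continuousOn (hθ.continuousOn.mono hεN)
  have hθBO : θ '' B ⊆ O := (image_mono hεN).trans hθO.image_subset
  obtain ⟨f, hf, hf1, hf2⟩ := H.exists_contDiff_tendsto hO hθB hθBO
  obtain ⟨hm, hle⟩ := hmap B hB hεN
  obtain ⟨hAm, c, hc⟩ := hb B hB hεN
  have hwi := MemLp.integrable_of_isCompact hθB (H.1 _ hθB hθBO)
  have hγi := MemLp.integrable_of_isCompact hθB (H.2 _ hθB hθBO)
  have hfg : ∀ i, Continuous (∇ (f i)) := fun i =>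
    (InnerProductSpace.toDual ℝ (Euc n)).symm.continuous.comp
      ((hf i).continuous_fderiv (by simp))
  refine HasWeakGradient.of_tendsto (hLu.mono hBN) (hLg.mono hBN)
    (f := fun i y => f i (θ y)) (f' := fun i => ∇ (fun y => f i (θ y)))
    (fun i => HasWeakGradient.of_contDiffOn isOpen_ball
      (((hf i).of_le (by simp)).comp_contDiffOn (hθ.mono hBN))) ?_ ?_
  · intro K hK hKB
    have hl : Tendsto (fun i => C * ∫⁻ y in θ '' B, ‖f i y - w y‖ₑ) atTop (𝓝 0) := by
      simpa using ENNReal.Tendsto.const_mul hf1 (Or.inr hC)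
    refine tendsto_of_tendsto_of_tendsto_of_le_of_le tendsto_const_nhds hl (fun _ => zero_le)
      fun i => ?_
    refine (lintegral_mono_set (hKB.trans ball_subset_closedBall)).trans ?_
    exact lintegral_comp_le_of_map_le (F := fun y => ‖f i y - w y‖ₑ) hm hle
      ((hf i).continuous.aestronglyMeasurable.sub hwi.aestronglyMeasurable).enorm
  · intro K hK hKB
    have hl : Tendsto (fun i => ENNReal.ofReal c * (C * ∫⁻ y in θ '' B, ‖∇ (f i) y - γ y‖ₑ)) atTop
        (𝓝 0) := by
      simpa using ENNReal.Tendsto.const_mul (ENNReal.Tendsto.const_mul hf2 (Or.inr hC))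
        (Or.inr ENNReal.ofReal_ne_top)
    refine tendsto_of_tendsto_of_tendsto_of_le_of_le tendsto_const_nhds hl (fun _ => zero_le)
      fun i => ?_
    refine (lintegral_mono_set (hKB.trans ball_subset_closedBall)).trans ?_
    calc _ ≤ ∫⁻ y in B, ENNReal.ofReal c * ‖∇ (f i) (θ y) - γ (θ y)‖ₑ := by
          refine setLIntegral_mono' hB.measurableSet fun y hy => ?_
          rw [gradient_comp_eq_adjoint ((hf i).differentiable (by simp) _)
            ((hθ.contDiffAt (hN.mem_nhds (hεN hy))).differentiableAt one_ne_zero), ← map_sub,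
            ← ofReal_norm, ← ofReal_norm, ← ENNReal.ofReal_mul' (norm_nonneg _)]
          refine ENNReal.ofReal_le_ofReal ((ContinuousLinearMap.le_opNorm _ _).trans ?_)
          gcongr; exact hc y hy
      _ = ENNReal.ofReal c * ∫⁻ y in B, ‖∇ (f i) (θ y) - γ (θ y)‖ₑ :=
          lintegral_const_mul' _ _ ENNReal.ofReal_ne_top
      _ ≤ _ := by
          gcongr
          exact lintegral_comp_le_of_map_le (F := fun y => ‖∇ (f i) y - γ y‖ₑ) hm hle
            ((hfg i).aestronglyMeasurable.sub hγi.aestronglyMeasurable).enorm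

/-! ### Slices of weakly differentiable functions -/

/-- `Ψ` maps the product `A × B` of open sets to the compact set `K` by a Lipschitz map of class
`C¹`, such that preimages of small sets are small. -/
structure IsSlicing {k d l : ℕ} (A : Set (Euc k)) (B : Set (Euc d)) (K : Set (Euc l))
    (Ψ : Euc k × Euc d → Euc l) (L : ℝ≥0) (C : ℝ≥0∞) : Prop where
  isOpen_left : IsOpen A
  isOpen_right : IsOpen B
  convex_right : Convex ℝ B
  contDiffOn : ContDiffOn ℝ 1 Ψ (A ×ˢ B)
  lipschitzOnWith : LipschitzOnWith L Ψ (A ×ˢ B)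
  isCompact : IsCompact K
  mapsTo : MapsTo Ψ (A ×ˢ B) K
  ne_top : C ≠ ⊤
  measure_le : ∀ E, MeasurableSet E → volume (A ×ˢ B ∩ Ψ ⁻¹' E) ≤ C * volume E

namespace IsSlicing

variable {k d l : ℕ} {A : Set (Euc k)} {B : Set (Euc d)} {K : Set (Euc l)}
    {Ψ : Euc k × Euc d → Euc l} {L : ℝ≥0} {C : ℝ≥0∞}

theorem isOpen (S : IsSlicing A B K Ψ L C) : IsOpen (A ×ˢ B) := S.isOpen_left.prod S.isOpen_right

theorem aemeasurable (S : IsSlicing A B K Ψ L C) :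
    AEMeasurable Ψ (volume.restrict (A ×ˢ B)) :=
  S.contDiffOn.continuousOn.aemeasurable S.isOpen.measurableSet

theorem map_le (S : IsSlicing A B K Ψ L C) :
    (volume.restrict (A ×ˢ B)).map Ψ ≤ C • volume.restrict K :=
  map_restrict_le_smul_restrict S.aemeasurable S.isOpen.measurableSet S.isCompact.measurableSet
    S.mapsTo S.measure_le

theorem volume_restrict (A : Set (Euc k)) (B : Set (Euc d)) :
    (volume : Measure (Euc k × Euc d)).restrict (A ×ˢ B)
      = (volume.restrict A).prod (volume.restrict B) :=
  (Measure.prod_restrict A B).symm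

theorem differentiableAt (S : IsSlicing A B K Ψ L C) {q : Euc k × Euc d} (hq : q ∈ A ×ˢ B) :
    DifferentiableAt ℝ Ψ q :=
  (S.contDiffOn.contDiffAt (S.isOpen.mem_nhds hq)).differentiableAt one_ne_zero

theorem norm_fderiv_le (S : IsSlicing A B K Ψ L C) {q : Euc k × Euc d} (hq : q ∈ A ×ˢ B) :
    ‖fderiv ℝ Ψ q‖ ≤ L :=
  norm_fderiv_le_of_lipschitzOn ℝ (S.isOpen.mem_nhds hq) S.lipschitzOnWith

theorem hasFDerivAt_left (S : IsSlicing A B K Ψ L C) {ξ : Euc k} {b : Euc d} (hξ : ξ ∈ A)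
    (hb : b ∈ B) : HasFDerivAt (fun ξ => Ψ (ξ, b))
      ((fderiv ℝ Ψ (ξ, b)).comp (ContinuousLinearMap.inl ℝ (Euc k) (Euc d))) ξ :=
  (S.differentiableAt ⟨hξ, hb⟩).hasFDerivAt.comp ξ (hasFDerivAt_prodMk_left ξ b)

theorem contDiffOn_left (S : IsSlicing A B K Ψ L C) {b : Euc d} (hb : b ∈ B) :
    ContDiffOn ℝ 1 (fun ξ => Ψ (ξ, b)) A :=
  S.contDiffOn.comp ((contDiff_id.prodMk contDiff_const).contDiffOn (s := A))
    (fun _ hξ => ⟨hξ, hb⟩)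

theorem norm_fderiv_left_le (S : IsSlicing A B K Ψ L C) {ξ : Euc k} {b : Euc d} (hξ : ξ ∈ A)
    (hb : b ∈ B) : ‖fderiv ℝ (fun ξ => Ψ (ξ, b)) ξ‖ ≤ L := by
  refine norm_fderiv_le_of_lipschitzOn ℝ (S.isOpen_left.mem_nhds hξ) ?_
  refine LipschitzOnWith.of_dist_le_mul fun x hx y hy => ?_
  refine (S.lipschitzOnWith.dist_le_mul (x, b) ⟨hx, hb⟩ (y, b) ⟨hy, hb⟩).trans ?_
  rw [Prod.dist_eq]; simp

/-- Tonelli for the square of the norm of `f ∘ Ψ`, which is integrable over `A × B`. -/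
theorem memLp_slice {F : Type*} [NormedAddCommGroup F] (S : IsSlicing A B K Ψ L C)
    {f : Euc l → F} (hf : MemLp f 2 (volume.restrict K)) :
    ∀ᵐ b ∂(volume.restrict B), MemLp (fun ξ => f (Ψ (ξ, b))) 2 (volume.restrict A) := by
  have h := hf.comp_of_map_le S.aemeasurable S.map_le S.ne_top
  rw [volume_restrict] at h
  have hfin := h.2
  rw [eLpNorm_lt_top_iff_lintegral_rpow_enorm_lt_top (by norm_num) (by norm_num),
    lintegral_prod_symm _ (h.1.enorm.pow_const _)] at hfin
  have h1 := ae_lt_top' (AEMeasurable.lintegral_prod_left' (h.1.enorm.pow_const _)) hfin.ne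
  filter_upwards [h.1.prodMk_right, h1] with b hb1 hb2
  exact ⟨hb1, (eLpNorm_lt_top_iff_lintegral_rpow_enorm_lt_top (by norm_num) (by norm_num)).2 hb2⟩

/-- Almost every slice of an `L¹`-convergent sequence converges in `L¹`, along a subsequence. -/
theorem exists_subseq_tendsto {X Y : Type*} [MeasurableSpace X] [MeasurableSpace Y]
    {μ : Measure X} {ν : Measure Y} [SFinite μ] [SFinite ν] {F : ℕ → X × Y → ℝ≥0∞}
    (hF : ∀ i, AEMeasurable (F i) (μ.prod ν))
    (h : Tendsto (fun i => ∫⁻ q, F i q ∂(μ.prod ν)) atTop (𝓝 0)) :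
    ∃ ns : ℕ → ℕ, ∀ᵐ y ∂ν, Tendsto (fun i => ∫⁻ x, F (ns i) (x, y) ∂μ) atTop (𝓝 0) := by
  -- Along indices with integrals at most `2⁻ʲ`, the sum of the slice integrals is integrable, hence
  -- finite for almost every slice, so its terms tend to zero.
  have hex : ∀ j : ℕ, ∃ i, ∫⁻ q, F i q ∂(μ.prod ν) ≤ 2⁻¹ ^ j := fun j =>
    (ENNReal.tendsto_nhds_zero.1 h (2⁻¹ ^ j) (ENNReal.pow_pos (by simp) j)).exists
  choose ns hns using hex
  refine ⟨ns, ?_⟩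
  have hm : ∀ j, AEMeasurable (fun y => ∫⁻ x, F (ns j) (x, y) ∂μ) ν := fun j =>
    AEMeasurable.lintegral_prod_left' (hF (ns j))
  have hsum : ∫⁻ y, ∑' j, ∫⁻ x, F (ns j) (x, y) ∂μ ∂ν ≠ ⊤ := by
    rw [lintegral_tsum hm]
    refine ne_top_of_le_ne_top ?_ (ENNReal.tsum_le_tsum fun j => ?_ :
      _ ≤ ∑' j : ℕ, (2⁻¹ : ℝ≥0∞) ^ j)
    · rw [ENNReal.tsum_geometric]; simp
    · rw [← lintegral_prod_symm _ (hF (ns j))]; exact hns j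
  filter_upwards [ae_lt_top' (AEMeasurable.tsum hm) hsum] with y hy
  exact ENNReal.tendsto_atTop_zero_of_tsum_ne_top hy.ne

/-- Chain rule along almost every slice. -/
theorem ae_hasWeakGradient (S : IsSlicing A B K Ψ L C) {Ω : Set (Euc l)} (hΩ : IsOpen Ω)
    (hK : K ⊆ Ω) {u : Euc l → ℝ} {g : Euc l → Euc l} (H : HasWeakGradient Ω u g) :
    ∀ᵐ b ∂(volume.restrict B), HasWeakGradient A (fun ξ => u (Ψ (ξ, b)))
      (fun ξ => ContinuousLinearMap.adjoint (fderiv ℝ (fun ξ => Ψ (ξ, b)) ξ) (g (Ψ (ξ, b)))) := by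
  obtain ⟨f, hf, hf1, hf2⟩ := H.exists_contDiff_tendsto hΩ S.isCompact hK
  have hu := H.1 _ S.isCompact hK
  have hg := H.2 _ S.isCompact hK
  have hfg : ∀ i, Continuous (∇ (f i)) := fun i =>
    (InnerProductSpace.toDual ℝ (Euc l)).symm.continuous.comp
      ((hf i).continuous_fderiv (by simp))
  have m1 : ∀ i, AEStronglyMeasurable (fun y => f i y - u y) (volume.restrict K) := fun i =>
    (hf i).continuous.aestronglyMeasurable.sub hu.1
  have m2 : ∀ i, AEStronglyMeasurable (fun y => ∇ (f i) y - g y) (volume.restrict K) := fun i =>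
    (hfg i).aestronglyMeasurable.sub hg.1
  have c1 := fun i => (m1 i).comp_of_map_le S.aemeasurable S.map_le
  have c2 := fun i => (m2 i).comp_of_map_le S.aemeasurable S.map_le
  -- The errors of function and gradient are added so that a single subsequence serves both.
  have hlim : Tendsto (fun i => ∫⁻ q in A ×ˢ B,
      (‖f i (Ψ q) - u (Ψ q)‖ₑ + ‖∇ (f i) (Ψ q) - g (Ψ q)‖ₑ)) atTop (𝓝 0) := by
    have hl : Tendsto (fun i => C * (∫⁻ y in K, ‖f i y - u y‖ₑ)
        + C * ∫⁻ y in K, ‖∇ (f i) y - g y‖ₑ) atTop (𝓝 0) := by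
      simpa using (ENNReal.Tendsto.const_mul hf1 (Or.inr S.ne_top)).add
        (ENNReal.Tendsto.const_mul hf2 (Or.inr S.ne_top))
    refine tendsto_of_tendsto_of_tendsto_of_le_of_le tendsto_const_nhds hl (fun _ => zero_le)
      fun i => ?_
    simp only
    rw [lintegral_add_left' (c1 i).enorm]
    exact add_le_add
      (lintegral_comp_le_of_map_le (F := fun y => ‖f i y - u y‖ₑ) S.aemeasurable S.map_le
        (m1 i).enorm)
      (lintegral_comp_le_of_map_le (F := fun y => ‖∇ (f i) y - g y‖ₑ) S.aemeasurable S.map_le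
        (m2 i).enorm)
  rw [volume_restrict] at hlim
  simp only [volume_restrict] at c1 c2
  obtain ⟨ns, hns⟩ := exists_subseq_tendsto (fun i => (c1 i).enorm.add (c2 i).enorm) hlim
  filter_upwards [hns, S.memLp_slice hu, S.memLp_slice hg, ae_restrict_mem S.isOpen_right.measurableSet]
    with b hb hub hgb hbB
  have hC1 := S.contDiffOn_left hbB
  have hAc : ContinuousOn (fun ξ => ContinuousLinearMap.adjoint (fderiv ℝ (fun ξ => Ψ (ξ, b)) ξ)) A :=
    ContinuousLinearMap.adjoint.continuous.comp_continuousOn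
      (hC1.continuousOn_fderiv_of_isOpen S.isOpen_left le_rfl)
  have hbd : ∀ ξ ∈ A, ‖ContinuousLinearMap.adjoint (fderiv ℝ (fun ξ => Ψ (ξ, b)) ξ)‖ ≤ L := by
    intro ξ hξ
    rw [LinearIsometryEquiv.norm_map]
    exact S.norm_fderiv_left_le hξ hbB
  have hmA : MeasurableSet A := S.isOpen_left.measurableSet
  refine HasWeakGradient.of_tendsto (f := fun i ξ => f (ns i) (Ψ (ξ, b)))
    (f' := fun i => ∇ (fun ξ => f (ns i) (Ψ (ξ, b)))) ?_ ?_ (fun i =>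
      HasWeakGradient.of_contDiffOn S.isOpen_left
        (((hf (ns i)).of_le (by simp)).comp_contDiffOn hC1)) ?_ ?_
  · exact fun K hK hKA => hub.mono_measure (Measure.restrict_mono hKA le_rfl)
  · exact fun K hK hKA => (hgb.clm_apply_of_bound (hAc.aestronglyMeasurable hmA)
      ((ae_restrict_mem hmA).mono hbd)).mono_measure (Measure.restrict_mono hKA le_rfl)
  · intro K' _ hK'
    refine tendsto_of_tendsto_of_tendsto_of_le_of_le tendsto_const_nhds hb (fun _ => zero_le)
      fun i => ?_
    exact (lintegral_mono_set hK').trans (lintegral_mono fun ξ => le_self_add (a := ‖f (ns i) (Ψ (ξ, b)) - u (Ψ (ξ, b))‖ₑ))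
  · intro K' _ hK'
    have hl : Tendsto (fun i => (L : ℝ≥0∞) * ∫⁻ ξ in A, (‖f (ns i) (Ψ (ξ, b)) - u (Ψ (ξ, b))‖ₑ
        + ‖∇ (f (ns i)) (Ψ (ξ, b)) - g (Ψ (ξ, b))‖ₑ)) atTop (𝓝 0) := by
      simpa using ENNReal.Tendsto.const_mul hb (Or.inr ENNReal.coe_ne_top)
    refine tendsto_of_tendsto_of_tendsto_of_le_of_le tendsto_const_nhds hl (fun _ => zero_le)
      fun i => ?_
    refine (lintegral_mono_set hK').trans ?_
    rw [← lintegral_const_mul' _ _ ENNReal.coe_ne_top]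
    refine setLIntegral_mono' hmA fun ξ hξ => ?_
    refine le_trans ?_ (mul_le_mul_right le_add_self _)
    rw [gradient_comp_eq_adjoint ((hf (ns i)).differentiable (by simp) _)
      (S.hasFDerivAt_left hξ hbB).differentiableAt, ← map_sub, ← ofReal_norm, ← ofReal_norm,
      ← ENNReal.ofReal_coe_nnreal, ← ENNReal.ofReal_mul' (norm_nonneg _)]
    refine ENNReal.ofReal_le_ofReal ((ContinuousLinearMap.le_opNorm _ _).trans ?_)
    gcongr; exact hbd ξ hξ

end IsSlicing

theorem ContinuousOn.measurable_indicator {X E : Type*} [TopologicalSpace X] [MeasurableSpace X]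
    [OpensMeasurableSpace X] [TopologicalSpace E] [MeasurableSpace E] [BorelSpace E] [Zero E]
    {f : X → E} {s : Set X} (hf : ContinuousOn f s) (hs : MeasurableSet s) :
    Measurable (s.indicator f) := by
  classical
  rw [← piecewise_eq_indicator]
  exact hf.measurable_piecewise continuousOn_const hs

/-- Gives translation invariance of the product volume, and its uniqueness up to a scalar for the
comparison with Hausdorff measure. -/
instance isAddHaarMeasure_volume_prod (k d : ℕ) :
    (volume : Measure (Euc k × Euc d)).IsAddHaarMeasure := by
  rw [Measure.volume_eq_prod]; infer_instance

/-! ### Invariance along the second factor. -/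

namespace IsSlicing

variable {k d l : ℕ} {A : Set (Euc k)} {B : Set (Euc d)} {K : Set (Euc l)}
    {Ψ : Euc k × Euc d → Euc l} {L : ℝ≥0} {C : ℝ≥0∞}

/-- The increment of a `C¹` function in a direction of the second factor. -/
theorem enorm_sub_le_lintegral (S : IsSlicing A B K Ψ L C) {f : Euc k × Euc d → ℝ}
    (hf : ContDiffOn ℝ 1 f (A ×ˢ B)) (h : Euc d) {q : Euc k × Euc d} (hq : q ∈ A ×ˢ B)
    (hq' : q + (0, h) ∈ A ×ˢ B) :
    ‖f (q + (0, h)) - f q‖ₑ ≤ ∫⁻ t in Icc (0 : ℝ) 1,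
      (A ×ˢ B).indicator (fun q => ‖fderiv ℝ f q (0, h)‖ₑ) (q + t • (0, h)) := by
  have hmem : ∀ t ∈ Icc (0 : ℝ) 1, q + t • ((0 : Euc k), h) ∈ A ×ˢ B := by
    intro t ht
    refine ⟨by simpa using hq.1, ?_⟩
    simpa using S.convex_right.add_smul_mem hq.2 hq'.2 ht
  have hc : ContDiff ℝ 1 (fun t : ℝ => q + t • ((0 : Euc k), h)) := by fun_prop
  have h1 : ContDiffOn ℝ 1 (fun t : ℝ => f (q + t • ((0 : Euc k), h))) (Icc 0 1) :=
    hf.comp hc.contDiffOn hmem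
  have h2 := enorm_sub_le_lintegral_deriv_of_contDiffOn_Icc h1 zero_le_one
  simp only [one_smul, zero_smul, add_zero] at h2
  refine h2.trans (setLIntegral_mono' measurableSet_Icc fun t ht => ?_)
  rw [indicator_of_mem (hmem t ht)]
  have hd : HasFDerivAt f (fderiv ℝ f (q + t • ((0 : Euc k), h))) (q + t • ((0 : Euc k), h)) :=
    ((hf.contDiffAt (S.isOpen.mem_nhds (hmem t ht))).differentiableAt one_ne_zero).hasFDerivAt
  have hl : HasDerivAt (fun t : ℝ => q + t • ((0 : Euc k), h)) ((0 : Euc k), h) t := by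
    simpa using ((hasDerivAt_id t).smul_const ((0 : Euc k), h)).const_add q
  have := hd.comp_hasDerivAt t hl
  rw [show (fun t : ℝ => f (q + t • ((0 : Euc k), h))) = f ∘ fun t : ℝ => q + t • ((0 : Euc k), h)
    from rfl, this.deriv]

/-- The `L¹` modulus of continuity of a `C¹` function in the directions of the second factor. -/
theorem lintegral_enorm_sub_le (S : IsSlicing A B K Ψ L C) {f : Euc k × Euc d → ℝ}
    (hf : ContDiffOn ℝ 1 f (A ×ˢ B)) (h : Euc d) :
    ∫⁻ q in A ×ˢ B ∩ (fun q => q + (0, h)) ⁻¹' (A ×ˢ B), ‖f (q + (0, h)) - f q‖ₑ ≤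
      ∫⁻ q in A ×ˢ B, ‖fderiv ℝ f q (0, h)‖ₑ := by
  have hQ := S.isOpen.measurableSet
  -- Extension by zero lets Tonelli and translation invariance be used on the whole space.
  set G := (A ×ˢ B).indicator (fun q => ‖fderiv ℝ f q ((0 : Euc k), h)‖ₑ)
  have hG : Measurable G := by
    refine ContinuousOn.measurable_indicator ?_ hQ
    exact ((hf.continuousOn_fderiv_of_isOpen S.isOpen le_rfl).clm_apply continuousOn_const).enorm
  have hQ' : MeasurableSet (A ×ˢ B ∩ (fun q => q + ((0 : Euc k), h)) ⁻¹' (A ×ˢ B)) :=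
    hQ.inter (hQ.preimage (measurable_add_const _))
  calc _ ≤ ∫⁻ q in A ×ˢ B ∩ (fun q => q + (0, h)) ⁻¹' (A ×ˢ B),
        ∫⁻ t in Icc (0 : ℝ) 1, G (q + t • (0, h)) :=
        setLIntegral_mono' hQ' fun q hq => S.enorm_sub_le_lintegral hf h hq.1 hq.2
    _ ≤ ∫⁻ q, ∫⁻ t in Icc (0 : ℝ) 1, G (q + t • (0, h)) := setLIntegral_le_lintegral _ _
    _ = ∫⁻ t in Icc (0 : ℝ) 1, ∫⁻ q, G (q + t • (0, h)) := by
        refine lintegral_lintegral_swap ?_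
        refine (hG.comp ?_).aemeasurable
        fun_prop
    _ = ∫⁻ t in Icc (0 : ℝ) 1, ∫⁻ q, G q := by
        refine lintegral_congr fun t => ?_
        exact lintegral_add_right_eq_self G _
    _ = ∫⁻ q in A ×ˢ B, ‖fderiv ℝ f q (0, h)‖ₑ := by
        rw [lintegral_const, Measure.restrict_apply_univ, Real.volume_Icc, lintegral_indicator hQ]
        simp

/-- If the weak gradient of `u` annihilates the directions of the second factor, `u ∘ Ψ` is
invariant under translations in these directions. -/
theorem ae_eq_add (S : IsSlicing A B K Ψ L C) {Ω : Set (Euc l)} (hΩ : IsOpen Ω)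
    (hK : K ⊆ Ω) {u : Euc l → ℝ} {g : Euc l → Euc l} (H : HasWeakGradient Ω u g)
    (hg0 : ∀ᵐ q ∂(volume.restrict (A ×ˢ B)), ∀ η, ⟪g (Ψ q), fderiv ℝ Ψ q (0, η)⟫_ℝ = 0)
    {U : Euc k × Euc d → ℝ} (hU : Measurable U)
    (hUu : (fun q => u (Ψ q)) =ᵐ[volume.restrict (A ×ˢ B)] U) (h : Euc d) :
    ∀ᵐ q, q ∈ A ×ˢ B → q + (0, h) ∈ A ×ˢ B → U (q + (0, h)) = U q := by
  have hQ := S.isOpen.measurableSet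
  obtain ⟨f, hf, hf1, hf2⟩ := H.exists_contDiff_tendsto hΩ S.isCompact hK
  have hu := H.1 _ S.isCompact hK
  have hg := H.2 _ S.isCompact hK
  have hfg : ∀ i, Continuous (∇ (f i)) := fun i =>
    (InnerProductSpace.toDual ℝ (Euc l)).symm.continuous.comp
      ((hf i).continuous_fderiv (by simp))
  have m1 : ∀ i, AEStronglyMeasurable (fun y => f i y - u y) (volume.restrict K) := fun i =>
    (hf i).continuous.aestronglyMeasurable.sub hu.1
  have m2 : ∀ i, AEStronglyMeasurable (fun y => ∇ (f i) y - g y) (volume.restrict K) := fun i =>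
    (hfg i).aestronglyMeasurable.sub hg.1
  have hfC : ∀ i, ContDiffOn ℝ 1 (fun q => f i (Ψ q)) (A ×ˢ B) := fun i =>
    ((hf i).of_le (by simp)).comp_contDiffOn S.contDiffOn
  set T : Euc k × Euc d := (0, h)
  set Q := A ×ˢ B
  set Q' := Q ∩ (fun q => q + T) ⁻¹' Q
  have hQ' : MeasurableSet Q' := hQ.inter (hQ.preimage (measurable_add_const _))
  set D : ℕ → Euc k × Euc d → ℝ≥0∞ := fun i => Q.indicator (fun q => ‖f i (Ψ q) - U q‖ₑ)
  have hD : ∀ i, Measurable (D i) := by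
    intro i
    have h1 : Measurable (fun q => ‖Q.indicator (fun q => f i (Ψ q)) q - U q‖ₑ) :=
      (((hfC i).continuousOn.measurable_indicator hQ).sub hU).enorm
    convert h1.indicator hQ using 1
    ext q
    by_cases hq : q ∈ Q
    · simp only [D, indicator_of_mem hq]
    · simp only [D, indicator_of_notMem hq]
  have hDle : ∀ i, ∫⁻ q, D i q ≤ C * ∫⁻ y in K, ‖f i y - u y‖ₑ := by
    intro i
    rw [lintegral_indicator hQ]
    refine le_trans (le_of_eq (lintegral_congr_ae ?_)) (lintegral_comp_le_of_map_le
      (F := fun y => ‖f i y - u y‖ₑ) S.aemeasurable S.map_le (m1 i).enorm)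
    filter_upwards [hUu] with q hq
    rw [← hq]
  -- Since `g ∘ Ψ` annihilates `DΨ T`, the derivative of `f i ∘ Ψ` along `T` is the inner product of
  -- `DΨ T` with `∇ (f i) - g`, which is small in `L¹`.
  have hGle : ∀ i, ∫⁻ q in Q, ‖fderiv ℝ (fun q => f i (Ψ q)) q T‖ₑ ≤
      ENNReal.ofReal (L * ‖T‖) * (C * ∫⁻ y in K, ‖∇ (f i) y - g y‖ₑ) := by
    intro i
    calc _ ≤ ∫⁻ q in Q, ENNReal.ofReal (L * ‖T‖) * ‖∇ (f i) (Ψ q) - g (Ψ q)‖ₑ := by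
          refine lintegral_mono_ae ?_
          filter_upwards [hg0, ae_restrict_mem hQ] with q hq hqQ
          have hd := (((hf i).differentiable (by simp) _).hasFDerivAt.comp q
            (S.differentiableAt hqQ).hasFDerivAt).fderiv
          rw [show (fun q => f i (Ψ q)) = f i ∘ Ψ from rfl, hd, ContinuousLinearMap.comp_apply,
            ← inner_gradient_left, ← sub_zero (inner ℝ _ _), ← hq h, ← inner_sub_left,
            ← ofReal_norm, ← ofReal_norm, ← ENNReal.ofReal_mul (by positivity)]
          refine ENNReal.ofReal_le_ofReal ((norm_inner_le_norm _ _).trans ?_)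
          rw [mul_comm]
          gcongr
          exact ((fderiv ℝ Ψ q).le_opNorm T).trans (by gcongr; exact S.norm_fderiv_le hqQ)
      _ = ENNReal.ofReal (L * ‖T‖) * ∫⁻ q in Q, ‖∇ (f i) (Ψ q) - g (Ψ q)‖ₑ :=
          lintegral_const_mul' _ _ ENNReal.ofReal_ne_top
      _ ≤ _ := by
          gcongr
          exact lintegral_comp_le_of_map_le (F := fun y => ‖∇ (f i) y - g y‖ₑ) S.aemeasurable
            S.map_le (m2 i).enorm
  -- The increment of `U` is compared with that of `f i ∘ Ψ`: two approximation errors and one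
  -- increment controlled by the derivative along `T`.
  have hmid : ∀ i, ∫⁻ q in Q', ‖U (q + T) - U q‖ₑ ≤
      (∫⁻ q, D i q) + (∫⁻ q in Q, ‖fderiv ℝ (fun q => f i (Ψ q)) q T‖ₑ) + ∫⁻ q, D i q := by
    intro i
    calc _ ≤ ∫⁻ q in Q', (D i (q + T) + ‖f i (Ψ (q + T)) - f i (Ψ q)‖ₑ + D i q) := by
          refine setLIntegral_mono' hQ' fun q hq => ?_
          simp only [D]
          rw [indicator_of_mem hq.1, indicator_of_mem (show q + T ∈ Q from hq.2),
            show U (q + T) - U q = -(f i (Ψ (q + T)) - U (q + T))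
              + (f i (Ψ (q + T)) - f i (Ψ q)) + (f i (Ψ q) - U q) by ring]
          refine (enorm_add_le _ _).trans (add_le_add_left ((enorm_add_le _ _).trans ?_) _)
          rw [enorm_neg]
      _ = (∫⁻ q in Q', D i (q + T)) + (∫⁻ q in Q', ‖f i (Ψ (q + T)) - f i (Ψ q)‖ₑ)
          + ∫⁻ q in Q', D i q := by
          rw [lintegral_add_right _ (hD i),
            lintegral_add_left (f := fun q => D i (q + T)) ((hD i).comp (measurable_add_const T))]
      _ ≤ _ := by
          refine add_le_add (add_le_add ?_ (S.lintegral_enorm_sub_le (hfC i) h))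
            (setLIntegral_le_lintegral _ _)
          exact (setLIntegral_le_lintegral _ _).trans (lintegral_add_right_eq_self (D i) T).le
  have hzero : ∫⁻ q in Q', ‖U (q + T) - U q‖ₑ = 0 := by
    have hl : Tendsto (fun i => (C * ∫⁻ y in K, ‖f i y - u y‖ₑ)
        + ENNReal.ofReal (L * ‖T‖) * (C * ∫⁻ y in K, ‖∇ (f i) y - g y‖ₑ)
        + C * ∫⁻ y in K, ‖f i y - u y‖ₑ) atTop (𝓝 0) := by
      have a1 := ENNReal.Tendsto.const_mul hf1 (Or.inr S.ne_top)
      have a2 := ENNReal.Tendsto.const_mul (ENNReal.Tendsto.const_mul hf2 (Or.inr S.ne_top))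
        (Or.inr (ENNReal.ofReal_ne_top (r := L * ‖T‖)))
      simpa using (a1.add a2).add a1
    refine le_antisymm (ge_of_tendsto' hl fun i => (hmid i).trans ?_) zero_le
    exact add_le_add (add_le_add (hDle i) (hGle i)) (hDle i)
  have hUm : Measurable (fun q => ‖U (q + T) - U q‖ₑ) :=
    ((hU.comp (measurable_add_const T)).sub hU).enorm
  rw [lintegral_eq_zero_iff hUm, EventuallyEq, ae_restrict_iff' hQ'] at hzero
  filter_upwards [hzero] with q hq h1 h2
  have := hq ⟨h1, h2⟩
  simpa [sub_eq_zero] using this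

/-- If the weak gradient of `u` annihilates the directions of the second factor, `u ∘ Ψ` does not
depend on the second variable. -/
theorem ae_eq_slice (S : IsSlicing A B K Ψ L C) {Ω : Set (Euc l)} (hΩ : IsOpen Ω)
    (hK : K ⊆ Ω) {u : Euc l → ℝ} {g : Euc l → Euc l} (H : HasWeakGradient Ω u g)
    (hg0 : ∀ᵐ q ∂(volume.restrict (A ×ˢ B)), ∀ η, ⟪g (Ψ q), fderiv ℝ Ψ q (0, η)⟫_ℝ = 0) :
    ∀ᵐ b ∂(volume.restrict B), ∀ᵐ q ∂(volume.restrict (A ×ˢ B)),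
      u (Ψ q) = u (Ψ (q.1, b)) := by
  have hQ := S.isOpen.measurableSet
  have hm : AEMeasurable (fun q => u (Ψ q)) (volume.restrict (A ×ˢ B)) :=
    ((H.1 _ S.isCompact hK).1.comp_of_map_le S.aemeasurable S.map_le).aemeasurable
  -- The null set in the translation invariance depends on `h`. Exchanging `h` and `q`, substituting
  -- `b = q.2 + h` and exchanging again yields one null set for almost every `b`; a Borel
  -- representative `U` makes the exceptional sets measurable.
  obtain ⟨U, hU, hUu⟩ := hm
  have h1 : ∀ᵐ h : Euc d, ∀ᵐ q : Euc k × Euc d,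
      q ∈ A ×ˢ B → q + (0, h) ∈ A ×ˢ B → U (q + (0, h)) = U q :=
    Eventually.of_forall fun h => S.ae_eq_add hΩ hK H hg0 hU hUu h
  rw [Measure.ae_ae_comm] at h1
  · have h2 : ∀ᵐ q : Euc k × Euc d, ∀ᵐ b : Euc d, q ∈ A ×ˢ B → b ∈ B → U (q.1, b) = U q := by
      filter_upwards [h1] with q hq
      have := (measurePreserving_sub_right (volume : Measure (Euc d)) q.2).quasiMeasurePreserving.ae hq
      filter_upwards [this] with b hb hqQ hbB
      have e : q + ((0 : Euc k), b - q.2) = (q.1, b) := by ext1 <;> simp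
      rw [e] at hb
      exact hb hqQ ⟨hqQ.1, hbB⟩
    rw [Measure.ae_ae_comm] at h2
    · have h3 : ∀ᵐ b ∂(volume.restrict B), ∀ᵐ ξ ∂(volume.restrict A), u (Ψ (ξ, b)) = U (ξ, b) := by
        have := hUu
        rw [volume_restrict] at this
        have h4 := (Measure.measurePreserving_swap (μ := (volume : Measure (Euc d)).restrict B)
          (ν := (volume : Measure (Euc k)).restrict A)).quasiMeasurePreserving.ae this
        exact Measure.ae_ae_of_ae_prod h4
      filter_upwards [ae_restrict_of_ae h2, h3, ae_restrict_mem S.isOpen_right.measurableSet]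
        with b hb hb3 hbB
      have h5 : ∀ᵐ q ∂(volume.restrict (A ×ˢ B)), u (Ψ (q.1, b)) = U (q.1, b) := by
        rw [volume_restrict]
        exact Measure.quasiMeasurePreserving_fst.ae hb3
      filter_upwards [ae_restrict_of_ae hb, h5, hUu, ae_restrict_mem hQ] with q a1 a2 a3 a4
      rw [a3, a2, a1 a4 hbB]
    · have : {x : (Euc k × Euc d) × Euc d | x.1 ∈ A ×ˢ B → x.2 ∈ B → U (x.1.1, x.2) = U x.1} =
          (Prod.fst ⁻¹' (A ×ˢ B))ᶜ ∪ ((Prod.snd ⁻¹' B)ᶜ ∪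
            {x : (Euc k × Euc d) × Euc d | U (x.1.1, x.2) = U x.1}) := by
        ext x; simp only [mem_union, mem_compl_iff, mem_preimage, mem_ofPred_eq]; tauto
      rw [this]
      refine (measurable_fst hQ).compl.union
        ((measurable_snd S.isOpen_right.measurableSet).compl.union (measurableSet_eq_fun ?_ ?_)) <;>
      fun_prop
  · have : {x : Euc d × (Euc k × Euc d) | x.2 ∈ A ×ˢ B → x.2 + (0, x.1) ∈ A ×ˢ B →
        U (x.2 + (0, x.1)) = U x.2} =
          (Prod.snd ⁻¹' (A ×ˢ B))ᶜ ∪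
          (((fun x : Euc d × (Euc k × Euc d) => x.2 + ((0 : Euc k), x.1)) ⁻¹' (A ×ˢ B))ᶜ ∪
            {x : Euc d × (Euc k × Euc d) | U (x.2 + (0, x.1)) = U x.2}) := by
      ext x; simp only [mem_union, mem_compl_iff, mem_preimage, mem_ofPred_eq]; tauto
    rw [this]
    have hmm : Measurable (fun x : Euc d × (Euc k × Euc d) => x.2 + ((0 : Euc k), x.1)) := by
      fun_prop
    exact (measurable_snd hQ).compl.union
      ((hmm hQ).compl.union (measurableSet_eq_fun (hU.comp hmm) (hU.comp measurable_snd)))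

end IsSlicing

/-! ### Local parametrizations -/

namespace ThinDomain.IsLocalParam

variable {k l r : ℕ} {M : Set (Euc l)} {O : Set (Euc k)} {σ : Euc k → Euc l}

theorem apply_mem (h : IsLocalParam r M O σ) {ξ : Euc k} (hξ : ξ ∈ O) : σ ξ ∈ M := by
  obtain ⟨W, -, hW⟩ := h.image_eq
  exact (hW.subset (mem_image_of_mem σ hξ)).1

theorem contDiffAt (h : IsLocalParam r M O σ) {ξ : Euc k} (hξ : ξ ∈ O) : ContDiffAt ℝ r σ ξ :=
  h.contDiffOn.contDiffAt (h.isOpen.mem_nhds hξ)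

theorem differentiableAt (h : IsLocalParam r M O σ) (hr : r ≠ 0) {ξ : Euc k} (hξ : ξ ∈ O) :
    DifferentiableAt ℝ σ ξ :=
  (h.contDiffAt hξ).differentiableAt (by exact_mod_cast hr)

theorem exists_leftInverse_fderiv (h : IsLocalParam r M O σ) {ξ : Euc k} (hξ : ξ ∈ O) :
    ∃ A : Euc l →L[ℝ] Euc k, ∀ η, A (fderiv ℝ σ ξ η) = η := by
  obtain ⟨g, hg⟩ := LinearMap.exists_leftInverse_of_injective (fderiv ℝ σ ξ : Euc k →ₗ[ℝ] Euc l)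
    (LinearMap.ker_eq_bot.2 (h.injective_fderiv ξ hξ))
  exact ⟨LinearMap.toContinuousLinearMap g, fun η => LinearMap.congr_fun hg η⟩

/-- Points of `M` near `σ ξ₀` have parameters near `ξ₀`. -/
theorem eventually_mem_image (h : IsLocalParam r M O σ) {ξ₀ : Euc k} (hξ₀ : ξ₀ ∈ O)
    {V : Set (Euc k)} (hV : V ∈ 𝓝 ξ₀) : ∀ᶠ p in 𝓝[M] (σ ξ₀), p ∈ σ '' (O ∩ V) := by
  obtain ⟨W, hWo, hW⟩ := h.image_eq
  have h1 : W ∈ 𝓝[M] (σ ξ₀) :=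
    mem_nhdsWithin_of_mem_nhds (hWo.mem_nhds (hW.subset (mem_image_of_mem σ hξ₀)).2)
  have h2 : ((↑) : O → Euc k) ⁻¹' V ∈ 𝓝 (⟨ξ₀, hξ₀⟩ : O) :=
    continuous_subtype_val.continuousAt.preimage_mem_nhds hV
  rw [h.isEmbedding.isInducing.nhds_eq_comap] at h2
  obtain ⟨T, hT, hTV⟩ := mem_comap.1 h2
  filter_upwards [h1, mem_nhdsWithin_of_mem_nhds (show T ∈ 𝓝 (σ ξ₀) from hT), self_mem_nhdsWithin]
    with p hpW hpT hpM
  obtain ⟨ξ, hξ, rfl⟩ := hW.superset ⟨hpM, hpW⟩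
  exact ⟨ξ, ⟨hξ, @hTV ⟨ξ, hξ⟩ hpT⟩, rfl⟩

/-- A local parametrization has a left inverse of class `C¹` near each point. -/
theorem exists_leftInverse (h : IsLocalParam r M O σ) (hr : r ≠ 0) {ξ₀ : Euc k} (hξ₀ : ξ₀ ∈ O) :
    ∃ τ : Euc l → Euc k, ContDiffAt ℝ r τ (σ ξ₀) ∧ (∀ᶠ ξ in 𝓝 ξ₀, τ (σ ξ) = ξ) ∧
      ∀ᶠ p in 𝓝[M] (σ ξ₀), σ (τ p) = p := by
  obtain ⟨A, hA⟩ := h.exists_leftInverse_fderiv hξ₀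
  have hr' : (r : ℕ∞ω) ≠ 0 := by exact_mod_cast hr
  have hc : ContDiffAt ℝ r (fun ξ => A (σ ξ)) ξ₀ := A.contDiff.contDiffAt.comp ξ₀ (h.contDiffAt hξ₀)
  have hd : HasFDerivAt (fun ξ => A (σ ξ))
      (ContinuousLinearEquiv.refl ℝ (Euc k) : Euc k →L[ℝ] Euc k) ξ₀ := by
    have := A.hasFDerivAt.comp ξ₀ (h.differentiableAt hr hξ₀).hasFDerivAt
    convert! this using 1
    ext1 η
    exact (hA η).symm
  -- The inverse function theorem applies to `A ∘ σ`, whose derivative at `ξ₀` is the identity; `τ`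
  -- is `A` followed by the local inverse.
  set e := hc.toOpenPartialHomeomorph _ hd hr'
  have he : ∀ ξ, e ξ = A (σ ξ) := fun ξ => by
    rw [hc.toOpenPartialHomeomorph_coe hd hr']
  have hes : e.source ∈ 𝓝 ξ₀ :=
    e.open_source.mem_nhds (hc.mem_toOpenPartialHomeomorph_source hd hr')
  refine ⟨fun p => e.symm (A p), ?_, ?_, ?_⟩
  · have h1 : ContDiffAt ℝ r e.symm (A (σ ξ₀)) := hc.to_localInverse hd hr'
    exact h1.comp (σ ξ₀) A.contDiff.contDiffAt
  · filter_upwards [hes] with ξ hξ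
    rw [← he, e.left_inv hξ]
  -- The embedding property enters here: it excludes points of `M` near `σ ξ₀` that come only from
  -- distant parameters.
  · filter_upwards [h.eventually_mem_image hξ₀ hes] with p hp
    obtain ⟨ξ, ⟨-, hξ⟩, rfl⟩ := hp
    rw [← he, e.left_inv hξ]

/-- The tangent space is the range of the derivative of a local parametrization. -/
theorem tangentSpace_eq (h : IsLocalParam r M O σ) (hr : r ≠ 0) {ξ : Euc k} (hξ : ξ ∈ O) :
    tangentSpace M (σ ξ) = (fderiv ℝ σ ξ : Euc k →ₗ[ℝ] Euc l).range := by
  apply le_antisymm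
  · refine Submodule.span_le.2 ?_
    rintro w ⟨γ, hγM, hγ0, hγ⟩
    -- A curve in `M` equals `σ ∘ (τ ∘ γ)` near time zero, and `τ ∘ γ` is differentiable there, so
    -- its velocity lies in the range of `Dσ`.
    obtain ⟨τ, hτ, hτσ, hστ⟩ := h.exists_leftInverse hr hξ
    have hτd : DifferentiableAt ℝ τ (σ ξ) := hτ.differentiableAt (by exact_mod_cast hr)
    have h0 : τ (σ ξ) = ξ := hτσ.self_of_nhds
    have hγt : Tendsto γ (𝓝 0) (𝓝[M] (σ ξ)) :=
      tendsto_nhdsWithin_iff.2 ⟨hγ0 ▸ hγ.continuousAt.tendsto, Eventually.of_forall hγM⟩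
    have e1 : (fun t => σ (τ (γ t))) =ᶠ[𝓝 0] γ := hγt.eventually hστ
    rw [← hγ0] at hτd
    have d1 : HasDerivAt (fun t => τ (γ t)) (fderiv ℝ τ (γ 0) w) 0 :=
      hτd.hasFDerivAt.comp_hasDerivAt 0 hγ
    have d2 : HasFDerivAt σ (fderiv ℝ σ ξ) (τ (γ 0)) := by
      rw [hγ0, h0]; exact (h.differentiableAt hr hξ).hasFDerivAt
    have d3 := (d2.comp_hasDerivAt (0 : ℝ) d1).congr_of_eventuallyEq e1.symm
    exact ⟨_, (hγ.unique d3).symm⟩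
  · rintro w ⟨η, rfl⟩
    refine Submodule.subset_span ?_
    classical
    -- Admissible curves lie in `M` at all times, so the curve is set to `σ ξ` where the line leaves
    -- `O`; this does not affect its germ at zero.
    refine ⟨fun t => if ξ + t • η ∈ O then σ (ξ + t • η) else σ ξ, fun t => ?_, ?_, ?_⟩
    · simp only
      split_ifs with ht
      · exact h.apply_mem ht
      · exact h.apply_mem hξ
    · simp
    · have hl : HasDerivAt (fun t : ℝ => ξ + t • η) η 0 := by
        simpa using ((hasDerivAt_id (0 : ℝ)).smul_const η).const_add ξ
      have d2 : HasFDerivAt σ (fderiv ℝ σ ξ) (ξ + (0 : ℝ) • η) := by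
        simpa using (h.differentiableAt hr hξ).hasFDerivAt
      refine (d2.comp_hasDerivAt (0 : ℝ) hl).congr_of_eventuallyEq ?_
      have : ∀ᶠ t : ℝ in 𝓝 0, ξ + t • η ∈ O :=
        hl.continuousAt.eventually_mem (by simpa using h.isOpen.mem_nhds hξ)
      filter_upwards [this] with t ht
      simp [ht]

/-- A local parametrization is locally bi-Lipschitz. -/
theorem exists_biLipschitz (h : IsLocalParam r M O σ) (hr : r ≠ 0) {ξ₀ : Euc k} (hξ₀ : ξ₀ ∈ O) :
    ∃ L : ℝ≥0, ∃ V ∈ 𝓝 ξ₀, LipschitzOnWith L σ V ∧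
      ∀ ξ ∈ V, ∀ η ∈ V, dist ξ η ≤ L * dist (σ ξ) (σ η) := by
  have h1 : (1 : ℕ∞ω) ≤ r := by exact_mod_cast Nat.one_le_iff_ne_zero.2 hr
  obtain ⟨τ, hτ, hτσ, -⟩ := h.exists_leftInverse hr hξ₀
  obtain ⟨L₁, V₁, hV₁, hL₁⟩ := ((h.contDiffAt hξ₀).of_le h1).exists_lipschitzOnWith
  obtain ⟨L₂, V₂, hV₂, hL₂⟩ := (hτ.of_le h1).exists_lipschitzOnWith
  refine ⟨max L₁ L₂, V₁ ∩ {ξ | τ (σ ξ) = ξ} ∩ σ ⁻¹' V₂, inter_mem (inter_mem hV₁ hτσ)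
    ((h.contDiffAt hξ₀).continuousAt.preimage_mem_nhds hV₂),
    (hL₁.mono fun ξ hξ => hξ.1.1).weaken (le_max_left _ _), fun ξ hξ η hη => ?_⟩
  have := hL₂.dist_le_mul _ hξ.2 _ hη.2
  rw [hξ.1.2, hη.1.2] at this
  exact this.trans (by gcongr; exact le_max_right _ _)

end ThinDomain.IsLocalParam

/-! ### Normal projections in local coordinates -/

namespace ThinDomain.IsNormalProjection

variable {k l r : ℕ} {M U : Set (Euc l)} {φ : Euc l → Euc l} {O : Set (Euc k)}
  {σ : Euc k → Euc l}

theorem contDiffAt (hφ : IsNormalProjection r M U φ) (hr : 2 ≤ r) {x : Euc l} (hx : x ∈ U) :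
    ContDiffAt ℝ 1 φ x :=
  (hφ.contDiffOn.contDiffAt (hφ.isOpen.mem_nhds hx)).of_le
    (by exact_mod_cast (by omega : 1 ≤ r - 1))

/-- The coordinate expression of a normal projection. -/
theorem exists_coord (hφ : IsNormalProjection r M U φ) (hr : 2 ≤ r) (h : IsLocalParam r M O σ)
    {x₀ : Euc l} (hx₀ : x₀ ∈ U) {ξ₀ : Euc k} (hξ₀ : ξ₀ ∈ O) (hφx : φ x₀ = σ ξ₀) :
    ∃ θ : Euc l → Euc k, ContDiffAt ℝ 1 θ x₀ ∧ θ x₀ = ξ₀ ∧ ∀ᶠ x in 𝓝 x₀, σ (θ x) = φ x := by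
  obtain ⟨τ, hτ, hτσ, hστ⟩ := h.exists_leftInverse (by omega) hξ₀
  have h1 : (1 : ℕ∞ω) ≤ r := by exact_mod_cast (by omega : 1 ≤ r)
  refine ⟨fun x => τ (φ x), ?_, ?_, ?_⟩
  · refine ContDiffAt.comp x₀ ?_ (hφ.contDiffAt hr hx₀)
    rw [hφx]; exact hτ.of_le h1
  · simp only [hφx]; exact hτσ.self_of_nhds
  · have ht : Tendsto φ (𝓝 x₀) (𝓝[M] (σ ξ₀)) :=
      tendsto_nhdsWithin_iff.2 ⟨hφx ▸ (hφ.contDiffAt hr hx₀).continuousAt.tendsto,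
        (hφ.isOpen.eventually_mem hx₀).mono fun x hx => hφ.mapsTo hx⟩
    exact ht.eventually hστ

/-- Differentiating the orthogonality relation: the coordinate expression of a normal projection is
a submersion, and the kernel of its derivative is the normal space. -/
theorem fderiv_coord (hφ : IsNormalProjection r M U φ) (hr : 2 ≤ r) (h : IsLocalParam r M O σ)
    {x : Euc l} (hx : x ∈ U) {θ : Euc l → Euc k} (hθ : DifferentiableAt ℝ θ x) (hθx : θ x ∈ O)
    (hσθ : ∀ᶠ y in 𝓝 x, σ (θ y) = φ y) :
    Function.Surjective (fderiv ℝ θ x) ∧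
      ∀ v, fderiv ℝ θ x v = 0 ↔ v ∈ (tangentSpace M (φ x))ᗮ := by
  have hr0 : r ≠ 0 := by omega
  have hσx : σ (θ x) = φ x := hσθ.self_of_nhds
  have hT : tangentSpace M (φ x) = (fderiv ℝ σ (θ x) : Euc k →ₗ[ℝ] Euc l).range := by
    rw [← hσx, h.tangentSpace_eq hr0 hθx]
  have hσ1 := (h.differentiableAt hr0 hθx).hasFDerivAt
  have hσ2 : DifferentiableAt ℝ (fderiv ℝ σ) (θ x) := by
    have : ContDiffAt ℝ 1 (fderiv ℝ σ) (θ x) :=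
      (h.contDiffAt hθx).fderiv_right (by exact_mod_cast (by omega : 1 + 1 ≤ r))
    exact this.differentiableAt one_ne_zero
  -- The derivative of `⟪y - σ (θ y), Dσ (θ y) η⟫ = 0` at `x` in the direction `v`; the second
  -- derivative of `σ` exists because `2 ≤ r`.
  have key : ∀ (v : Euc l) (η : Euc k), ⟪v, fderiv ℝ σ (θ x) η⟫_ℝ =
      ⟪fderiv ℝ σ (θ x) (fderiv ℝ θ x v), fderiv ℝ σ (θ x) η⟫_ℝ
        - ⟪x - φ x, fderiv ℝ (fderiv ℝ σ) (θ x) (fderiv ℝ θ x v) η⟫_ℝ := by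
    intro v η
    have d1 : HasFDerivAt (fun y => y - σ (θ y))
        (ContinuousLinearMap.id ℝ (Euc l) - (fderiv ℝ σ (θ x)).comp (fderiv ℝ θ x)) x :=
      (hasFDerivAt_id x).sub (hσ1.comp x hθ.hasFDerivAt)
    have d2 : HasFDerivAt (fun y => fderiv ℝ σ (θ y))
        ((fderiv ℝ (fderiv ℝ σ) (θ x)).comp (fderiv ℝ θ x)) x :=
      hσ2.hasFDerivAt.comp x hθ.hasFDerivAt
    have d3 := d2.clm_apply (hasFDerivAt_const η x)
    have d4 := d1.inner ℝ d3
    have hz : (fun y => ⟪y - σ (θ y), fderiv ℝ σ (θ y) η⟫_ℝ) =ᶠ[𝓝 x] fun _ => 0 := by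
      filter_upwards [hσθ, hφ.isOpen.mem_nhds hx,
        hθ.continuousAt.preimage_mem_nhds (h.isOpen.mem_nhds hθx)] with y hy hyU hyO
      have h1 := hφ.sub_mem_orthogonal y hyU
      rw [← hy, h.tangentSpace_eq hr0 hyO] at h1
      exact Submodule.inner_left_of_mem_orthogonal
        (LinearMap.mem_range_self (fderiv ℝ σ (θ y) : Euc k →ₗ[ℝ] Euc l) η) h1
    have d5 := d4.unique ((hasFDerivAt_const (0 : ℝ) x).congr_of_eventuallyEq hz)
    have d6 := congrArg (fun T => T v) d5
    simp only [ContinuousLinearMap.comp_apply, ContinuousLinearMap.prod_apply,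
      fderivInnerCLM_apply, sub_apply, ContinuousLinearMap.id_apply,
      add_apply, ContinuousLinearMap.flip_apply,
      zero_apply, map_zero, zero_add, inner_sub_left, hσx] at d6
    rw [inner_sub_left]
    linarith
  -- The first fundamental form minus the second in the direction `x - φ x`. Definiteness is not
  -- assumed; nondegeneracy comes from the identity `key`.
  set 𝔅 : Euc k →ₗ[ℝ] Euc k →ₗ[ℝ] ℝ := LinearMap.mk₂ ℝ
    (fun ζ η => ⟪fderiv ℝ σ (θ x) ζ, fderiv ℝ σ (θ x) η⟫_ℝ
        - ⟪x - φ x, fderiv ℝ (fderiv ℝ σ) (θ x) ζ η⟫_ℝ)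
    (fun a b c => by
      rw [map_add, map_add, inner_add_left, add_apply, inner_add_right]
      abel)
    (fun c a b => by
      rw [map_smul, map_smul, real_inner_smul_left, smul_apply, real_inner_smul_right, smul_eq_mul,
        mul_sub])
    (fun a b c => by simp only [map_add, inner_add_right]; ring)
    (fun c a b => by simp only [map_smul, inner_smul_right, smul_eq_mul]; ring)
  have hB : ∀ v η, 𝔅 (fderiv ℝ θ x v) η = ⟪v, fderiv ℝ σ (θ x) η⟫_ℝ := fun v η =>
    (key v η).symm
  obtain ⟨A, hA⟩ := h.exists_leftInverse_fderiv hθx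
  -- As `Dσ` is injective, the functionals `η ↦ ⟪v, Dσ η⟫` exhaust the dual. So `𝔅` is onto the
  -- dual, hence bijective by dimension, and `Dθ` must be surjective with kernel the orthogonal
  -- complement of the range of `Dσ`.
  have hrep : ∀ lam : Euc k →ₗ[ℝ] ℝ, ∃ v, 𝔅 (fderiv ℝ θ x v) = lam := by
    intro lam
    refine ⟨(InnerProductSpace.toDual ℝ (Euc l)).symm
      ((LinearMap.toContinuousLinearMap lam).comp A), ?_⟩
    ext1 η
    rw [hB, InnerProductSpace.toDual_symm_apply, ContinuousLinearMap.comp_apply, hA]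
    rfl
  have hsurj : Function.Surjective 𝔅 := fun lam => let ⟨v, hv⟩ := hrep lam; ⟨_, hv⟩
  have hinj : Function.Injective 𝔅 :=
    (LinearMap.injective_iff_surjective_of_finrank_eq_finrank
      (Subspace.dual_finrank_eq (K := ℝ) (V := Euc k)).symm).2 hsurj
  refine ⟨fun ζ => ?_, fun v => ?_⟩
  · obtain ⟨v, hv⟩ := hrep (𝔅 ζ)
    exact ⟨v, hinj hv⟩
  · rw [hT, Submodule.mem_orthogonal']
    constructor
    · rintro hv _ ⟨η, rfl⟩
      have := hB v η
      rw [hv, map_zero, LinearMap.zero_apply] at this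
      exact this.symm
    · intro hv
      refine hinj ?_
      rw [map_zero]
      ext1 η
      rw [hB]
      exact hv _ ⟨η, rfl⟩

end ThinDomain.IsNormalProjection

/-! ### Charts adapted to the fibres of a normal projection -/

/-- `Φ` is a bi-Lipschitz `C¹` diffeomorphism of `N` onto a product `A × B`, with inverse `Ψ`, whose
first component is the expression of `φ` in the local parametrization `σ`. -/
structure IsFiberChart {k d l : ℕ} (φ : Euc l → Euc l) (σ : Euc k → Euc l) (N : Set (Euc l))
    (A : Set (Euc k)) (B : Set (Euc d)) (Φ : Euc l → Euc k × Euc d) (Ψ : Euc k × Euc d → Euc l)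
    (L : ℝ≥0) : Prop where
  isOpen_source : IsOpen N
  isOpen_left : IsOpen A
  isOpen_right : IsOpen B
  convex_right : Convex ℝ B
  isBounded_right : Bornology.IsBounded B
  mapsTo : MapsTo Φ N (A ×ˢ B)
  mapsTo_symm : MapsTo Ψ (A ×ˢ B) N
  left_inv : ∀ x ∈ N, Ψ (Φ x) = x
  right_inv : ∀ q ∈ A ×ˢ B, Φ (Ψ q) = q
  contDiffOn : ContDiffOn ℝ 1 Φ N
  contDiffOn_symm : ContDiffOn ℝ 1 Ψ (A ×ˢ B)
  lipschitzOnWith : LipschitzOnWith L Φ N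
  lipschitzOnWith_symm : LipschitzOnWith L Ψ (A ×ˢ B)
  lipschitzOnWith_param : LipschitzOnWith L σ A
  dist_le_param : ∀ ξ ∈ A, ∀ η ∈ A, dist ξ η ≤ L * dist (σ ξ) (σ η)
  comp_eq : ∀ x ∈ N, σ (Φ x).1 = φ x

/-- The missing coordinates come from the orthogonal projection onto the kernel of `D`, which has
dimension `l - k`. -/
theorem ContinuousLinearMap.exists_equiv_prod_of_surjective {k l : ℕ} {D : Euc l →L[ℝ] Euc k}
    (hD : Function.Surjective D) :
    ∃ E : Euc l ≃L[ℝ] Euc k × Euc (l - k), ∀ v, (E v).1 = D v := by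
  set Z : Submodule ℝ (Euc l) := (D : Euc l →ₗ[ℝ] Euc k).ker
  have hr : (D : Euc l →ₗ[ℝ] Euc k).range = ⊤ := LinearMap.range_eq_top.2 hD
  have hfin : Module.finrank ℝ Z = Module.finrank ℝ (Euc (l - k)) := by
    have := (D : Euc l →ₗ[ℝ] Euc k).finrank_range_add_finrank_ker
    rw [hr, finrank_top] at this
    simp only [finrank_euclideanSpace, Fintype.card_fin] at this ⊢
    simp only [Z]
    omega
  set e : Z ≃L[ℝ] Euc (l - k) := ContinuousLinearEquiv.ofFinrankEq hfin
  set P : Euc l →L[ℝ] Euc (l - k) := (e : Z →L[ℝ] Euc (l - k)).comp Z.orthogonalProjectionOnto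
  have hP : (P : Euc l →ₗ[ℝ] Euc (l - k)).range = ⊤ := by
    refine LinearMap.range_eq_top.2 fun y => ?_
    refine ⟨(e.symm y : Z), ?_⟩
    simp [P]
  have hker : (P : Euc l →ₗ[ℝ] Euc (l - k)).ker = Zᗮ := by
    rw [← Submodule.ker_orthogonalProjectionOnto]
    ext v
    simp [P]
  exact ⟨D.equivProdOfSurjectiveOfIsCompl P hr hP (hker ▸ Submodule.isCompl_orthogonal (K := Z)),
    fun v => rfl⟩

/-- The submersion `θ` is completed by linear coordinates on the kernel of its derivative at `x₀`,
and the inverse function theorem is applied to the pair. -/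
theorem ThinDomain.IsNormalProjection.exists_isFiberChart {k l r : ℕ} {M U : Set (Euc l)}
    {φ : Euc l → Euc l} {O : Set (Euc k)} {σ : Euc k → Euc l} (hφ : IsNormalProjection r M U φ)
    (hr : 2 ≤ r) (h : IsLocalParam r M O σ) {x₀ : Euc l} (hx₀ : x₀ ∈ U) {ξ₀ : Euc k}
    (hξ₀ : ξ₀ ∈ O) (hφx : φ x₀ = σ ξ₀) {S : Set (Euc l)} (hS : S ∈ 𝓝 x₀) :
    ∃ (N : Set (Euc l)) (A : Set (Euc k)) (B : Set (Euc (l - k))) (Φ : Euc l → Euc k × Euc (l - k))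
      (Ψ : Euc k × Euc (l - k) → Euc l) (L : ℝ≥0), IsFiberChart φ σ N A B Φ Ψ L ∧ x₀ ∈ N ∧
        N ⊆ S ∧ N ⊆ U ∧ A ⊆ O ∧ (Φ x₀).1 = ξ₀ := by
  obtain ⟨θ, hθ, hθx, hσθ⟩ := hφ.exists_coord hr h hx₀ hξ₀ hφx
  have hθd := hθ.differentiableAt one_ne_zero
  obtain ⟨hsurj, -⟩ := hφ.fderiv_coord hr h hx₀ hθd (hθx ▸ hξ₀) hσθ
  obtain ⟨E, hE⟩ := ContinuousLinearMap.exists_equiv_prod_of_surjective hsurj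
  set Q₀ : Euc l →L[ℝ] Euc (l - k) :=
    (ContinuousLinearMap.snd ℝ (Euc k) (Euc (l - k))).comp (E : Euc l →L[ℝ] Euc k × Euc (l - k))
  set Φ : Euc l → Euc k × Euc (l - k) := fun x => (θ x, Q₀ (x - x₀))
  have hΦ : ContDiffAt ℝ 1 Φ x₀ :=
    hθ.prodMk (Q₀.contDiff.contDiffAt.comp x₀ (contDiffAt_id.sub contDiffAt_const))
  have hΦd : HasFDerivAt Φ (E : Euc l →L[ℝ] Euc k × Euc (l - k)) x₀ := by
    have h1 : HasFDerivAt (fun x => Q₀ (x - x₀)) Q₀ x₀ := by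
      exact Q₀.hasFDerivAt.comp x₀ ((hasFDerivAt_id x₀).sub_const x₀)
    have h2 := hθd.hasFDerivAt.prodMk h1
    have h3 : (E : Euc l →L[ℝ] Euc k × Euc (l - k)) = (fderiv ℝ θ x₀).prod Q₀ :=
      ContinuousLinearMap.ext fun v => Prod.ext (hE v) rfl
    rw [h3]; exact h2
  have hΦx : Φ x₀ = (ξ₀, 0) := by simp [Φ, hθx]
  set e := hΦ.toOpenPartialHomeomorph Φ hΦd one_ne_zero
  have he : ⇑e = Φ := hΦ.toOpenPartialHomeomorph_coe hΦd one_ne_zero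
  have hes : x₀ ∈ e.source := hΦ.mem_toOpenPartialHomeomorph_source hΦd one_ne_zero
  have hΨ : ContDiffAt ℝ 1 e.symm (ξ₀, 0) := by
    rw [← hΦx]; exact hΦ.to_localInverse hΦd one_ne_zero
  have hΨx : e.symm (ξ₀, 0) = x₀ := by rw [← hΦx, ← he, e.left_inv hes]
  obtain ⟨L₁, T₁, hT₁, hL₁⟩ := hΦ.exists_lipschitzOnWith
  obtain ⟨L₂, T₂, hT₂, hL₂⟩ := hΨ.exists_lipschitzOnWith
  obtain ⟨L₃, V, hV, hL₃, hL₃'⟩ := h.exists_biLipschitz (by omega) hξ₀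
  have hgood : ∀ᶠ x in 𝓝 x₀, ContDiffAt ℝ 1 Φ x ∧ x ∈ T₁ ∧ x ∈ S ∧ x ∈ U ∧ σ (θ x) = φ x :=
    (hΦ.eventually (by simp)).and ((eventually_mem_set.2 hT₁).and ((eventually_mem_set.2 hS).and
      ((hφ.isOpen.eventually_mem hx₀).and hσθ)))
  have hgood' : ∀ᶠ q in 𝓝 ((ξ₀, 0) : Euc k × Euc (l - k)), q ∈ e.target ∧ ContDiffAt ℝ 1 e.symm q ∧
      q ∈ T₂ ∧ q.1 ∈ V ∧ q.1 ∈ O ∧ (ContDiffAt ℝ 1 Φ (e.symm q) ∧ e.symm q ∈ T₁ ∧ e.symm q ∈ S ∧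
        e.symm q ∈ U ∧ σ (θ (e.symm q)) = φ (e.symm q)) := by
    have ht : e.target ∈ 𝓝 ((ξ₀, 0) : Euc k × Euc (l - k)) := by
      rw [← hΦx, ← he]; exact e.open_target.mem_nhds (e.map_source hes)
    have h1 : ∀ᶠ q in 𝓝 ((ξ₀, 0) : Euc k × Euc (l - k)), q.1 ∈ V :=
      continuous_fst.continuousAt.preimage_mem_nhds hV
    have h2 : ∀ᶠ q in 𝓝 ((ξ₀, 0) : Euc k × Euc (l - k)), q.1 ∈ O :=
      continuous_fst.continuousAt.preimage_mem_nhds (h.isOpen.mem_nhds hξ₀)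
    have h3 := hΨ.continuousAt.tendsto
    rw [hΨx] at h3
    filter_upwards [ht, hΨ.eventually (by simp), hT₂, h1, h2, h3.eventually hgood]
      with q a1 a2 a3 a4 a5 a6
    exact ⟨a1, a2, a3, a4, a5, a6⟩
  -- One radius meets all the local conditions at once; in the sup metric the ball is already a
  -- product of balls.
  obtain ⟨ρ, hρ, hρs⟩ := Metric.eventually_nhds_iff_ball.1 hgood'
  have hball : ball ξ₀ ρ ×ˢ ball (0 : Euc (l - k)) ρ = ball ((ξ₀, 0) : Euc k × Euc (l - k)) ρ :=
    ball_prod_same _ _ _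
  have hball' : ∀ ξ ∈ ball ξ₀ ρ, (ξ, 0) ∈ ball ((ξ₀, 0) : Euc k × Euc (l - k)) ρ := fun ξ hξ => by
    rw [← hball]; exact ⟨hξ, mem_ball_self hρ⟩
  have hN : ∀ x ∈ e.source ∩ e ⁻¹' ball (ξ₀, 0) ρ,
      ContDiffAt ℝ 1 Φ x ∧ x ∈ T₁ ∧ x ∈ S ∧ x ∈ U ∧ σ (θ x) = φ x := by
    intro x hx
    have := (hρs _ hx.2).2.2.2.2.2
    rwa [e.left_inv hx.1] at this
  refine ⟨e.source ∩ e ⁻¹' ball (ξ₀, 0) ρ, ball ξ₀ ρ, ball 0 ρ, Φ, e.symm, max (max L₁ L₂) L₃,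
    ⟨e.isOpen_inter_preimage isOpen_ball, isOpen_ball, isOpen_ball, convex_ball _ _, isBounded_ball,
      ?_, ?_, ?_, ?_, ?_, ?_, ?_, ?_, ?_, ?_, ?_⟩, ⟨hes, ?_⟩, fun x hx => (hN x hx).2.2.1,
      fun x hx => (hN x hx).2.2.2.1, fun ξ hξ => (hρs _ (hball' ξ hξ)).2.2.2.2.1, hθx⟩
  · intro x hx; rw [hball, ← he]; exact hx.2
  · intro q hq
    rw [hball] at hq
    refine ⟨e.map_target (hρs q hq).1, ?_⟩
    rw [mem_preimage, e.right_inv (hρs q hq).1]; exact hq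
  · intro x hx; rw [← he]; exact e.left_inv hx.1
  · intro q hq; rw [hball] at hq; rw [← he]; exact e.right_inv (hρs q hq).1
  · exact fun x hx => (hN x hx).1.contDiffWithinAt
  · intro q hq; rw [hball] at hq; exact (hρs q hq).2.1.contDiffWithinAt
  · exact (hL₁.mono fun x hx => (hN x hx).2.1).weaken
      ((le_max_left _ _).trans (le_max_left _ _))
  · exact (hL₂.mono fun q hq => (hρs q (hball ▸ hq)).2.2.1).weaken
      ((le_max_right _ _).trans (le_max_left _ _))
  · exact (hL₃.mono fun ξ hξ => (hρs _ (hball' ξ hξ)).2.2.2.1).weaken (le_max_right _ _)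
  · intro ξ hξ η hη
    refine (hL₃' ξ (hρs _ (hball' ξ hξ)).2.2.2.1 η (hρs _ (hball' η hη)).2.2.2.1).trans ?_
    gcongr; exact le_max_right _ _
  · exact fun x hx => (hN x hx).2.2.2.2
  · rw [mem_preimage, he, hΦx]; exact mem_ball_self hρ

/-! ### Hausdorff measure and bi-Lipschitz maps -/

theorem LipschitzOnWith.euclideanHausdorffMeasure_image_le {X Y : Type*} [EMetricSpace X]
    [MeasurableSpace X] [BorelSpace X] [EMetricSpace Y] [MeasurableSpace Y] [BorelSpace Y]
    {L : ℝ≥0} {f : X → Y} {s : Set X} (h : LipschitzOnWith L f s) (d : ℕ) :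
    μHE[d] (f '' s) ≤ (L : ℝ≥0∞) ^ d * μHE[d] s := by
  have := h.hausdorffMeasure_image_le (d := d) d.cast_nonneg
  rw [ENNReal.rpow_natCast] at this
  rw [Measure.euclideanHausdorffMeasure_def, Measure.euclideanHausdorffMeasure_def,
    Measure.smul_apply, Measure.smul_apply, mul_smul_comm]
  rw [ENNReal.smul_def, ENNReal.smul_def, smul_eq_mul, smul_eq_mul]
  gcongr

/-- Both are Haar measures, hence proportional. The factor depends on the sup metric of the product,
but only its finiteness matters. -/
theorem exists_volume_prod_comparable {k d l : ℕ} (hl : k + d = l) :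
    ∃ C : ℝ≥0∞, C ≠ ⊤ ∧ ∀ s : Set (Euc k × Euc d),
      volume s ≤ C * μHE[l] s ∧ μHE[l] s ≤ C * volume s := by
  have hf : Module.finrank ℝ (Euc k × Euc d) = l := by simp [hl]
  have hH : (μHE[l] : Measure (Euc k × Euc d)).IsAddHaarMeasure := by
    rw [← hf]; infer_instance
  have h1 := Measure.isAddLeftInvariant_eq_smul (volume : Measure (Euc k × Euc d)) μHE[l]
  have h2 := Measure.isAddLeftInvariant_eq_smul (μHE[l] : Measure (Euc k × Euc d)) volume
  set a := Measure.addHaarScalarFactor (volume : Measure (Euc k × Euc d)) μHE[l]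
  set b := Measure.addHaarScalarFactor (μHE[l] : Measure (Euc k × Euc d)) volume
  refine ⟨max a b, by simp, fun s => ⟨?_, ?_⟩⟩
  · conv_lhs => rw [h1]
    rw [Measure.smul_apply, ENNReal.smul_def, smul_eq_mul]
    gcongr
    exact le_max_left _ _
  · conv_lhs => rw [h2]
    rw [Measure.smul_apply, ENNReal.smul_def, smul_eq_mul]
    gcongr
    exact le_max_right _ _

theorem ContinuousOn.measurableSet_inter_preimage {X Y : Type*} [TopologicalSpace X]
    [MeasurableSpace X] [BorelSpace X] [TopologicalSpace Y] [MeasurableSpace Y] [BorelSpace Y]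
    {f : X → Y} {s : Set X} {t : Set Y} (hf : ContinuousOn f s) (hs : MeasurableSet s)
    (ht : MeasurableSet t) : MeasurableSet (s ∩ f ⁻¹' t) := by
  have := hs.subtype_image ((continuousOn_iff_continuous_domRestrict.1 hf).measurable ht)
  rwa [show s.domRestrict f = f ∘ Subtype.val from rfl, preimage_comp,
    Subtype.image_preimage_coe] at this

/-! ### Volume and Hausdorff measure in a fibre chart. -/

namespace IsFiberChart

variable {k d l : ℕ} {φ : Euc l → Euc l} {σ : Euc k → Euc l} {N : Set (Euc l)}
  {A : Set (Euc k)} {B : Set (Euc d)} {Φ : Euc l → Euc k × Euc d} {Ψ : Euc k × Euc d → Euc l}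
  {L : ℝ≥0}

theorem injOn_param (h : IsFiberChart φ σ N A B Φ Ψ L) : InjOn σ A := fun ξ hξ η hη e => by
  have := h.dist_le_param ξ hξ η hη
  rw [e, dist_self, mul_zero] at this
  exact dist_le_zero.1 this

theorem param_eq (h : IsFiberChart φ σ N A B Φ Ψ L) {q : Euc k × Euc d} (hq : q ∈ A ×ˢ B) :
    φ (Ψ q) = σ q.1 := by
  rw [← h.comp_eq _ (h.mapsTo_symm hq), h.right_inv q hq]

theorem fst_eq (h : IsFiberChart φ σ N A B Φ Ψ L) {x : Euc l} (hx : x ∈ N) {ξ : Euc k}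
    (hξ : ξ ∈ A) (e : φ x = σ ξ) : (Φ x).1 = ξ :=
  h.injOn_param (h.mapsTo hx).1 hξ ((h.comp_eq x hx).trans e)

/-- `Φ` and `Ψ` are Lipschitz, so each distorts `μHE[l]` by at most `L ^ l`; this measure is the
volume on `Euc l` and comparable to it on the product. -/
theorem exists_volume_comparable (h : IsFiberChart φ σ N A B Φ Ψ L) (hl : k + d = l) :
    ∃ C : ℝ≥0∞, C ≠ ⊤ ∧ ∀ S, volume (N ∩ S) ≤ C * volume (A ×ˢ B ∩ Ψ ⁻¹' S) ∧
      volume (A ×ˢ B ∩ Ψ ⁻¹' S) ≤ C * volume (N ∩ S) := by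
  obtain ⟨C, hC, H⟩ := exists_volume_prod_comparable hl
  have e1 : (volume : Measure (Euc l)) = μHE[l] :=
    (EuclideanSpace.euclideanHausdorffMeasure_eq_volume l).symm
  refine ⟨(L : ℝ≥0∞) ^ l * C, by finiteness, fun S => ⟨?_, ?_⟩⟩
  · have : N ∩ S ⊆ Ψ '' (A ×ˢ B ∩ Ψ ⁻¹' S) := fun x hx =>
      ⟨Φ x, ⟨h.mapsTo hx.1, by simpa [h.left_inv x hx.1] using hx.2⟩, h.left_inv x hx.1⟩
    rw [e1, mul_assoc]
    exact (measure_mono this).trans (((h.lipschitzOnWith_symm.mono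
      inter_subset_left).euclideanHausdorffMeasure_image_le l).trans
        (mul_le_mul_right (H _).2 _))
  · have : A ×ˢ B ∩ Ψ ⁻¹' S ⊆ Φ '' (N ∩ S) := fun q hq =>
      ⟨Ψ q, ⟨h.mapsTo_symm hq.1, hq.2⟩, h.right_inv q hq.1⟩
    calc volume (A ×ˢ B ∩ Ψ ⁻¹' S) ≤ C * μHE[l] (Φ '' (N ∩ S)) :=
          (measure_mono this).trans (H _).1
      _ ≤ C * ((L : ℝ≥0∞) ^ l * μHE[l] (N ∩ S)) := by
          gcongr
          exact (h.lipschitzOnWith.mono inter_subset_left).euclideanHausdorffMeasure_image_le l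
      _ = _ := by rw [e1]; ring

theorem measure_image_param_le (h : IsFiberChart φ σ N A B Φ Ψ L) (E : Set (Euc l)) :
    μHE[k] (E ∩ σ '' A) ≤ (L : ℝ≥0∞) ^ k * volume (A ∩ σ ⁻¹' E) := by
  have : E ∩ σ '' A ⊆ σ '' (A ∩ σ ⁻¹' E) := by
    rintro _ ⟨hE, ξ, hξ, rfl⟩
    exact ⟨ξ, ⟨hξ, hE⟩, rfl⟩
  rw [← EuclideanSpace.euclideanHausdorffMeasure_eq_volume k]
  exact (measure_mono this).trans
    ((h.lipschitzOnWith_param.mono inter_subset_left).euclideanHausdorffMeasure_image_le k)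

theorem volume_preimage_param_le (h : IsFiberChart φ σ N A B Φ Ψ L) (E : Set (Euc l)) :
    volume (A ∩ σ ⁻¹' E) ≤ (L : ℝ≥0∞) ^ k * μHE[k] (E ∩ σ '' A) := by
  have hτ : ∀ ξ ∈ A, Function.invFunOn σ A (σ ξ) = ξ := fun ξ hξ =>
    h.injOn_param.leftInvOn_invFunOn hξ
  have hL : LipschitzOnWith L (Function.invFunOn σ A) (E ∩ σ '' A) := by
    refine LipschitzOnWith.of_dist_le_mul ?_
    rintro _ ⟨-, ξ, hξ, rfl⟩ _ ⟨-, η, hη, rfl⟩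
    rw [hτ ξ hξ, hτ η hη]
    exact h.dist_le_param ξ hξ η hη
  have : A ∩ σ ⁻¹' E ⊆ Function.invFunOn σ A '' (E ∩ σ '' A) := fun ξ hξ =>
    ⟨σ ξ, ⟨hξ.2, ξ, hξ.1, rfl⟩, hτ ξ hξ.1⟩
  rw [← EuclideanSpace.euclideanHausdorffMeasure_eq_volume k]
  exact (measure_mono this).trans (hL.euclideanHausdorffMeasure_image_le k)

/-- In the chart the section over `σ ξ` is the Lipschitz image of part of the slice `{ξ} × B`;
injectivity of `σ` on `A` excludes other slices. -/
theorem measure_normalSection_le (h : IsFiberChart φ σ N A B Φ Ψ L) {T : Set (Euc l)}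
    (hT : T ⊆ N) {ξ : Euc k} (hξ : ξ ∈ A) :
    μHE[d] (normalSection φ T (σ ξ)) ≤ (L : ℝ≥0∞) ^ d * volume {b ∈ B | Ψ (ξ, b) ∈ T} := by
  have : normalSection φ T (σ ξ) ⊆ (fun b => Ψ (ξ, b)) '' {b ∈ B | Ψ (ξ, b) ∈ T} := by
    rintro x ⟨hx, e⟩
    have e' : (ξ, (Φ x).2) = Φ x := Prod.ext (h.fst_eq (hT hx) hξ e).symm rfl
    refine ⟨(Φ x).2, ⟨(h.mapsTo (hT hx)).2, ?_⟩, ?_⟩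
    · rwa [e', h.left_inv x (hT hx)]
    · simp only [e', h.left_inv x (hT hx)]
  have hL : LipschitzOnWith L (fun b => Ψ (ξ, b)) {b ∈ B | Ψ (ξ, b) ∈ T} := by
    refine LipschitzOnWith.of_dist_le_mul fun b hb c hc => ?_
    have := h.lipschitzOnWith_symm.dist_le_mul (ξ, b) ⟨hξ, hb.1⟩ (ξ, c) ⟨hξ, hc.1⟩
    rwa [Prod.dist_eq, dist_self, max_eq_right dist_nonneg] at this
  rw [← EuclideanSpace.euclideanHausdorffMeasure_eq_volume d]
  exact (measure_mono this).trans (hL.euclideanHausdorffMeasure_image_le d)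

theorem volume_slice_le (h : IsFiberChart φ σ N A B Φ Ψ L) {T : Set (Euc l)} {ξ : Euc k}
    (hξ : ξ ∈ A) :
    volume {b ∈ B | Ψ (ξ, b) ∈ T} ≤ (L : ℝ≥0∞) ^ d * μHE[d] (normalSection φ T (σ ξ)) := by
  have hsub : (fun b => Ψ (ξ, b)) '' {b ∈ B | Ψ (ξ, b) ∈ T} ⊆ N ∩ normalSection φ T (σ ξ) := by
    rintro _ ⟨b, hb, rfl⟩
    exact ⟨h.mapsTo_symm ⟨hξ, hb.1⟩, hb.2, h.param_eq (q := (ξ, b)) ⟨hξ, hb.1⟩⟩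
  have : {b ∈ B | Ψ (ξ, b) ∈ T} ⊆ (fun x => (Φ x).2) '' (N ∩ normalSection φ T (σ ξ)) := by
    intro b hb
    exact ⟨Ψ (ξ, b), hsub ⟨b, hb, rfl⟩, by simp only [h.right_inv (ξ, b) ⟨hξ, hb.1⟩]⟩
  have hL : LipschitzOnWith L (fun x => (Φ x).2) (N ∩ normalSection φ T (σ ξ)) :=
    LipschitzOnWith.of_dist_le_mul fun x hx y hy =>
      (le_max_right _ _).trans (h.lipschitzOnWith.dist_le_mul x hx.1 y hy.1)
  rw [← EuclideanSpace.euclideanHausdorffMeasure_eq_volume d]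
  exact (measure_mono this).trans ((hL.euclideanHausdorffMeasure_image_le d).trans
    (mul_le_mul_right (measure_mono inter_subset_right) _))

theorem aemeasurable_param (h : IsFiberChart φ σ N A B Φ Ψ L) :
    AEMeasurable σ (volume.restrict A) :=
  h.lipschitzOnWith_param.continuousOn.aemeasurable h.isOpen_left.measurableSet

theorem measurableSet_image_param (h : IsFiberChart φ σ N A B Φ Ψ L) :
    MeasurableSet (σ '' A) :=
  h.isOpen_left.measurableSet.image_of_continuousOn_injOn h.lipschitzOnWith_param.continuousOn
    h.injOn_param

theorem map_param_le (h : IsFiberChart φ σ N A B Φ Ψ L) :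
    (volume.restrict A).map σ ≤ (L : ℝ≥0∞) ^ k • μHE[k].restrict (σ '' A) := by
  refine Measure.le_iff.2 fun E hE => ?_
  rw [Measure.map_apply_of_aemeasurable h.aemeasurable_param hE,
    Measure.restrict_apply₀' h.isOpen_left.measurableSet.nullMeasurableSet, inter_comm,
    Measure.smul_apply, Measure.restrict_apply hE, smul_eq_mul]
  exact h.volume_preimage_param_le E

theorem restrict_le_map_param (h : IsFiberChart φ σ N A B Φ Ψ L) :
    μHE[k].restrict (σ '' A) ≤ (L : ℝ≥0∞) ^ k • (volume.restrict A).map σ := by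
  refine Measure.le_iff.2 fun E hE => ?_
  rw [Measure.smul_apply, Measure.map_apply_of_aemeasurable h.aemeasurable_param hE,
    Measure.restrict_apply₀' h.isOpen_left.measurableSet.nullMeasurableSet,
    inter_comm _ A, Measure.restrict_apply hE, smul_eq_mul]
  exact h.measure_image_param_le E

/-- The slicing of Lebesgue measure along the fibres of `φ`, in product
coordinates. -/
theorem volume_prod_eq_lintegral (h : IsFiberChart φ σ N A B Φ Ψ L) {T E : Set (Euc l)}
    (hT : MeasurableSet T) (hE : MeasurableSet E) :
    volume (A ×ˢ B ∩ Ψ ⁻¹' (T ∩ φ ⁻¹' E)) =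
      ∫⁻ ξ in A, (E.indicator 1 (σ ξ)) * volume {b ∈ B | Ψ (ξ, b) ∈ T} := by
  have hAB : MeasurableSet (A ×ˢ B) := h.isOpen_left.measurableSet.prod h.isOpen_right.measurableSet
  have hΨ : ContinuousOn Ψ (A ×ˢ B) := h.lipschitzOnWith_symm.continuousOn
  have hσ : ContinuousOn σ A := h.lipschitzOnWith_param.continuousOn
  have key : A ×ˢ B ∩ Ψ ⁻¹' (T ∩ φ ⁻¹' E) =
      (A ×ˢ B ∩ Ψ ⁻¹' T) ∩ ((A ∩ σ ⁻¹' E) ×ˢ univ) := by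
    ext q
    refine ⟨fun ⟨hq, hqT, hqE⟩ => ⟨⟨hq, hqT⟩, ⟨hq.1, ?_⟩, trivial⟩, fun ⟨⟨hq, hqT⟩, hqE, _⟩ =>
      ⟨hq, hqT, ?_⟩⟩
    · have : φ (Ψ q) ∈ E := hqE
      rwa [h.param_eq hq] at this
    · change φ (Ψ q) ∈ E
      rw [h.param_eq hq]; exact hqE.2
  have hm1 : MeasurableSet (A ×ˢ B ∩ Ψ ⁻¹' T) := by
    exact hΨ.measurableSet_inter_preimage hAB hT
  have hm2 : MeasurableSet (A ∩ σ ⁻¹' E) :=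
    hσ.measurableSet_inter_preimage h.isOpen_left.measurableSet hE
  rw [key, Measure.volume_eq_prod, Measure.prod_apply (hm1.inter (hm2.prod MeasurableSet.univ)),
    ← lintegral_indicator h.isOpen_left.measurableSet]
  refine lintegral_congr fun ξ => ?_
  by_cases hξ : ξ ∈ A
  · rw [indicator_of_mem hξ]
    by_cases hE' : σ ξ ∈ E
    · rw [indicator_of_mem hE', Pi.one_apply, one_mul]
      congr 1
      ext b
      simp [hξ, hE']
    · rw [indicator_of_notMem hE', zero_mul, ← measure_empty (μ := (volume : Measure (Euc d)))]
      congr 1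
      ext b
      simp [hE']
  · rw [indicator_of_notMem hξ, ← measure_empty (μ := (volume : Measure (Euc d)))]
    congr 1
    ext b
    simp [hξ]

end IsFiberChart

/-! ### Measurability of the Hausdorff measure of the fibres of a continuous map -/

section FiberMeasure

variable {X Y : Type*} [MetricSpace X] [MeasurableSpace X] [BorelSpace X]

/-- Coverings by small open sets suffice to compute Hausdorff measures. -/
theorem MeasureTheory.Measure.hausdorffMeasure_eq_iSup_isOpen {d : ℝ} (hd : 0 < d) (s : Set X) :
    μH[d] s = ⨆ n : ℕ, ⨅ (t : ℕ → Set X) (_ : ∀ i, IsOpen (t i)) (_ : s ⊆ ⋃ i, t i)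
      (_ : ∀ i, ediam (t i) ≤ ((n : ℝ≥0∞) + 1)⁻¹), ∑' i, ediam (t i) ^ d := by
  rw [Measure.hausdorffMeasure_apply]
  apply le_antisymm
  · refine iSup₂_le fun r hr => ?_
    obtain ⟨n, hn⟩ := ENNReal.exists_inv_nat_lt hr.ne'
    refine le_iSup_of_le n ?_
    refine le_iInf₂ fun t _ => le_iInf₂ fun hst hd' => ?_
    refine iInf₂_le_of_le t hst (iInf_le_of_le (fun i => (hd' i).trans ?_) ?_)
    · exact (ENNReal.inv_le_inv.2 le_self_add).trans hn.le
    · exact ENNReal.tsum_le_tsum fun i => iSup_le fun _ => le_rfl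
  · refine iSup_le fun n => ?_
    set r : ℝ≥0∞ := ((n : ℝ≥0∞) + 1)⁻¹ with hr
    have hr0 : 0 < r := ENNReal.inv_pos.2 (by finiteness)
    have hrt : r ≠ ⊤ := ENNReal.inv_ne_top.2 (by simp)
    -- Diameters at most `r / 2` leave room to thicken by `δ < r / 4`. The thickenings are chosen so
    -- small that the sums grow by at most `ε` in total.
    refine le_iSup₂_of_le (r / 2) (ENNReal.half_pos hr0.ne') ?_
    refine le_iInf₂ fun t hst => le_iInf fun htr => ?_
    refine ENNReal.le_of_forall_pos_le_add fun ε hε _ => ?_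
    obtain ⟨ε', hε', hsum⟩ := ENNReal.exists_pos_sum_of_countable
      (ENNReal.coe_ne_zero.2 hε.ne') ℕ
    have hδ : ∀ i, ∃ δ : ℝ, 0 < δ ∧ ediam (thickening δ (t i)) ≤ r ∧
        ediam (thickening δ (t i)) ^ d ≤ (⨆ _ : (t i).Nonempty, ediam (t i) ^ d) + ε' i := by
      intro i
      rcases (t i).eq_empty_or_nonempty with he | hne
      -- An empty set contributes `0 ^ d`, which vanishes because `0 < d`.
      · exact ⟨1, one_pos, by simp [he], by simp [he, ENNReal.zero_rpow_of_pos hd]⟩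
      have hc : ContinuousAt (fun δ : ℝ≥0∞ => (ediam (t i) + 2 * δ) ^ d) 0 := by
        refine (ENNReal.continuous_rpow_const.comp
          (continuous_const.add (ENNReal.continuous_const_mul (by simp)))).continuousAt
      have hfin : ediam (t i) ≠ ⊤ := ((htr i).trans_lt (by finiteness)).ne
      have h0 : (ediam (t i) + 2 * 0) ^ d < ediam (t i) ^ d + ε' i := by
        rw [mul_zero, add_zero]
        exact ENNReal.lt_add_right (ENNReal.rpow_ne_top_of_nonneg hd.le hfin)
          (ENNReal.coe_ne_zero.2 (hε' i).ne')
      have h1 := hc.eventually (gt_mem_nhds h0)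
      have h2 : ∀ᶠ δ : ℝ≥0∞ in 𝓝 0, δ < r / 4 :=
        gt_mem_nhds (ENNReal.div_pos hr0.ne' (by simp))
      have h3 : Tendsto (fun δ : ℝ => ENNReal.ofReal δ) (𝓝[>] 0) (𝓝 0) := by
        have := ENNReal.continuous_ofReal.tendsto 0
        rw [ENNReal.ofReal_zero] at this
        exact this.mono_left nhdsWithin_le_nhds
      obtain ⟨δ, ⟨h4, h5⟩, h6⟩ := ((h3.eventually (h1.and h2)).and
        self_mem_nhdsWithin).exists
      have h7 : ediam (thickening δ (t i)) ≤ ediam (t i) + 2 * ENNReal.ofReal δ := by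
        have := ediam_thickening_le (s := t i) (⟨δ, le_of_lt h6⟩ : ℝ≥0)
        refine this.trans_eq ?_
        rw [ENNReal.ofReal_eq_coe_nnreal (le_of_lt h6)]
        rfl
      refine ⟨δ, h6, h7.trans ?_, ?_⟩
      · calc ediam (t i) + 2 * ENNReal.ofReal δ ≤ r / 2 + 2 * (r / 4) := by
              gcongr
              exact htr i
          _ = r := by
              rw [← ENNReal.add_halves r]
              congr 1
              · simp
              rw [ENNReal.add_halves, show (4 : ℝ≥0∞) = 2 * 2 by norm_num,
                ENNReal.div_eq_inv_mul, ENNReal.mul_inv (by simp) (by simp), ← mul_assoc,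
                ← mul_assoc, ENNReal.mul_inv_cancel (by simp) (by simp), one_mul,
                ENNReal.div_eq_inv_mul]
      · rw [iSup_pos hne]
        exact (ENNReal.rpow_le_rpow h7 hd.le).trans h4.le
    choose δ hδ0 hδr hδd using hδ
    refine iInf₂_le_of_le (fun i => thickening (δ i) (t i)) (fun i => isOpen_thickening)
      (iInf₂_le_of_le ?_ hδr ?_)
    · exact hst.trans (iUnion_mono fun i => self_subset_thickening (hδ0 i) _)
    · calc ∑' i, ediam (thickening (δ i) (t i)) ^ d
          ≤ ∑' i, ((⨆ _ : (t i).Nonempty, ediam (t i) ^ d) + ε' i) := ENNReal.tsum_le_tsum hδd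
        _ = ∑' i, (⨆ _ : (t i).Nonempty, ediam (t i) ^ d) + ∑' i, (ε' i : ℝ≥0∞) :=
            ENNReal.tsum_add
        _ ≤ _ := by gcongr

/-- If open sets cover the fibre over `p`, they cover all nearby fibres, because the image under `φ`
of the uncovered part of `K` is compact and misses `p`. So each premeasure is upper semicontinuous
in `p`, and the measure is a countable supremum of them. -/
theorem IsCompact.measurable_hausdorffMeasure_fiber [TopologicalSpace Y] [T2Space Y]
    [MeasurableSpace Y] [OpensMeasurableSpace Y] {K : Set X} (hK : IsCompact K) {φ : X → Y}
    (hφ : ContinuousOn φ K) {d : ℝ} (hd : 0 < d) :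
    Measurable fun p => μH[d] {x ∈ K | φ x = p} := by
  simp_rw [Measure.hausdorffMeasure_eq_iSup_isOpen hd]
  refine Measurable.iSup fun n => measurable_of_Iio fun c => IsOpen.measurableSet ?_
  rw [isOpen_iff_mem_nhds]
  intro p hp
  simp only [mem_preimage, mem_Iio, iInf_lt_iff] at hp
  obtain ⟨t, ht, hcov, hdiam, hlt⟩ := hp
  have hc : IsCompact (φ '' (K \ ⋃ i, t i)) :=
    (hK.diff (isOpen_iUnion ht)).image_of_continuousOn (hφ.mono sdiff_subset)
  filter_upwards [hc.isClosed.isOpen_compl.mem_nhds (x := p) (by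
    rintro ⟨x, hx, rfl⟩
    exact hx.2 (hcov ⟨hx.1, rfl⟩))] with q hq
  simp only [mem_preimage, mem_Iio, iInf_lt_iff]
  refine ⟨t, ht, ?_, hdiam, hlt⟩
  rintro x ⟨hxK, rfl⟩
  by_contra hx
  exact hq ⟨x, ⟨hxK, hx⟩, rfl⟩

/-- Exhaustion by increasing compact sets and continuity of the measure from below. -/
theorem IsSigmaCompact.measurable_hausdorffMeasure_fiber [TopologicalSpace Y] [T2Space Y]
    [MeasurableSpace Y] [OpensMeasurableSpace Y] {T : Set X} (hT : IsSigmaCompact T) {φ : X → Y}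
    (hφ : ContinuousOn φ T) {d : ℝ} (hd : 0 < d) :
    Measurable fun p => μH[d] {x ∈ T | φ x = p} := by
  obtain ⟨K, hK, rfl⟩ := hT
  have : (fun p => μH[d] {x ∈ ⋃ n, K n | φ x = p}) =
      fun p => ⨆ n, μH[d] {x ∈ accumulate K n | φ x = p} := by
    funext p
    have hm : Monotone fun n => {x ∈ accumulate K n | φ x = p} := fun m n hmn x hx =>
      ⟨monotone_accumulate hmn hx.1, hx.2⟩
    rw [← hm.measure_iUnion]
    congr 1
    ext x
    simp only [mem_iUnion, mem_ofPred_eq, ← iUnion_accumulate (s := K), exists_and_right]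
  rw [this]
  refine Measurable.iSup fun n => IsCompact.measurable_hausdorffMeasure_fiber ?_ (hφ.mono ?_) hd
  · exact (Set.finite_Iic n).isCompact_biUnion fun i _ => hK i
  · exact accumulate_subset_iUnion n

end FiberMeasure

theorem IsOpen.isSigmaCompact_of_sigmaCompactSpace {X : Type*} [PseudoEMetricSpace X]
    [SigmaCompactSpace X] {T : Set X} (hT : IsOpen T) : IsSigmaCompact T := by
  obtain ⟨F, hF, -, rfl, -⟩ := hT.exists_iUnion_isClosed
  exact isSigmaCompact_iUnion _ fun n =>
    isSigmaCompact_univ.of_isClosed_subset (hF n) (subset_univ _)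

theorem ThinDomain.measurable_normalSection {l d : ℕ} (hd : d ≠ 0) {T : Set (Euc l)}
    (hT : IsOpen T) {φ : Euc l → Euc l} (hφ : ContinuousOn φ T) :
    Measurable fun p => μHE[d] (normalSection φ T p) := by
  have hσ : IsSigmaCompact T := IsOpen.isSigmaCompact_of_sigmaCompactSpace hT
  have := hσ.measurable_hausdorffMeasure_fiber hφ (d := d) (by positivity)
  simp only [Measure.euclideanHausdorffMeasure_def, Measure.smul_apply, ENNReal.smul_def,
    smul_eq_mul]
  exact this.const_mul _

/-! ### Disintegration of Lebesgue measure along a normal projection, up to constants -/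

theorem ThinDomain.normalSection_mono {l : ℕ} {φ : Euc l → Euc l} {S T : Set (Euc l)}
    (h : S ⊆ T) (p : Euc l) : normalSection φ S p ⊆ normalSection φ T p :=
  fun _ hx => ⟨h hx.1, hx.2⟩

theorem ThinDomain.normalSection_eq_empty {l : ℕ} {φ : Euc l → Euc l} {T : Set (Euc l)}
    {p : Euc l} (h : p ∉ φ '' T) : normalSection φ T p = ∅ :=
  eq_empty_of_forall_notMem fun x hx => h ⟨x, hx⟩

namespace IsFiberChart

variable {k d l : ℕ} {φ : Euc l → Euc l} {σ : Euc k → Euc l} {N : Set (Euc l)}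
  {A : Set (Euc k)} {B : Set (Euc d)} {Φ : Euc l → Euc k × Euc d} {Ψ : Euc k × Euc d → Euc l}
  {L : ℝ≥0}

theorem image_eq_subset (h : IsFiberChart φ σ N A B Φ Ψ L) : φ '' N ⊆ σ '' A := by
  rintro _ ⟨x, hx, rfl⟩
  exact ⟨_, (h.mapsTo hx).1, h.comp_eq x hx⟩

theorem continuousOn_projection (h : IsFiberChart φ σ N A B Φ Ψ L) : ContinuousOn φ N := by
  have : ContinuousOn (fun x => σ (Φ x).1) N :=
    h.lipschitzOnWith_param.continuousOn.comp
      (continuous_fst.comp_continuousOn h.lipschitzOnWith.continuousOn) fun x hx => (h.mapsTo hx).1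
  exact this.congr fun x hx => (h.comp_eq x hx).symm

/-- A coarea formula up to constants: Fubini in `A × B`, with bounded distortion between chart and
volume (`C`), slice and section (`L ^ d`), parameter and base (`L ^ k`). -/
theorem exists_volume_comparable_lintegral (h : IsFiberChart φ σ N A B Φ Ψ L) (hl : k + d = l)
    (hd : d ≠ 0) :
    ∃ C : ℝ≥0∞, C ≠ ⊤ ∧ ∀ T, IsOpen T → T ⊆ N → ∀ E, MeasurableSet E →
      volume (T ∩ φ ⁻¹' E) ≤ C * ∫⁻ p in E, μHE[d] (normalSection φ T p) ∂μHE[k] ∧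
      ∫⁻ p in E, μHE[d] (normalSection φ T p) ∂μHE[k] ≤ C * volume (T ∩ φ ⁻¹' E) := by
  obtain ⟨C, hC, H⟩ := h.exists_volume_comparable hl
  refine ⟨C * ((L : ℝ≥0∞) ^ d * (L : ℝ≥0∞) ^ k), by finiteness, fun T hT hTN E hE => ?_⟩
  have hm : Measurable fun p => μHE[d] (normalSection φ T p) :=
    measurable_normalSection hd hT (h.continuousOn_projection.mono hTN)
  have hmE : Measurable (E.indicator fun p => μHE[d] (normalSection φ T p)) := hm.indicator hE
  have hN : N ∩ (T ∩ φ ⁻¹' E) = T ∩ φ ⁻¹' E :=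
    inter_eq_right.2 (inter_subset_left.trans hTN)
  have h0 : ∫⁻ p in E, μHE[d] (normalSection φ T p) ∂μHE[k] =
      ∫⁻ p in σ '' A, E.indicator (fun p => μHE[d] (normalSection φ T p)) p ∂μHE[k] := by
    rw [← lintegral_indicator hE, ← lintegral_indicator h.measurableSet_image_param]
    refine lintegral_congr fun p => ?_
    by_cases hp : p ∈ σ '' A
    · rw [indicator_of_mem hp]
    · have : p ∉ φ '' T := fun h' => hp (h.image_eq_subset (image_mono hTN h'))
      rw [indicator_of_notMem hp]
      by_cases hpE : p ∈ E
      · rw [indicator_of_mem hpE, normalSection_eq_empty this, measure_empty]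
      · rw [indicator_of_notMem hpE]
  have hAm := h.isOpen_left.measurableSet
  refine ⟨?_, ?_⟩
  · calc volume (T ∩ φ ⁻¹' E) = volume (N ∩ (T ∩ φ ⁻¹' E)) := by rw [hN]
      _ ≤ C * volume (A ×ˢ B ∩ Ψ ⁻¹' (T ∩ φ ⁻¹' E)) := (H _).1
      _ = C * ∫⁻ ξ in A, (E.indicator 1 (σ ξ)) * volume {b ∈ B | Ψ (ξ, b) ∈ T} := by
          rw [h.volume_prod_eq_lintegral hT.measurableSet hE]
      _ ≤ C * ∫⁻ ξ in A, (L : ℝ≥0∞) ^ d *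
            E.indicator (fun p => μHE[d] (normalSection φ T p)) (σ ξ) := by
          refine mul_le_mul_right (setLIntegral_mono' hAm fun ξ hξ => ?_) _
          by_cases hp : σ ξ ∈ E
          · simpa [hp] using h.volume_slice_le hξ
          · simp [hp]
      _ = C * ((L : ℝ≥0∞) ^ d * ∫⁻ ξ in A,
            E.indicator (fun p => μHE[d] (normalSection φ T p)) (σ ξ)) := by
          rw [lintegral_const_mul' _ _ (by finiteness)]
      _ ≤ C * ((L : ℝ≥0∞) ^ d * ((L : ℝ≥0∞) ^ k * ∫⁻ p in σ '' A,
            E.indicator (fun p => μHE[d] (normalSection φ T p)) p ∂μHE[k])) := by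
          gcongr
          exact lintegral_comp_le_of_map_le h.aemeasurable_param h.map_param_le hmE.aemeasurable
      _ = _ := by rw [h0]; ring
  · calc ∫⁻ p in E, μHE[d] (normalSection φ T p) ∂μHE[k]
        = ∫⁻ p in σ '' A, E.indicator (fun p => μHE[d] (normalSection φ T p)) p ∂μHE[k] := h0
      _ ≤ (L : ℝ≥0∞) ^ k * ∫⁻ ξ in A,
            E.indicator (fun p => μHE[d] (normalSection φ T p)) (σ ξ) := by
          rw [← lintegral_map' hmE.aemeasurable h.aemeasurable_param, ← smul_eq_mul,
            ← lintegral_smul_measure]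
          exact lintegral_mono' h.restrict_le_map_param le_rfl
      _ ≤ (L : ℝ≥0∞) ^ k * ∫⁻ ξ in A, (L : ℝ≥0∞) ^ d *
            ((E.indicator 1 (σ ξ)) * volume {b ∈ B | Ψ (ξ, b) ∈ T}) := by
          refine mul_le_mul_right (setLIntegral_mono' hAm fun ξ hξ => ?_) _
          by_cases hp : σ ξ ∈ E
          · simpa [hp] using h.measure_normalSection_le hTN hξ
          · simp [hp]
      _ = (L : ℝ≥0∞) ^ k * ((L : ℝ≥0∞) ^ d * volume (A ×ˢ B ∩ Ψ ⁻¹' (T ∩ φ ⁻¹' E))) := by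
          rw [h.volume_prod_eq_lintegral hT.measurableSet hE, lintegral_const_mul' _ _ (by finiteness)]
      _ ≤ (L : ℝ≥0∞) ^ k * ((L : ℝ≥0∞) ^ d * (C * volume (T ∩ φ ⁻¹' E))) := by
          gcongr
          exact (H _).2.trans_eq (by rw [hN])
      _ = _ := by ring

theorem measure_normalSection_le_const (h : IsFiberChart φ σ N A B Φ Ψ L) (p : Euc l) :
    μHE[d] (normalSection φ N p) ≤ (L : ℝ≥0∞) ^ d * volume B := by
  by_cases hp : p ∈ σ '' A
  · obtain ⟨ξ, hξ, rfl⟩ := hp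
    exact (h.measure_normalSection_le subset_rfl hξ).trans
      (mul_le_mul_right (measure_mono (sep_subset _ _)) _)
  · rw [normalSection_eq_empty fun h' => hp (h.image_eq_subset h'), measure_empty]
    exact zero_le

theorem volume_right_le (h : IsFiberChart φ σ N A B Φ Ψ L) {p : Euc l} (hp : p ∈ σ '' A)
    {T : Set (Euc l)} (hT : N ⊆ T) :
    volume B ≤ (L : ℝ≥0∞) ^ d * μHE[d] (normalSection φ T p) := by
  obtain ⟨ξ, hξ, rfl⟩ := hp
  refine le_trans (measure_mono fun b hb => ?_) (h.volume_slice_le (T := T) hξ)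
  exact ⟨hb, hT (h.mapsTo_symm ⟨hξ, hb⟩)⟩

end IsFiberChart

/-! ### Estimates that are uniform over compact sets. -/

namespace ThinDomain.IsNormalProjection

variable {k l r : ℕ} {M U : Set (Euc l)} {φ : Euc l → Euc l}

theorem exists_isFiberChart_of_mem (hφ : IsNormalProjection r M U φ) (hr : 2 ≤ r)
    (hM : IsSubmanifold k r M) {x₀ : Euc l} (hx₀ : x₀ ∈ U) {S : Set (Euc l)} (hS : S ∈ 𝓝 x₀) :
    ∃ (O : Set (Euc k)) (σ : Euc k → Euc l) (N : Set (Euc l)) (A : Set (Euc k))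
      (B : Set (Euc (l - k))) (Φ : Euc l → Euc k × Euc (l - k))
      (Ψ : Euc k × Euc (l - k) → Euc l) (L : ℝ≥0), IsLocalParam r M O σ ∧
        IsFiberChart φ σ N A B Φ Ψ L ∧ x₀ ∈ N ∧ N ⊆ S ∧ N ⊆ U ∧ A ⊆ O := by
  obtain ⟨O, σ, h, ξ₀, hξ₀, e⟩ := hM (φ x₀) (hφ.mapsTo hx₀)
  obtain ⟨N, A, B, Φ, Ψ, L, hN, h1, h2, h3, h4, -⟩ :=
    hφ.exists_isFiberChart hr h hx₀ hξ₀ e.symm hS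
  exact ⟨O, σ, N, A, B, Φ, Ψ, L, h, hN, h1, h2, h3, h4⟩

theorem exists_volume_comparable_lintegral (hφ : IsNormalProjection r M U φ) (hr : 2 ≤ r)
    (hM : IsSubmanifold k r M) (hkl : k < l) {K : Set (Euc l)} (hK : IsCompact K) (hKU : K ⊆ U) :
    ∃ C : ℝ≥0∞, C ≠ ⊤ ∧ ∀ T, IsOpen T → T ⊆ K → ∀ E, MeasurableSet E →
      volume (T ∩ φ ⁻¹' E) ≤ C * ∫⁻ p in E, μHE[l - k] (normalSection φ T p) ∂μHE[k] ∧
      ∫⁻ p in E, μHE[l - k] (normalSection φ T p) ∂μHE[k] ≤ C * volume (T ∩ φ ⁻¹' E) := by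
  have hd : l - k ≠ 0 := by omega
  -- Passing to an open neighbourhood `V` keeps the pieces `T ∩ V` open in the union step of the
  -- compactness argument.
  suffices ∃ V, IsOpen V ∧ V ⊆ U ∧ K ⊆ V ∧ ∃ C : ℝ≥0∞, C ≠ ⊤ ∧ ∀ T, IsOpen T → T ⊆ V →
      ∀ E, MeasurableSet E →
      volume (T ∩ φ ⁻¹' E) ≤ C * ∫⁻ p in E, μHE[l - k] (normalSection φ T p) ∂μHE[k] ∧
      ∫⁻ p in E, μHE[l - k] (normalSection φ T p) ∂μHE[k] ≤ C * volume (T ∩ φ ⁻¹' E) by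
    obtain ⟨V, -, -, hKV, C, hC, H⟩ := this
    exact ⟨C, hC, fun T hT hTK => H T hT (hTK.trans hKV)⟩
  refine hK.induction_on (p := fun K => ∃ V, IsOpen V ∧ V ⊆ U ∧ K ⊆ V ∧ ∃ C : ℝ≥0∞, C ≠ ⊤ ∧
    ∀ T, IsOpen T → T ⊆ V → ∀ E, MeasurableSet E →
      volume (T ∩ φ ⁻¹' E) ≤ C * ∫⁻ p in E, μHE[l - k] (normalSection φ T p) ∂μHE[k] ∧
      ∫⁻ p in E, μHE[l - k] (normalSection φ T p) ∂μHE[k] ≤ C * volume (T ∩ φ ⁻¹' E))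
    ?_ ?_ ?_ ?_
  · refine ⟨∅, isOpen_empty, empty_subset _, subset_rfl, 0, by simp, fun T _ hT E _ => ?_⟩
    obtain rfl := subset_empty_iff.1 hT
    simp [normalSection]
  · rintro s t hst ⟨V, hV, hVU, htV, H⟩
    exact ⟨V, hV, hVU, hst.trans htV, H⟩
  · rintro s t ⟨V, hV, hVU, hsV, C, hC, H⟩ ⟨V', hV', hVU', htV, C', hC', H'⟩
    refine ⟨V ∪ V', hV.union hV', union_subset hVU hVU', union_subset_union hsV htV, C + C',
      by finiteness, fun T hT hTV E hE => ?_⟩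
    have hTU : T = (T ∩ V) ∪ (T ∩ V') := by
      rw [← inter_union_distrib_left, inter_eq_left.2 hTV]
    obtain ⟨h1, h2⟩ := H (T ∩ V) (hT.inter hV) inter_subset_right E hE
    obtain ⟨h3, h4⟩ := H' (T ∩ V') (hT.inter hV') inter_subset_right E hE
    have hm : Measurable fun p => μHE[l - k] (normalSection φ (T ∩ V) p) :=
      measurable_normalSection hd (hT.inter hV) ((hφ.contDiffOn.continuousOn).mono
        (inter_subset_right.trans hVU))
    constructor
    · calc volume (T ∩ φ ⁻¹' E) ≤ volume (T ∩ V ∩ φ ⁻¹' E) + volume (T ∩ V' ∩ φ ⁻¹' E) := by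
            conv_lhs => rw [hTU, union_inter_distrib_right]
            exact measure_union_le _ _
        _ ≤ _ := add_le_add h1 h3
        _ ≤ C * ∫⁻ p in E, μHE[l - k] (normalSection φ T p) ∂μHE[k] +
            C' * ∫⁻ p in E, μHE[l - k] (normalSection φ T p) ∂μHE[k] := by
            gcongr <;> exact normalSection_mono inter_subset_left _
        _ = _ := by ring
    · calc ∫⁻ p in E, μHE[l - k] (normalSection φ T p) ∂μHE[k]
          ≤ ∫⁻ p in E, (μHE[l - k] (normalSection φ (T ∩ V) p) +
              μHE[l - k] (normalSection φ (T ∩ V') p)) ∂μHE[k] := by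
            refine lintegral_mono fun p => ?_
            refine (measure_mono fun x hx => ?_).trans (measure_union_le _ _)
            exact (hTV hx.1).imp (fun h => ⟨⟨hx.1, h⟩, hx.2⟩) (fun h => ⟨⟨hx.1, h⟩, hx.2⟩)
        _ ≤ C * volume (T ∩ V ∩ φ ⁻¹' E) + C' * volume (T ∩ V' ∩ φ ⁻¹' E) := by
            rw [lintegral_add_left hm]
            exact add_le_add h2 h4
        _ ≤ C * volume (T ∩ φ ⁻¹' E) + C' * volume (T ∩ φ ⁻¹' E) := by
            gcongr <;> exact inter_subset_left
        _ = _ := by ring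
  · intro x hx
    obtain ⟨O, σ, N, A, B, Φ, Ψ, L, -, hN, hxN, -, hNU, -⟩ :=
      hφ.exists_isFiberChart_of_mem hr hM (hKU hx) univ_mem
    exact ⟨N, mem_nhdsWithin_of_mem_nhds (hN.isOpen_source.mem_nhds hxN), N, hN.isOpen_source, hNU,
      subset_rfl, hN.exists_volume_comparable_lintegral (by omega) hd⟩

/-- Within one chart a section is a Lipschitz image of part of the bounded set `B`; finitely many
charts cover `K`. -/
theorem exists_measure_normalSection_le (hφ : IsNormalProjection r M U φ) (hr : 2 ≤ r)
    (hM : IsSubmanifold k r M) {K : Set (Euc l)} (hK : IsCompact K) (hKU : K ⊆ U) :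
    ∃ C : ℝ≥0∞, C ≠ ⊤ ∧ ∀ p, μHE[l - k] (normalSection φ K p) ≤ C := by
  refine hK.induction_on (p := fun K => ∃ C : ℝ≥0∞, C ≠ ⊤ ∧
    ∀ p, μHE[l - k] (normalSection φ K p) ≤ C) ⟨0, by simp, by simp [normalSection]⟩ ?_ ?_ ?_
  · rintro s t hst ⟨C, hC, H⟩
    exact ⟨C, hC, fun p => (measure_mono (normalSection_mono hst p)).trans (H p)⟩
  · rintro s t ⟨C, hC, H⟩ ⟨C', hC', H'⟩
    refine ⟨C + C', by finiteness, fun p => ?_⟩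
    refine (measure_mono fun x hx => ?_).trans
      ((measure_union_le _ _).trans (add_le_add (H p) (H' p)))
    exact hx.1.imp (fun h => ⟨h, hx.2⟩) (fun h => ⟨h, hx.2⟩)
  · intro x hx
    obtain ⟨O, σ, N, A, B, Φ, Ψ, L, -, hN, hxN, -, -, -⟩ :=
      hφ.exists_isFiberChart_of_mem hr hM (hKU hx) univ_mem
    have : volume B < ⊤ := hN.isBounded_right.measure_lt_top
    exact ⟨N, mem_nhdsWithin_of_mem_nhds (hN.isOpen_source.mem_nhds hxN), _, by finiteness,
      hN.measure_normalSection_le_const⟩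

end ThinDomain.IsNormalProjection

/-! ### The push-forward of Lebesgue measure under a normal projection -/

/-- The norms agree since `‖√m f‖² = m ‖f‖²`. Positivity of `m` serves the measurability, where `m
f` must be divided by `√m`. -/
theorem memLp_withDensity_iff_sqrt_smul {X F : Type*} [MeasurableSpace X] [NormedAddCommGroup F]
    [NormedSpace ℝ F] {κ : Measure X} {m : X → ℝ≥0∞} (hm : Measurable m)
    (h0 : ∀ᵐ x ∂κ, m x ≠ 0) (ht : ∀ᵐ x ∂κ, m x ≠ ⊤) {f : X → F} :
    MemLp f 2 (κ.withDensity m) ↔ MemLp (fun x => √((m x).toReal) • f x) 2 κ := by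
  have hmr : Measurable fun x => √((m x).toReal) := (hm.ennreal_toReal).sqrt
  have hd : κ.withDensity m = κ.withDensity fun x => ((m x).toNNReal : ℝ≥0∞) :=
    withDensity_congr_ae (ht.mono fun x hx => (ENNReal.coe_toNNReal hx).symm)
  have hmeas : AEStronglyMeasurable f (κ.withDensity m) ↔
      AEStronglyMeasurable (fun x => √((m x).toReal) • f x) κ := by
    rw [hd, aestronglyMeasurable_withDensity_iff hm.ennreal_toNNReal]
    constructor
    · intro h
      refine (hmr.inv.aestronglyMeasurable.smul h).congr ?_
      filter_upwards [h0, ht] with x hx hx'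
      have hpos : 0 < (m x).toReal := ENNReal.toReal_pos hx hx'
      simp only [Pi.smul_apply', Pi.inv_apply, smul_smul, ENNReal.coe_toNNReal_eq_toReal]
      congr 1
      rw [inv_mul_eq_div, Real.div_sqrt]
    · intro h
      refine (hmr.aestronglyMeasurable.smul h).congr (Eventually.of_forall fun x => ?_)
      simp only [Pi.smul_apply', smul_smul, ENNReal.coe_toNNReal_eq_toReal]
      rw [Real.mul_self_sqrt ENNReal.toReal_nonneg]
  refine and_congr hmeas ?_
  rw [eLpNorm_lt_top_iff_lintegral_rpow_enorm_lt_top (by simp) (by simp),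
    eLpNorm_lt_top_iff_lintegral_rpow_enorm_lt_top (by simp) (by simp),
    lintegral_withDensity_eq_lintegral_mul_non_measurable _ hm (ht.mono fun x hx => hx.lt_top)]
  refine iff_of_eq (congrArg (· < ⊤) (lintegral_congr_ae ?_))
  filter_upwards [ht] with x hx
  simp only [Pi.mul_apply, ENNReal.toReal_ofNat, ENNReal.rpow_two, enorm_smul, mul_pow]
  congr 1
  rw [Real.enorm_eq_ofReal (Real.sqrt_nonneg _), ← ENNReal.ofReal_pow (Real.sqrt_nonneg _),
    Real.sq_sqrt ENNReal.toReal_nonneg, ENNReal.ofReal_toReal hx]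

/-- The standing assumptions on the submanifold `M`, the normal projection `φ`, and the bounded open
set `Ω`. -/
structure IsThinDomain {l : ℕ} (k r : ℕ) (M U : Set (Euc l)) (φ : Euc l → Euc l)
    (Ω : Set (Euc l)) : Prop where
  lt : k < l
  two_le : 2 ≤ r
  isSubmanifold : IsSubmanifold k r M
  isNormalProjection : IsNormalProjection r M U φ
  isOpen : IsOpen Ω
  isBounded : Bornology.IsBounded Ω
  closure_subset : closure Ω ⊆ U

namespace IsThinDomain

variable {k l r : ℕ} {M U Ω : Set (Euc l)} {φ : Euc l → Euc l}

theorem subset (h : IsThinDomain k r M U φ Ω) : Ω ⊆ U := subset_closure.trans h.closure_subset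

theorem isCompact_closure (h : IsThinDomain k r M U φ Ω) : IsCompact (closure Ω) :=
  h.isBounded.isCompact_closure

theorem exists_isFiberChart (h : IsThinDomain k r M U φ Ω) {x₀ : Euc l} (hx₀ : x₀ ∈ Ω)
    {S : Set (Euc l)} (hS : S ∈ 𝓝 x₀) :
    ∃ (O : Set (Euc k)) (σ : Euc k → Euc l) (N : Set (Euc l)) (A : Set (Euc k))
      (B : Set (Euc (l - k))) (Φ : Euc l → Euc k × Euc (l - k))
      (Ψ : Euc k × Euc (l - k) → Euc l) (L : ℝ≥0), IsLocalParam r M O σ ∧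
        IsFiberChart φ σ N A B Φ Ψ L ∧ x₀ ∈ N ∧ N ⊆ S ∧ N ⊆ Ω ∧ A ⊆ O := by
  obtain ⟨O, σ, N, A, B, Φ, Ψ, L, h1, h2, h3, h4, -, h6⟩ :=
    h.isNormalProjection.exists_isFiberChart_of_mem h.two_le h.isSubmanifold (h.subset hx₀)
      (inter_mem hS (h.isOpen.mem_nhds hx₀))
  exact ⟨O, σ, N, A, B, Φ, Ψ, L, h1, h2, h3, h4.trans inter_subset_left,
    h4.trans inter_subset_right, h6⟩

theorem continuousOn (h : IsThinDomain k r M U φ Ω) : ContinuousOn φ Ω :=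
  h.isNormalProjection.contDiffOn.continuousOn.mono h.subset

theorem aemeasurable (h : IsThinDomain k r M U φ Ω) : AEMeasurable φ (volume.restrict Ω) :=
  h.continuousOn.aemeasurable h.isOpen.measurableSet

theorem measurableSet_image (h : IsThinDomain k r M U φ Ω) : MeasurableSet (φ '' Ω) := by
  obtain ⟨K, hK, e⟩ := (IsOpen.isSigmaCompact_of_sigmaCompactSpace h.isOpen).image_of_continuousOn
    h.continuousOn
  exact e ▸ MeasurableSet.iUnion fun n => (hK n).measurableSet

theorem measurable_density (h : IsThinDomain k r M U φ Ω) :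
    Measurable fun p => μHE[l - k] (normalSection φ Ω p) :=
  measurable_normalSection (by have := h.lt; omega) h.isOpen h.continuousOn

theorem density_ne_top (h : IsThinDomain k r M U φ Ω) (p : Euc l) :
    μHE[l - k] (normalSection φ Ω p) ≠ ⊤ := by
  obtain ⟨C, hC, H⟩ := h.isNormalProjection.exists_measure_normalSection_le h.two_le
    h.isSubmanifold h.isCompact_closure h.closure_subset
  exact (((measure_mono (normalSection_mono subset_closure p)).trans (H p)).trans_lt hC.lt_top).ne

/-- A chart inside `T` contains a whole copy of `B` over every nearby base point, and the copy has
measure at least `volume B / L ^ (l - k)`. -/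
theorem exists_le_density (h : IsThinDomain k r M U φ Ω) {T : Set (Euc l)} (hT : IsOpen T)
    (hTΩ : T ⊆ Ω) {p : Euc l} (hp : p ∈ φ '' T) :
    ∃ c : ℝ≥0∞, c ≠ 0 ∧ ∀ᶠ q in 𝓝[M] p, c ≤ μHE[l - k] (normalSection φ T q) := by
  obtain ⟨x, hx, rfl⟩ := hp
  obtain ⟨O, σ, N, A, B, Φ, Ψ, L, hσ, hN, hxN, hNT, -, hAO⟩ :=
    h.exists_isFiberChart (hTΩ hx) (hT.mem_nhds hx)
  have hB : 0 < volume B := hN.isOpen_right.measure_pos _ ⟨_, (hN.mapsTo hxN).2⟩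
  have hA := (hN.mapsTo hxN).1
  have hL : (L : ℝ≥0∞) ^ (l - k) ≠ 0 := fun h0 => by
    have := hN.volume_right_le (mem_image_of_mem σ hA) hNT
    rw [h0, zero_mul] at this
    exact hB.ne' (le_antisymm this zero_le)
  refine ⟨volume B / (L : ℝ≥0∞) ^ (l - k), (ENNReal.div_pos hB.ne' (by finiteness)).ne', ?_⟩
  have := hσ.eventually_mem_image (hAO hA) (hN.isOpen_left.mem_nhds hA)
  rw [hN.comp_eq x hxN] at this
  filter_upwards [this] with q hq
  exact ENNReal.div_le_of_le_mul' (hN.volume_right_le (image_mono inter_subset_right hq) hNT)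

theorem image_subset (h : IsThinDomain k r M U φ Ω) : φ '' Ω ⊆ M :=
  image_subset_iff.2 fun _ hx => h.isNormalProjection.mapsTo (h.subset hx)

theorem density_ne_zero (h : IsThinDomain k r M U φ Ω) {T : Set (Euc l)} (hT : IsOpen T)
    (hTΩ : T ⊆ Ω) {p : Euc l} (hp : p ∈ φ '' T) : μHE[l - k] (normalSection φ T p) ≠ 0 := by
  obtain ⟨c, hc, H⟩ := h.exists_le_density hT hTΩ hp
  exact ((pos_iff_ne_zero.2 hc).trans_le
    (H.self_of_nhdsWithin (h.image_subset (image_mono hTΩ hp)))).ne'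

/-- This turns every condition weighted by `μ` into one for the image measure, for which composition
with `φ` preserves integrals. -/
theorem exists_map_comparable (h : IsThinDomain k r M U φ Ω) :
    ∃ C : ℝ≥0∞, C ≠ ⊤ ∧
      (volume.restrict Ω).map φ ≤ C • (μHE[k].restrict (φ '' Ω)).withDensity
        (fun p => μHE[l - k] (normalSection φ Ω p)) ∧
      (μHE[k].restrict (φ '' Ω)).withDensity (fun p => μHE[l - k] (normalSection φ Ω p)) ≤
        C • (volume.restrict Ω).map φ := by
  obtain ⟨C, hC, H⟩ := h.isNormalProjection.exists_volume_comparable_lintegral h.two_le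
    h.isSubmanifold h.lt h.isCompact_closure h.closure_subset
  have e1 : ∀ E, MeasurableSet E → (volume.restrict Ω).map φ E = volume (Ω ∩ φ ⁻¹' E) := by
    intro E hE
    rw [Measure.map_apply_of_aemeasurable h.aemeasurable hE,
      Measure.restrict_apply₀' h.isOpen.measurableSet.nullMeasurableSet, inter_comm]
  have e2 : ∀ E, MeasurableSet E → (μHE[k].restrict (φ '' Ω)).withDensity
      (fun p => μHE[l - k] (normalSection φ Ω p)) E =
      ∫⁻ p in E, μHE[l - k] (normalSection φ Ω p) ∂μHE[k] := by
    intro E hE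
    rw [withDensity_apply _ hE, Measure.restrict_restrict hE, ← lintegral_indicator hE,
      ← lintegral_indicator (hE.inter h.measurableSet_image)]
    refine lintegral_congr fun p => ?_
    by_cases hpE : p ∈ E
    · rw [indicator_of_mem hpE]
      by_cases hp : p ∈ φ '' Ω
      · rw [indicator_of_mem (mem_inter hpE hp)]
      · rw [indicator_of_notMem fun h' => hp h'.2, normalSection_eq_empty hp, measure_empty]
    · rw [indicator_of_notMem hpE, indicator_of_notMem fun h' => hpE h'.1]
  refine ⟨C, hC, Measure.le_iff.2 fun E hE => ?_, Measure.le_iff.2 fun E hE => ?_⟩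
  · rw [Measure.smul_apply, smul_eq_mul, e1 E hE, e2 E hE]
    exact (H Ω h.isOpen subset_closure E hE).1
  · rw [Measure.smul_apply, smul_eq_mul, e1 E hE, e2 E hE]
    exact (H Ω h.isOpen subset_closure E hE).2

theorem ae_density_ne_zero (h : IsThinDomain k r M U φ Ω) :
    ∀ᵐ p ∂(μHE[k].restrict (φ '' Ω)), μHE[l - k] (normalSection φ Ω p) ≠ 0 :=
  (ae_restrict_mem h.measurableSet_image).mono fun _ hp => h.density_ne_zero h.isOpen subset_rfl hp

theorem memLp_sqrt_smul_iff (h : IsThinDomain k r M U φ Ω) {F : Type*} [NormedAddCommGroup F]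
    [NormedSpace ℝ F] {v : Euc l → F} :
    MemLp (fun p => √(sectionMeasure k φ Ω p) • v p) 2 (μHE[k].restrict (φ '' Ω)) ↔
      MemLp v 2 ((volume.restrict Ω).map φ) := by
  obtain ⟨C, hC, h1, h2⟩ := h.exists_map_comparable
  have := memLp_withDensity_iff_sqrt_smul (f := v) h.measurable_density h.ae_density_ne_zero
    (Eventually.of_forall h.density_ne_top)
  exact this.symm.trans ⟨fun H => H.of_measure_le_smul hC h1, fun H => H.of_measure_le_smul hC h2⟩

theorem ae_map_iff_ae_restrict (h : IsThinDomain k r M U φ Ω) {P : Euc l → Prop} :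
    (∀ᵐ p ∂((volume.restrict Ω).map φ), P p) ↔ ∀ᵐ p ∂(μHE[k].restrict (φ '' Ω)), P p := by
  obtain ⟨C, hC, h1, h2⟩ := h.exists_map_comparable
  refine ⟨fun H => ?_, fun H => ?_⟩
  · exact (withDensity_absolutelyContinuous' h.measurable_density.aemeasurable
      h.ae_density_ne_zero).ae_le ((Measure.absolutelyContinuous_of_le_smul h2).ae_le H)
  · exact (Measure.absolutelyContinuous_of_le_smul h1).ae_le
      ((withDensity_absolutelyContinuous _ _).ae_le H)

/-- Near each point the density is at least some `c > 0`, so there the Hausdorff measure is at most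
`c⁻¹` times the weighted one. -/
theorem memL2Loc_of_memLp_map (h : IsThinDomain k r M U φ Ω) {F : Type*} [NormedAddCommGroup F]
    {v : Euc l → F} (hv : MemLp v 2 ((volume.restrict Ω).map φ)) :
    MemL2Loc μHE[k] (φ '' Ω) v := by
  obtain ⟨C, hC, -, h2⟩ := h.exists_map_comparable
  have hv' := hv.of_measure_le_smul hC h2
  refine memL2Loc_of_forall_mem fun p hp => ?_
  obtain ⟨c, hc, H⟩ := h.exists_le_density h.isOpen subset_rfl hp
  have H' : {q | c ≤ μHE[l - k] (normalSection φ Ω q)} ∈ 𝓝[φ '' Ω] p :=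
    nhdsWithin_mono _ h.image_subset H
  refine ⟨{q | c ≤ μHE[l - k] (normalSection φ Ω q)} ∩ φ '' Ω,
    inter_mem H' self_mem_nhdsWithin, ?_⟩
  have hm : MeasurableSet {q | c ≤ μHE[l - k] (normalSection φ Ω q)} :=
    measurableSet_le measurable_const h.measurable_density
  refine hv'.of_measure_le_smul (c := c⁻¹) (ENNReal.inv_ne_top.2 hc) ?_
  refine Measure.le_iff.2 fun E hE => ?_
  rw [Measure.smul_apply, smul_eq_mul, ← ENNReal.div_eq_inv_mul]
  -- The lower bound is only known to be nonzero; `c = ⊤` would make the set empty, since the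
  -- density is finite.
  by_cases hct : c = ⊤
  · have : {q | c ≤ μHE[l - k] (normalSection φ Ω q)} = ∅ :=
      eq_empty_of_forall_notMem fun q hq => h.density_ne_top q (top_le_iff.1 (hct ▸ hq))
    simp [this]
  rw [ENNReal.le_div_iff_mul_le (Or.inl hc) (Or.inl hct), withDensity_apply _ hE,
    Measure.restrict_restrict hE, Measure.restrict_apply hE, mul_comm, ← setLIntegral_const]
  refine (setLIntegral_mono' ?_ fun q hq => hq.2.1).trans
    (lintegral_mono_set fun q hq => ⟨hq.1, hq.2.2⟩)
  exact hE.inter (hm.inter h.measurableSet_image)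

end IsThinDomain

/-! ### Gluing functions that are locally constant along the fibres -/

namespace IsThinDomain

variable {k l r : ℕ} {M U Ω : Set (Euc l)} {φ : Euc l → Euc l}

theorem ae_restrict_of_ae_map (h : IsThinDomain k r M U φ Ω) {P : Euc l → Prop}
    (hP : ∀ᵐ p ∂(μHE[k].restrict (φ '' Ω)), P p) : ∀ᵐ x ∂(volume.restrict Ω), P (φ x) :=
  ae_of_ae_map h.aemeasurable (h.ae_map_iff_ae_restrict.2 hP)

/-- Two functions whose compositions with `φ` agree almost everywhere on an open set `T` agree
almost everywhere on `φ(T)`. -/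
theorem ae_eq_of_comp_ae_eq (h : IsThinDomain k r M U φ Ω) {T : Set (Euc l)} (hT : IsOpen T)
    (hTΩ : T ⊆ Ω) {F : Type*} [NormedAddCommGroup F] [MeasurableSpace F] [BorelSpace F]
    [SecondCountableTopology F] {f₁ f₂ : Euc l → F} (h₁ : Measurable f₁) (h₂ : Measurable f₂)
    (hf : ∀ᵐ x ∂(volume.restrict T), f₁ (φ x) = f₂ (φ x)) :
    ∀ᵐ p ∂(μHE[k] : Measure (Euc l)), p ∈ φ '' T → f₁ p = f₂ p := by
  obtain ⟨C, hC, H⟩ := h.isNormalProjection.exists_volume_comparable_lintegral h.two_le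
    h.isSubmanifold h.lt h.isCompact_closure h.closure_subset
  have hZ : MeasurableSet {p | f₁ p = f₂ p}ᶜ := (measurableSet_eq_fun h₁ h₂).compl
  have h0 : volume (T ∩ φ ⁻¹' {p | f₁ p = f₂ p}ᶜ) = 0 := by
    rw [ae_iff, Measure.restrict_apply₀' hT.measurableSet.nullMeasurableSet] at hf
    rw [inter_comm]; exact hf
  -- The lower comparison forces the sections of `T` to be null over almost every point of
  -- disagreement, whereas over `φ '' T` they have positive measure.
  have h1 := (H T hT (hTΩ.trans subset_closure) _ hZ).2
  rw [h0, mul_zero, nonpos_iff_eq_zero] at h1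
  have hm : Measurable fun p => μHE[l - k] (normalSection φ T p) :=
    measurable_normalSection (by have := h.lt; omega) hT (h.continuousOn.mono hTΩ)
  rw [setLIntegral_eq_zero_iff hZ hm] at h1
  filter_upwards [h1] with p hp hpT
  by_contra hne
  exact h.density_ne_zero hT hTΩ hpT (hp hne)

/-- Local factors of `f` agree over the images of overlaps, off a null set of base points. Over any
other point the local value is locally constant along the section, hence constant by connectedness.
The constraint `T` lets tangency pass through the gluing. -/
theorem exists_measurable_comp_ae_eq (h : IsThinDomain k r M U φ Ω)
    (hsec : HasConnectedNormalSections M φ Ω) {F : Type*} [NormedAddCommGroup F]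
    [MeasurableSpace F] [BorelSpace F] [SecondCountableTopology F] {f : Euc l → F}
    {T : Euc l → Set F}
    (hf : ∀ x ∈ Ω, ∃ N, IsOpen N ∧ x ∈ N ∧ ∃ f' : Euc l → F, Measurable f' ∧
      (∀ p ∈ φ '' N, f' p ∈ T p) ∧ ∀ᵐ y ∂(volume.restrict N), f y = f' (φ y)) :
    ∃ v : Euc l → F, Measurable v ∧ (∀ p ∈ φ '' Ω, v p ∈ T p) ∧
      ∀ᵐ x ∂(volume.restrict Ω), f x = v (φ x) := by
  classical
  rcases Ω.eq_empty_or_nonempty with rfl | ⟨x₀, hx₀⟩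
  · exact ⟨0, measurable_zero, by simp, by simp⟩
  choose! N₀ hN₀o hN₀x f₀ hf₀ hT₀ hfN₀ using hf
  obtain ⟨s, hs, hcov⟩ : ∃ s : Set Ω, s.Countable ∧ ⋃ x ∈ s, N₀ x = ⋃ x : Ω, N₀ x := by
    exact TopologicalSpace.isOpen_iUnion_countable (fun x : Ω => N₀ x)
      fun x => hN₀o x x.2
  have hcovΩ : Ω ⊆ ⋃ x ∈ s, N₀ x := fun x hx => hcov ▸ mem_iUnion.2 ⟨⟨x, hx⟩, hN₀x x hx⟩
  have hsne : s.Nonempty := by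
    obtain ⟨y, hy⟩ := mem_iUnion.1 (hcovΩ hx₀)
    obtain ⟨hy, -⟩ := mem_iUnion.1 hy
    exact ⟨y, hy⟩
  obtain ⟨e, he⟩ := hs.exists_eq_range hsne
  set N : ℕ → Set (Euc l) := fun n => N₀ (e n) ∩ Ω
  have hNo : ∀ n, IsOpen (N n) := fun n => (hN₀o _ (e n).2).inter h.isOpen
  have hNΩ : ∀ n, N n ⊆ Ω := fun n => inter_subset_right
  set F' : ℕ → Euc l → F := fun n => f₀ (e n)
  have hF' : ∀ n, Measurable (F' n) := fun n => hf₀ _ (e n).2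
  have hfF : ∀ n, ∀ᵐ y ∂(volume.restrict (N n)), f y = F' n (φ y) := fun n =>
    ae_restrict_of_ae_restrict_of_subset inter_subset_left (hfN₀ _ (e n).2)
  have hNcov : ∀ x ∈ Ω, ∃ n, x ∈ N n := fun x hx => by
    obtain ⟨y, hy⟩ := mem_iUnion.1 (hcovΩ hx)
    obtain ⟨hys, hy⟩ := mem_iUnion.1 hy
    obtain ⟨n, rfl⟩ := he ▸ hys
    exact ⟨n, hy, hx⟩
  -- Countability of the cover is essential: the exceptional base points of all pairs form a single
  -- null set.
  have hcompat : ∀ᵐ p ∂(μHE[k] : Measure (Euc l)), ∀ m n, p ∈ φ '' (N m ∩ N n) →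
      F' m p = F' n p := by
    refine ae_all_iff.2 fun m => ae_all_iff.2 fun n => ?_
    refine h.ae_eq_of_comp_ae_eq ((hNo m).inter (hNo n)) (inter_subset_left.trans (hNΩ m))
      (hF' m) (hF' n) ?_
    filter_upwards [ae_restrict_of_ae_restrict_of_subset inter_subset_left (hfF m),
      ae_restrict_of_ae_restrict_of_subset inter_subset_right (hfF n)] with x h1 h2
    exact h1.symm.trans h2
  have hmeas : ∀ n, MeasurableSet {p | p ∈ φ '' N n ∨ p ∉ φ '' Ω} := fun n => by
    obtain ⟨K, hK, e⟩ := (IsOpen.isSigmaCompact_of_sigmaCompactSpace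
      (hNo n)).image_of_continuousOn (h.continuousOn.mono (hNΩ n))
    exact MeasurableSet.union (e ▸ MeasurableSet.iUnion fun n => (hK n).measurableSet)
      h.measurableSet_image.compl
  have hex : ∀ p, ∃ n, p ∈ φ '' N n ∨ p ∉ φ '' Ω := fun p => by
    by_cases hp : p ∈ φ '' Ω
    · obtain ⟨x, hx, rfl⟩ := hp
      obtain ⟨n, hn⟩ := hNcov x hx
      exact ⟨n, Or.inl ⟨x, hn, rfl⟩⟩
    · exact ⟨0, Or.inr hp⟩
  -- The value at `p` is that of the first local factor whose domain meets the section over `p`; the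
  -- index is `0` for `p` outside `φ '' Ω`. This choice is measurable.
  refine ⟨fun p => F' (Nat.find (hex p)) p, Measurable.find hF' hmeas hex, fun p hp => ?_, ?_⟩
  · have := (Nat.find_spec (hex p)).resolve_right fun h' => h' hp
    exact hT₀ _ (e _).2 p (image_mono inter_subset_left this)
  have hall : ∀ᵐ x ∂(volume.restrict Ω), ∀ n, x ∈ N n → f x = F' n (φ x) :=
    ae_all_iff.2 fun n => by
      have := (ae_restrict_iff' (hNo n).measurableSet).1 (hfF n)
      exact ae_restrict_of_ae this
  filter_upwards [hall, h.ae_restrict_of_ae_map (ae_restrict_of_ae hcompat),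
    ae_restrict_mem h.isOpen.measurableSet] with x hx hc hxΩ
  choose! i hi using hNcov
  have hconn := hsec (φ x) (h.isNormalProjection.mapsTo (h.subset hxΩ))
  have hconst : ∀ y ∈ normalSection φ Ω (φ x), ∀ z ∈ normalSection φ Ω (φ x),
      F' (i y) (φ x) = F' (i z) (φ x) := fun y hy z hz => by
    -- Having the same local value is an equivalence relation that holds between neighbouring points
    -- of the section, because their domains overlap over `φ x`.
    refine hconn.induction₂ (fun y z => F' (i y) (φ x) = F' (i z) (φ x)) (fun y hy => ?_)
      (fun _ _ _ _ _ _ => Eq.trans) (fun _ _ _ _ => Eq.symm) hy hz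
    filter_upwards [self_mem_nhdsWithin,
      mem_nhdsWithin_of_mem_nhds ((hNo (i y)).mem_nhds (hi y hy.1))] with z hz hzN
    exact hc _ _ ⟨z, ⟨hzN, hi z hz.1⟩, hz.2⟩
  obtain ⟨y, hy, hyx⟩ := (Nat.find_spec (hex (φ x))).resolve_right fun h' => h' ⟨x, hxΩ, rfl⟩
  rw [hx (i x) (hi x hxΩ), hconst x ⟨hxΩ, rfl⟩ y ⟨hNΩ _ hy, hyx⟩]
  exact hc _ _ ⟨y, ⟨hi y (hNΩ _ hy), hy⟩, hyx⟩

end IsThinDomain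

/-! ### Calculus in fibre charts -/

namespace IsFiberChart

variable {k d l : ℕ} {φ : Euc l → Euc l} {σ : Euc k → Euc l} {N : Set (Euc l)}
  {A : Set (Euc k)} {B : Set (Euc d)} {Φ : Euc l → Euc k × Euc d} {Ψ : Euc k × Euc d → Euc l}
  {L : ℝ≥0}

theorem contDiffOn_coord (h : IsFiberChart φ σ N A B Φ Ψ L) :
    ContDiffOn ℝ 1 (fun x => (Φ x).1) N :=
  h.contDiffOn.fst

theorem differentiableAt_coord (h : IsFiberChart φ σ N A B Φ Ψ L) {x : Euc l} (hx : x ∈ N) :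
    DifferentiableAt ℝ (fun x => (Φ x).1) x :=
  (h.contDiffOn_coord.contDiffAt (h.isOpen_source.mem_nhds hx)).differentiableAt one_ne_zero

theorem fderiv_coord_symm (h : IsFiberChart φ σ N A B Φ Ψ L) {q : Euc k × Euc d}
    (hq : q ∈ A ×ˢ B) (w : Euc k × Euc d) :
    fderiv ℝ (fun x => (Φ x).1) (Ψ q) (fderiv ℝ Ψ q w) = w.1 := by
  have ho := (h.isOpen_left.prod h.isOpen_right).mem_nhds hq
  have h1 := (h.contDiffOn_symm.contDiffAt ho).differentiableAt one_ne_zero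
  have h2 := (h.differentiableAt_coord (h.mapsTo_symm hq)).hasFDerivAt.comp q h1.hasFDerivAt
  have h3 : HasFDerivAt (fun q => (Φ (Ψ q)).1) (ContinuousLinearMap.fst ℝ (Euc k) (Euc d)) q := by
    refine (ContinuousLinearMap.fst ℝ (Euc k) (Euc d)).hasFDerivAt.congr_of_eventuallyEq ?_
    filter_upwards [ho] with q' hq'
    rw [h.right_inv q' hq']; rfl
  exact congrArg (fun T => T w) (h2.unique h3)

theorem fderiv_projection (h : IsFiberChart φ σ N A B Φ Ψ L) {x : Euc l} (hx : x ∈ N)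
    (hσ : DifferentiableAt ℝ σ (Φ x).1) :
    fderiv ℝ φ x = (fderiv ℝ σ (Φ x).1).comp (fderiv ℝ (fun x => (Φ x).1) x) := by
  refine ((hσ.hasFDerivAt.comp x
    (h.differentiableAt_coord hx).hasFDerivAt).congr_of_eventuallyEq ?_).fderiv
  filter_upwards [h.isOpen_source.mem_nhds hx] with y hy
  exact (h.comp_eq y hy).symm

theorem fderiv_coord {r : ℕ} {M U : Set (Euc l)} {O : Set (Euc k)}
    (h : IsFiberChart φ σ N A B Φ Ψ L) (hφ : IsNormalProjection r M U φ) (hr : 2 ≤ r)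
    (hσ : IsLocalParam r M O σ) (hNU : N ⊆ U) (hAO : A ⊆ O) {x : Euc l} (hx : x ∈ N) :
    Function.Surjective (fderiv ℝ (fun x => (Φ x).1) x) ∧
      ∀ v, fderiv ℝ (fun x => (Φ x).1) x v = 0 ↔ v ∈ (tangentSpace M (φ x))ᗮ :=
  hφ.fderiv_coord hr hσ (hNU hx) (h.differentiableAt_coord hx) (hAO (h.mapsTo hx).1)
    (by filter_upwards [h.isOpen_source.mem_nhds hx] with y hy using h.comp_eq y hy)

/-- In the chart the preimage of `E` lies in `E × B`, and `B` has finite volume. This is what the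
weak chain rule needs in order to pull back along the coordinate. -/
theorem exists_volume_preimage_coord_le (h : IsFiberChart φ σ N A B Φ Ψ L) (hl : k + d = l) :
    ∃ C : ℝ≥0∞, C ≠ ⊤ ∧ ∀ E, volume (N ∩ (fun x => (Φ x).1) ⁻¹' E) ≤ C * volume E := by
  obtain ⟨C, hC, H⟩ := h.exists_volume_comparable hl
  have hB : volume B < ⊤ := h.isBounded_right.measure_lt_top
  refine ⟨C * volume B, by finiteness, fun E => (H _).1.trans ?_⟩
  have : A ×ˢ B ∩ Ψ ⁻¹' ((fun x => (Φ x).1) ⁻¹' E) ⊆ E ×ˢ B := fun q hq => by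
    have h1 : (Φ (Ψ q)).1 ∈ E := hq.2
    rw [h.right_inv q hq.1] at h1
    exact ⟨h1, hq.1.2⟩
  calc _ ≤ C * volume (E ×ˢ B) := mul_le_mul_right (measure_mono this) _
    _ = _ := by rw [Measure.volume_eq_prod, Measure.prod_prod]; ring

theorem ae_symm_iff (h : IsFiberChart φ σ N A B Φ Ψ L) (hl : k + d = l) {P : Euc l → Prop} :
    (∀ᵐ q ∂(volume.restrict (A ×ˢ B)), P (Ψ q)) ↔ ∀ᵐ x ∂(volume.restrict N), P x := by
  obtain ⟨C, hC, H⟩ := h.exists_volume_comparable hl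
  have hAB := (h.isOpen_left.prod h.isOpen_right).measurableSet.nullMeasurableSet (μ := volume)
  rw [ae_iff, ae_iff, Measure.restrict_apply₀' hAB,
    Measure.restrict_apply₀' h.isOpen_source.measurableSet.nullMeasurableSet,
    inter_comm, inter_comm _ N]
  obtain ⟨h1, h2⟩ := H {x | ¬ P x}
  constructor
  · intro h0
    refine le_antisymm (h1.trans (le_of_eq ?_)) zero_le
    rw [show Ψ ⁻¹' {x | ¬ P x} = {q | ¬ P (Ψ q)} from rfl, h0, mul_zero]
  · intro h0
    refine le_antisymm (h2.trans (le_of_eq ?_)) zero_le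
    rw [h0, mul_zero]

theorem ae_fst_iff (h : IsFiberChart φ σ N A B Φ Ψ L) (hB : B.Nonempty) {P : Euc k → Prop} :
    (∀ᵐ q ∂(volume.restrict (A ×ˢ B)), P q.1) ↔ ∀ᵐ ξ ∂(volume.restrict A), P ξ := by
  rw [IsSlicing.volume_restrict]
  refine ⟨fun H => ?_, fun H => Measure.quasiMeasurePreserving_fst.ae H⟩
  have hne : (volume.restrict B) ≠ 0 := by
    rw [Ne, Measure.restrict_eq_zero]
    exact (h.isOpen_right.measure_pos _ hB).ne'
  have : NeBot (ae (volume.restrict B)) := ae_neBot.2 hne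
  exact (Measure.ae_ae_of_ae_prod H).mono fun ξ hξ => hξ.exists.elim fun _ hp => hp

theorem ae_coord_iff (h : IsFiberChart φ σ N A B Φ Ψ L) (hl : k + d = l) (hB : B.Nonempty)
    {P : Euc k → Prop} :
    (∀ᵐ x ∂(volume.restrict N), P (Φ x).1) ↔ ∀ᵐ ξ ∂(volume.restrict A), P ξ := by
  rw [← h.ae_symm_iff hl, ← h.ae_fst_iff hB]
  refine eventually_congr ?_
  filter_upwards [ae_restrict_mem (h.isOpen_left.prod h.isOpen_right).measurableSet] with q hq
  rw [h.right_inv q hq]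

theorem exists_isSlicing (h : IsFiberChart φ σ N A B Φ Ψ L) (hl : k + d = l) {K : Set (Euc l)}
    (hK : IsCompact K) (hNK : N ⊆ K) : ∃ C, IsSlicing A B K Ψ L C := by
  obtain ⟨C, hC, H⟩ := h.exists_volume_comparable hl
  exact ⟨C, h.isOpen_left, h.isOpen_right, h.convex_right, h.contDiffOn_symm,
    h.lipschitzOnWith_symm, hK, fun q hq => hNK (h.mapsTo_symm hq), hC, fun E _ =>
    (H E).2.trans (mul_le_mul_right (measure_mono inter_subset_right) _)⟩

/-- A measurable function of the parameter is a measurable function on the ambient space. -/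
theorem exists_measurable_comp_param (h : IsFiberChart φ σ N A B Φ Ψ L) {F : Type*}
    [MeasurableSpace F] [Nonempty F] {w : Euc k → F} (hw : Measurable w) :
    ∃ f : Euc l → F, Measurable f ∧ ∀ ξ ∈ A, f (σ ξ) = w ξ := by
  have he : MeasurableEmbedding (A.domRestrict σ) :=
    h.lipschitzOnWith_param.continuousOn.measurableEmbedding h.isOpen_left.measurableSet
      h.injOn_param
  obtain ⟨f, hf, e⟩ := he.exists_measurable_extend (hw.comp measurable_subtype_coe)
    fun _ => inferInstance
  exact ⟨f, hf, fun ξ hξ => congrFun e ⟨ξ, hξ⟩⟩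

theorem hasWeakGradient_comp_coord (h : IsFiberChart φ σ N A B Φ Ψ L) (hl : k + d = l)
    {w : Euc k → ℝ} {γ : Euc k → Euc k} (H : HasWeakGradient A w γ) :
    HasWeakGradient N (fun x => w (Φ x).1) (fun x =>
      ContinuousLinearMap.adjoint (fderiv ℝ (fun x => (Φ x).1) x) (γ (Φ x).1)) := by
  obtain ⟨C, hC, hpush⟩ := h.exists_volume_preimage_coord_le hl
  exact HasWeakGradient.comp h.isOpen_source h.isOpen_left h.contDiffOn_coord
    (fun x hx => (h.mapsTo hx).1) hC (fun E _ => hpush E) H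

end IsFiberChart

theorem ThinDomain.normalProj_eq_zero_iff {l : ℕ} {M : Set (Euc l)} {φ : Euc l → Euc l}
    {x w : Euc l} : normalProj M φ x w = 0 ↔ w ∈ tangentSpace M (φ x) := by
  rw [normalProj, sub_apply, ContinuousLinearMap.id_apply, sub_eq_zero,
    ← Submodule.starProjection_eq_self_iff, eq_comm]

namespace IsThinDomain

variable {k l r : ℕ} {M U Ω : Set (Euc l)} {φ : Euc l → Euc l}

/-- In a fibre chart, a weakly differentiable function with tangential gradient is a function of the
parameter only. -/
theorem exists_isFiberChart_factor (h : IsThinDomain k r M U φ Ω) {u : Euc l → ℝ}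
    {g : Euc l → Euc l} (H : HasWeakGradient Ω u g)
    (hg : ∀ᵐ x ∂(volume.restrict Ω), g x ∈ tangentSpace M (φ x)) {O : Set (Euc k)}
    {σ : Euc k → Euc l} (hσ : IsLocalParam r M O σ) {x₀ : Euc l} (hx₀ : x₀ ∈ Ω) {ξ₀ : Euc k}
    (hξ₀ : ξ₀ ∈ O) (hφx : φ x₀ = σ ξ₀) :
    ∃ (N : Set (Euc l)) (A : Set (Euc k)) (B : Set (Euc (l - k)))
      (Φ : Euc l → Euc k × Euc (l - k)) (Ψ : Euc k × Euc (l - k) → Euc l) (L : ℝ≥0),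
      IsFiberChart φ σ N A B Φ Ψ L ∧ x₀ ∈ N ∧ N ⊆ Ω ∧ A ⊆ O ∧ (Φ x₀).1 = ξ₀ ∧
      ∃ (w : Euc k → ℝ) (γ : Euc k → Euc k), HasWeakGradient A w γ ∧
        (∀ᵐ x ∂(volume.restrict N), u x = w (Φ x).1) ∧
        ∀ᵐ x ∂(volume.restrict N),
          g x = ContinuousLinearMap.adjoint (fderiv ℝ (fun x => (Φ x).1) x) (γ (Φ x).1) := by
  have hl : k + (l - k) = l := by have := h.lt; omega
  obtain ⟨ε, hε, hεΩ⟩ := Metric.nhds_basis_closedBall.mem_iff.1 (h.isOpen.mem_nhds hx₀)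
  obtain ⟨N, A, B, Φ, Ψ, L, hN, hxN, hNK, hNU, hAO, hΦx⟩ :=
    h.isNormalProjection.exists_isFiberChart h.two_le hσ (h.subset hx₀) hξ₀ hφx
      (closedBall_mem_nhds x₀ hε)
  have hNΩ := hNK.trans hεΩ
  obtain ⟨C, hS⟩ := hN.exists_isSlicing hl (isCompact_closedBall x₀ ε) hNK
  have hB : B.Nonempty := ⟨_, (hN.mapsTo hxN).2⟩
  have hABm := (hN.isOpen_left.prod hN.isOpen_right).measurableSet
  have hgN : ∀ᵐ x ∂(volume.restrict N), g x ∈ tangentSpace M (φ x) :=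
    ae_restrict_of_ae_restrict_of_subset hNΩ hg
  -- `DΨ` sends `B`-directions into the kernel of the coordinate derivative, that is, into the
  -- normal space, which is orthogonal to the tangential `g`.
  have hg0 : ∀ᵐ q ∂(volume.restrict (A ×ˢ B)), ∀ η, ⟪g (Ψ q), fderiv ℝ Ψ q (0, η)⟫_ℝ = 0 := by
    filter_upwards [(hN.ae_symm_iff hl).2 hgN, ae_restrict_mem hABm] with q hq hqAB η
    refine Submodule.inner_right_of_mem_orthogonal hq ?_
    rw [← (hN.fderiv_coord h.isNormalProjection h.two_le hσ hNU hAO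
      (hN.mapsTo_symm hqAB)).2, hN.fderiv_coord_symm hqAB]
  have hne : NeBot (ae (volume.restrict B)) := by
    rw [ae_neBot, Ne, Measure.restrict_eq_zero]
    exact (hN.isOpen_right.measure_pos _ hB).ne'
  -- One slice `b` is good for both properties; `w` is `u ∘ Ψ` on this slice.
  obtain ⟨b, hb1, hb2⟩ := ((hS.ae_hasWeakGradient h.isOpen hεΩ H).and
    (hS.ae_eq_slice h.isOpen hεΩ H hg0)).exists
  refine ⟨N, A, B, Φ, Ψ, L, hN, hxN, hNΩ, hAO, hΦx, _, _, hb1, ?_, ?_⟩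
  all_goals
    have hu : ∀ᵐ x ∂(volume.restrict N), u x = u (Ψ ((Φ x).1, b)) := by
      refine (hN.ae_symm_iff hl).1 ?_
      filter_upwards [hb2, ae_restrict_mem hABm] with q hq hqAB
      rw [hN.right_inv q hqAB, hq]
  · exact hu
  -- The chain rule for `w` along the coordinate gives a second weak gradient of `u`; uniqueness
  -- identifies it with `g`.
  · have h1 := hN.hasWeakGradient_comp_coord hl hb1
    exact (H.mono hNΩ).ae_eq hN.isOpen_source (h1.congr_ae (hu.mono fun x hx => hx.symm)
      (ae_eq_refl _))

end IsThinDomain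

/-! ### Linear algebra of tangential gradients -/

theorem ContinuousLinearMap.adjoint_injective_of_surjective {m n : ℕ} {D : Euc m →L[ℝ] Euc n}
    (hD : Function.Surjective D) : Function.Injective (ContinuousLinearMap.adjoint D) := by
  intro a b hab
  refine ext_inner_right ℝ fun v => ?_
  obtain ⟨w, rfl⟩ := hD v
  rw [← ContinuousLinearMap.adjoint_inner_left, hab, ContinuousLinearMap.adjoint_inner_left]

/-- The inverse of the restriction of the adjoint of `D` to the range of `D`, for injective `D`. -/
noncomputable def adjointRightInverse {k l : ℕ} (D : Euc k →L[ℝ] Euc l) : Euc k →L[ℝ] Euc l :=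
  D.comp (Ring.inverse ((ContinuousLinearMap.adjoint D).comp D))

theorem isUnit_adjoint_comp_self {k l : ℕ} {D : Euc k →L[ℝ] Euc l} (hD : Function.Injective D) :
    IsUnit ((ContinuousLinearMap.adjoint D).comp D) := by
  have hinj : Function.Injective ((ContinuousLinearMap.adjoint D).comp D) := by
    refine (injective_iff_map_eq_zero _).2 fun v hv => hD ?_
    have : ⟪D v, D v⟫_ℝ = 0 := by
      rw [← ContinuousLinearMap.adjoint_inner_left]
      rw [ContinuousLinearMap.comp_apply] at hv
      rw [hv, inner_zero_left]
    rw [inner_self_eq_zero.1 this, map_zero]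
  have hsurj := LinearMap.surjective_of_injective
    (f := ((ContinuousLinearMap.adjoint D).comp D : Euc k →L[ℝ] Euc k).toLinearMap) hinj
  exact ContinuousLinearMap.isUnit_iff_bijective.2 ⟨hinj, hsurj⟩

theorem adjoint_adjointRightInverse {k l : ℕ} {D : Euc k →L[ℝ] Euc l}
    (hD : Function.Injective D) (w : Euc k) :
    ContinuousLinearMap.adjoint D (adjointRightInverse D w) = w := by
  have := Ring.mul_inverse_cancel _ (isUnit_adjoint_comp_self hD)
  exact congrArg (fun T : Euc k →L[ℝ] Euc k => T w) this

/-- The kernel of the adjoint is the orthogonal complement of the range, so it contains no nonzero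
difference of two vectors of the range. -/
theorem eq_of_adjoint_eq_of_mem_range {k l : ℕ} {D : Euc k →L[ℝ] Euc l} {X Y : Euc l}
    (hX : X ∈ (D : Euc k →ₗ[ℝ] Euc l).range) (hY : Y ∈ (D : Euc k →ₗ[ℝ] Euc l).range)
    (h : ContinuousLinearMap.adjoint D X = ContinuousLinearMap.adjoint D Y) : X = Y := by
  obtain ⟨ξ, hξ⟩ := Submodule.sub_mem _ hX hY
  have : ⟪X - Y, X - Y⟫_ℝ = 0 := by
    have h1 : X - Y = D ξ := hξ.symm
    nth_rw 2 [h1]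
    rw [← ContinuousLinearMap.adjoint_inner_left, map_sub, h, sub_self, inner_zero_left]
  exact sub_eq_zero.1 (inner_self_eq_zero.1 this)

theorem ContinuousOn.adjointRightInverse {X : Type*} [TopologicalSpace X] {k l : ℕ}
    {D : X → Euc k →L[ℝ] Euc l} {s : Set X} (hD : ContinuousOn D s)
    (hinj : ∀ x ∈ s, Function.Injective (D x)) :
    ContinuousOn (fun x => _root_.adjointRightInverse (D x)) s := by
  have h1 : ContinuousOn (fun x => (ContinuousLinearMap.adjoint (D x)).comp (D x)) s :=
    (ContinuousLinearMap.adjoint.continuous.comp_continuousOn hD).clm_comp hD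
  refine hD.clm_comp fun x hx => ?_
  obtain ⟨y, hy⟩ := isUnit_adjoint_comp_self (hinj x hx)
  have := NormedRing.inverse_continuousAt y
  rw [hy] at this
  exact ContinuousAt.comp_continuousWithinAt (f := fun x =>
    (ContinuousLinearMap.adjoint (D x)).comp (D x)) this (h1 x hx)

theorem ThinDomain.MemL2Loc.aestronglyMeasurable {n : ℕ} {F : Type*} [NormedAddCommGroup F]
    {ν : Measure (Euc n)} {S : Set (Euc n)} {f : Euc n → F} (hS : IsSigmaCompact S)
    (h : MemL2Loc ν S f) : AEStronglyMeasurable f (ν.restrict S) := by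
  obtain ⟨K, hK, rfl⟩ := hS
  exact aestronglyMeasurable_iUnion_iff.2 fun n => (h _ (hK n) (subset_iUnion K n)).1

theorem ThinDomain.IsLocalParam.restrict {k l r : ℕ} {M : Set (Euc l)} {O A : Set (Euc k)}
    {σ : Euc k → Euc l} (h : IsLocalParam r M O σ) (hA : IsOpen A) (hAO : A ⊆ O) :
    IsLocalParam r M A σ := by
  -- The witness `interior (σ '' A ∪ Mᶜ)` is the largest open set meeting `M` only inside `σ '' A`.
  refine ⟨hA, h.contDiffOn.mono hAO, fun ξ hξ => h.injective_fderiv ξ (hAO hξ),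
    h.isEmbedding.comp (Topology.IsEmbedding.inclusion hAO), interior (σ '' A ∪ Mᶜ),
    isOpen_interior, ?_⟩
  apply Subset.antisymm
  · rintro _ ⟨ξ, hξ, rfl⟩
    refine ⟨h.apply_mem (hAO hξ), mem_interior_iff_mem_nhds.2 ?_⟩
    have h1 := h.eventually_mem_image (hAO hξ) (hA.mem_nhds hξ)
    rw [inter_eq_right.2 hAO] at h1
    filter_upwards [eventually_nhdsWithin_iff.1 h1] with p hp
    exact (em (p ∈ M)).imp hp id
  · rintro p ⟨hpM, hp⟩
    exact (interior_subset hp).resolve_right fun h' => h' hpM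

/-! ### The adjoint of `Dφ` on tangent vectors. -/

namespace IsFiberChart

variable {k d l : ℕ} {φ : Euc l → Euc l} {σ : Euc k → Euc l} {N : Set (Euc l)}
  {A : Set (Euc k)} {B : Set (Euc d)} {Φ : Euc l → Euc k × Euc d} {Ψ : Euc k × Euc d → Euc l}
  {L : ℝ≥0}

theorem exists_measurable_comp_projection (h : IsFiberChart φ σ N A B Φ Ψ L) (hl : k + d = l)
    (hB : B.Nonempty) {F : Type*} [NormedAddCommGroup F] [MeasurableSpace F] [BorelSpace F]
    {w : Euc k → F} (hw : AEStronglyMeasurable w (volume.restrict A)) :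
    ∃ f : Euc l → F, Measurable f ∧ ∀ᵐ x ∂(volume.restrict N), w (Φ x).1 = f (φ x) := by
  obtain ⟨f, hf, hfσ⟩ := h.exists_measurable_comp_param hw.aemeasurable.measurable_mk
  refine ⟨f, hf, ?_⟩
  filter_upwards [(h.ae_coord_iff hl hB).2 hw.aemeasurable.ae_eq_mk,
    ae_restrict_mem h.isOpen_source.measurableSet] with x hx hxN
  rw [hx, ← h.comp_eq x hxN, hfσ _ (h.mapsTo hxN).1]

theorem adjoint_fderiv_projection (h : IsFiberChart φ σ N A B Φ Ψ L) {x : Euc l} (hx : x ∈ N)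
    (hσ : DifferentiableAt ℝ σ (Φ x).1) (X : Euc l) :
    ContinuousLinearMap.adjoint (fderiv ℝ φ x) X =
      ContinuousLinearMap.adjoint (fderiv ℝ (fun x => (Φ x).1) x)
        (ContinuousLinearMap.adjoint (fderiv ℝ σ (Φ x).1) X) := by
  rw [h.fderiv_projection hx hσ, ContinuousLinearMap.adjoint_comp]; rfl

variable {r : ℕ} {M U : Set (Euc l)} {O : Set (Euc k)}

theorem tangentSpace_eq (h : IsFiberChart φ σ N A B Φ Ψ L) (hr : 2 ≤ r)
    (hσ : IsLocalParam r M O σ) (hAO : A ⊆ O) {x : Euc l} (hx : x ∈ N) :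
    tangentSpace M (φ x) = (fderiv ℝ σ (Φ x).1 : Euc k →ₗ[ℝ] Euc l).range := by
  rw [← h.comp_eq x hx, hσ.tangentSpace_eq (by omega) (hAO (h.mapsTo hx).1)]

/-- The adjoint of the derivative of a normal projection is injective on tangent vectors. -/
theorem adjoint_fderiv_injOn (h : IsFiberChart φ σ N A B Φ Ψ L) (hφ : IsNormalProjection r M U φ)
    (hr : 2 ≤ r) (hσ : IsLocalParam r M O σ) (hNU : N ⊆ U) (hAO : A ⊆ O) {x : Euc l}
    (hx : x ∈ N) :
    InjOn (ContinuousLinearMap.adjoint (fderiv ℝ φ x)) (tangentSpace M (φ x) : Set (Euc l)) := by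
  intro X hX Y hY hXY
  have hd := hσ.differentiableAt (by omega) (hAO (h.mapsTo hx).1)
  rw [h.adjoint_fderiv_projection hx hd, h.adjoint_fderiv_projection hx hd] at hXY
  rw [SetLike.mem_coe, h.tangentSpace_eq hr hσ hAO hx] at hX hY
  exact eq_of_adjoint_eq_of_mem_range hX hY (ContinuousLinearMap.adjoint_injective_of_surjective
    (h.fderiv_coord hφ hr hσ hNU hAO hx).1 hXY)

theorem continuousOn_adjointRightInverse (h : IsFiberChart φ σ N A B Φ Ψ L) (hr : 2 ≤ r)
    (hσ : IsLocalParam r M O σ) (hAO : A ⊆ O) :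
    ContinuousOn (fun ξ => adjointRightInverse (fderiv ℝ σ ξ)) A := by
  refine ContinuousOn.adjointRightInverse ?_ fun ξ hξ => hσ.injective_fderiv ξ (hAO hξ)
  exact (hσ.contDiffOn.mono hAO).continuousOn_fderiv_of_isOpen h.isOpen_left
    (by exact_mod_cast (by omega : 1 ≤ r))

/-- `X` is recovered from `Dφᵀ X` in two bounded steps: the adjoint of `DΨ` along `A` yields `Dσᵀ
X`, and `adjointRightInverse` recovers a tangent vector from that. -/
theorem norm_le_of_adjoint (h : IsFiberChart φ σ N A B Φ Ψ L) (hr : 2 ≤ r)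
    (hσ : IsLocalParam r M O σ) (hAO : A ⊆ O) {x : Euc l} (hx : x ∈ N) {X : Euc l}
    (hX : X ∈ tangentSpace M (φ x)) :
    ‖X‖ ≤ ‖adjointRightInverse (fderiv ℝ σ (Φ x).1)‖ * L *
      ‖ContinuousLinearMap.adjoint (fderiv ℝ φ x) X‖ := by
  have hq := h.mapsTo hx
  have hd := hσ.differentiableAt (by omega) (hAO hq.1)
  have hi := hσ.injective_fderiv _ (hAO hq.1)
  set γ := ContinuousLinearMap.adjoint (fderiv ℝ σ (Φ x).1) X with hγ
  have hXγ : X = adjointRightInverse (fderiv ℝ σ (Φ x).1) γ := by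
    rw [h.tangentSpace_eq hr hσ hAO hx] at hX
    exact eq_of_adjoint_eq_of_mem_range hX ⟨_, rfl⟩ (adjoint_adjointRightInverse hi _).symm
  have hγ' : γ = ContinuousLinearMap.adjoint ((fderiv ℝ Ψ (Φ x)).comp
      (ContinuousLinearMap.inl ℝ (Euc k) (Euc d)))
        (ContinuousLinearMap.adjoint (fderiv ℝ φ x) X) := by
    rw [h.adjoint_fderiv_projection hx hd, ← hγ]
    clear_value γ
    refine ext_inner_right ℝ fun v => ?_
    have := h.fderiv_coord_symm hq (v, 0)
    rw [h.left_inv x hx] at this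
    rw [ContinuousLinearMap.adjoint_inner_left _ v _, ContinuousLinearMap.comp_apply,
      ContinuousLinearMap.inl_apply, ContinuousLinearMap.adjoint_inner_left, this]
  have h1 : ‖fderiv ℝ Ψ (Φ x)‖ ≤ L := norm_fderiv_le_of_lipschitzOn ℝ
    ((h.isOpen_left.prod h.isOpen_right).mem_nhds hq) h.lipschitzOnWith_symm
  have h2 : ‖(fderiv ℝ Ψ (Φ x)).comp (ContinuousLinearMap.inl ℝ (Euc k) (Euc d))‖ ≤ L := by
    refine ContinuousLinearMap.opNorm_le_bound _ L.coe_nonneg fun v => ?_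
    refine ((fderiv ℝ Ψ (Φ x)).le_of_opNorm_le h1 _).trans (le_of_eq ?_)
    simp [Prod.norm_def]
  calc ‖X‖ ≤ ‖adjointRightInverse (fderiv ℝ σ (Φ x).1)‖ * ‖γ‖ := by
        conv_lhs => rw [hXγ]
        exact ContinuousLinearMap.le_opNorm _ _
    _ ≤ ‖adjointRightInverse (fderiv ℝ σ (Φ x).1)‖ * (L *
          ‖ContinuousLinearMap.adjoint (fderiv ℝ φ x) X‖) := by
        gcongr
        rw [hγ']
        refine (ContinuousLinearMap.le_opNorm _ _).trans ?_
        rw [LinearIsometryEquiv.norm_map]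
        gcongr
    _ = _ := by ring

end IsFiberChart

/-- The chart estimate has a locally bounded constant, by continuity of `adjointRightInverse` along
`σ`. Applied to the closure of `Ω`, it bounds `∇v ∘ φ` by `∇u`. -/
theorem ThinDomain.IsNormalProjection.exists_norm_le_adjoint {k l r : ℕ} {M U : Set (Euc l)}
    {φ : Euc l → Euc l} (hφ : IsNormalProjection r M U φ) (hr : 2 ≤ r)
    (hM : IsSubmanifold k r M) {K : Set (Euc l)} (hK : IsCompact K) (hKU : K ⊆ U) :
    ∃ c : ℝ, ∀ x ∈ K, ∀ X ∈ tangentSpace M (φ x),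
      ‖X‖ ≤ c * ‖ContinuousLinearMap.adjoint (fderiv ℝ φ x) X‖ := by
  refine hK.induction_on (p := fun K => ∃ c : ℝ, ∀ x ∈ K, ∀ X ∈ tangentSpace M (φ x),
      ‖X‖ ≤ c * ‖ContinuousLinearMap.adjoint (fderiv ℝ φ x) X‖) ⟨0, by simp⟩ ?_ ?_ ?_
  · rintro s t hst ⟨c, hc⟩
    exact ⟨c, fun x hx => hc x (hst hx)⟩
  · rintro s t ⟨c, hc⟩ ⟨c', hc'⟩
    refine ⟨max c c', fun x hx X hX => ?_⟩
    rcases hx with hx | hx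
    · exact (hc x hx X hX).trans (by gcongr; exact le_max_left _ _)
    · exact (hc' x hx X hX).trans (by gcongr; exact le_max_right _ _)
  · intro x hx
    obtain ⟨O, σ, N, A, B, Φ, Ψ, L, hσ, hN, hxN, -, -, hAO⟩ :=
      hφ.exists_isFiberChart_of_mem hr hM (hKU hx) univ_mem
    have hA := (hN.mapsTo hxN).1
    have hc : ContinuousAt (fun y => ‖adjointRightInverse (fderiv ℝ σ (Φ y).1)‖) x := by
      refine ContinuousAt.norm (ContinuousAt.comp (f := fun y => (Φ y).1)
        (g := fun ξ => adjointRightInverse (fderiv ℝ σ ξ)) ?_ ?_)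
      · exact (hN.continuousOn_adjointRightInverse hr hσ hAO).continuousAt
          (hN.isOpen_left.mem_nhds hA)
      · exact (hN.differentiableAt_coord hxN).continuousAt
    refine ⟨{y | ‖adjointRightInverse (fderiv ℝ σ (Φ y).1)‖ <
      ‖adjointRightInverse (fderiv ℝ σ (Φ x).1)‖ + 1} ∩ N, mem_nhdsWithin_of_mem_nhds
        (inter_mem (hc.eventually (gt_mem_nhds (lt_add_one _))) (hN.isOpen_source.mem_nhds hxN)),
      (‖adjointRightInverse (fderiv ℝ σ (Φ x).1)‖ + 1) * L, fun y hy X hX => ?_⟩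
    refine (hN.norm_le_of_adjoint hr hσ hAO hy.2 hX).trans ?_
    have : ‖adjointRightInverse (fderiv ℝ σ (Φ y).1)‖ ≤ _ := le_of_lt hy.1
    gcongr

/-! ### Sobolev functions that are constant along the fibres -/

namespace IsThinDomain

variable {k l r : ℕ} {M U Ω : Set (Euc l)} {φ : Euc l → Euc l}

theorem isSigmaCompact_image (h : IsThinDomain k r M U φ Ω) : IsSigmaCompact (φ '' Ω) :=
  (IsOpen.isSigmaCompact_of_sigmaCompactSpace h.isOpen).image_of_continuousOn h.continuousOn

theorem mem_isFiberChart (h : IsThinDomain k r M U φ Ω) {x₀ : Euc l} (hx₀ : x₀ ∈ Ω) :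
    ∃ (O : Set (Euc k)) (σ : Euc k → Euc l) (ξ₀ : Euc k), IsLocalParam r M O σ ∧ ξ₀ ∈ O ∧
      φ x₀ = σ ξ₀ := by
  obtain ⟨O, σ, hσ, ξ₀, hξ₀, e⟩ :=
    h.isSubmanifold (φ x₀) (h.isNormalProjection.mapsTo (h.subset hx₀))
  exact ⟨O, σ, ξ₀, hσ, hξ₀, e.symm⟩

theorem adjoint_fderiv_injOn (h : IsThinDomain k r M U φ Ω) {x : Euc l} (hx : x ∈ Ω) :
    InjOn (ContinuousLinearMap.adjoint (fderiv ℝ φ x)) (tangentSpace M (φ x) : Set (Euc l)) := by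
  obtain ⟨O, σ, N, A, B, Φ, Ψ, L, hσ, hN, hxN, -, hNΩ, hAO⟩ := h.exists_isFiberChart hx univ_mem
  exact hN.adjoint_fderiv_injOn h.isNormalProjection h.two_le hσ (hNΩ.trans h.subset) hAO hxN

/-- `Dφ` kills normal vectors, so the range of its adjoint is orthogonal to the normal space. -/
theorem adjoint_fderiv_mem (h : IsThinDomain k r M U φ Ω) {x : Euc l} (hx : x ∈ Ω) (X : Euc l) :
    ContinuousLinearMap.adjoint (fderiv ℝ φ x) X ∈ tangentSpace M (φ x) := by
  obtain ⟨O, σ, N, A, B, Φ, Ψ, L, hσ, hN, hxN, -, hNΩ, hAO⟩ := h.exists_isFiberChart hx univ_mem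
  have hd := hσ.differentiableAt (by have := h.two_le; omega) (hAO (hN.mapsTo hxN).1)
  rw [← Submodule.orthogonal_orthogonal (tangentSpace M (φ x)), Submodule.mem_orthogonal']
  intro v hv
  rw [ContinuousLinearMap.adjoint_inner_left, hN.fderiv_projection hxN hd,
    ContinuousLinearMap.comp_apply, ((hN.fderiv_coord h.isNormalProjection h.two_le hσ
      (hNΩ.trans h.subset) hAO hxN).2 v).2 hv, map_zero, inner_zero_right]

/-- A weakly differentiable function with tangential gradient factors through the projection. -/
theorem exists_comp_ae_eq (h : IsThinDomain k r M U φ Ω)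
    (hsec : HasConnectedNormalSections M φ Ω) {u : Euc l → ℝ} {g : Euc l → Euc l}
    (H : HasWeakGradient Ω u g)
    (hg : ∀ᵐ x ∂(volume.restrict Ω), g x ∈ tangentSpace M (φ x)) :
    ∃ v : Euc l → ℝ, Measurable v ∧ ∀ᵐ x ∂(volume.restrict Ω), u x = v (φ x) := by
  have hl : k + (l - k) = l := by have := h.lt; omega
  suffices ∃ v : Euc l → ℝ, Measurable v ∧ (∀ p ∈ φ '' Ω, v p ∈ univ) ∧
      ∀ᵐ x ∂(volume.restrict Ω), u x = v (φ x) from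
    let ⟨v, hv, _, hv'⟩ := this; ⟨v, hv, hv'⟩
  refine h.exists_measurable_comp_ae_eq hsec (T := fun _ => univ) fun x hx => ?_
  obtain ⟨O, σ, ξ₀, hσ, hξ₀, e⟩ := h.mem_isFiberChart hx
  obtain ⟨N, A, B, Φ, Ψ, L, hN, hxN, hNΩ, hAO, -, w, γ, hw, hu, -⟩ :=
    h.exists_isFiberChart_factor H hg hσ hx hξ₀ e
  obtain ⟨f, hf, hwf⟩ := hN.exists_measurable_comp_projection hl ⟨_, (hN.mapsTo hxN).2⟩
    (hw.memL2Loc.aestronglyMeasurable (IsOpen.isSigmaCompact_of_sigmaCompactSpace hN.isOpen_left))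
  exact ⟨N, hN.isOpen_source, hxN, f, hf, fun _ _ => mem_univ _, by
    filter_upwards [hu, hwf] with y h1 h2 using h1.trans h2⟩

/-- The gradient of such a function is the pull-back of a tangent vector field. -/
theorem exists_tangent_field (h : IsThinDomain k r M U φ Ω)
    (hsec : HasConnectedNormalSections M φ Ω) {u : Euc l → ℝ} {g : Euc l → Euc l}
    (H : HasWeakGradient Ω u g)
    (hg : ∀ᵐ x ∂(volume.restrict Ω), g x ∈ tangentSpace M (φ x)) :
    ∃ V : Euc l → Euc l, Measurable V ∧ (∀ p ∈ φ '' Ω, V p ∈ tangentSpace M p) ∧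
      ∀ᵐ x ∂(volume.restrict Ω), g x = ContinuousLinearMap.adjoint (fderiv ℝ φ x) (V (φ x)) := by
  classical
  have hl : k + (l - k) = l := by have := h.lt; omega
  -- A pointwise solution of `g x = Dφ(x)ᵀ X`, chosen without regard to measurability. Injectivity
  -- of `Dφ(x)ᵀ` on tangent vectors makes it agree with the measurable local formulas, so the gluing
  -- applies to `X`.
  set X : Euc l → Euc l := fun x =>
    if hx : ∃ Y ∈ tangentSpace M (φ x), g x = ContinuousLinearMap.adjoint (fderiv ℝ φ x) Y
    then hx.choose else 0
  have hX : ∀ x ∈ Ω, ∀ Y ∈ tangentSpace M (φ x),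
      g x = ContinuousLinearMap.adjoint (fderiv ℝ φ x) Y → X x = Y := by
    intro x hx Y hY hgY
    have hex : ∃ Y ∈ tangentSpace M (φ x),
      g x = ContinuousLinearMap.adjoint (fderiv ℝ φ x) Y := ⟨Y, hY, hgY⟩
    simp only [X, dif_pos hex]
    exact h.adjoint_fderiv_injOn hx hex.choose_spec.1 hY (hex.choose_spec.2.symm.trans hgY)
  have key : ∀ x ∈ Ω, ∃ N, IsOpen N ∧ x ∈ N ∧ ∃ f' : Euc l → Euc l, Measurable f' ∧
      (∀ p ∈ φ '' N, f' p ∈ (tangentSpace M p : Set (Euc l))) ∧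
      ∀ᵐ y ∂(volume.restrict N), X y = f' (φ y) ∧
        g y = ContinuousLinearMap.adjoint (fderiv ℝ φ y) (X y) := by
    intro x hx
    obtain ⟨O, σ, ξ₀, hσ, hξ₀, e⟩ := h.mem_isFiberChart hx
    obtain ⟨N, A, B, Φ, Ψ, L, hN, hxN, hNΩ, hAO, -, w, γ, hw, -, hgN⟩ :=
      h.exists_isFiberChart_factor H hg hσ hx hξ₀ e
    have hγ := hw.memL2Loc_grad.aestronglyMeasurable
      (IsOpen.isSigmaCompact_of_sigmaCompactSpace hN.isOpen_left)
    have hR : Measurable (A.indicator fun ξ => adjointRightInverse (fderiv ℝ σ ξ)) :=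
      (hN.continuousOn_adjointRightInverse h.two_le hσ hAO).measurable_indicator
        hN.isOpen_left.measurableSet
    have happ : Continuous fun p : (Euc k →L[ℝ] Euc l) × Euc k => p.1 p.2 :=
      isBoundedBilinearMap_apply.continuous
    have hRγ : Measurable fun ξ => (A.indicator fun ξ => adjointRightInverse (fderiv ℝ σ ξ)) ξ
        (hγ.mk γ ξ) := happ.measurable.comp (hR.prodMk hγ.stronglyMeasurable_mk.measurable)
    obtain ⟨f, hf, hfσ⟩ := hN.exists_measurable_comp_param hRγ
    have hfN : ∀ y ∈ N, f (φ y) = adjointRightInverse (fderiv ℝ σ (Φ y).1) (hγ.mk γ (Φ y).1) := by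
      intro y hy
      rw [← hN.comp_eq y hy, hfσ _ (hN.mapsTo hy).1, indicator_of_mem (hN.mapsTo hy).1]
    have hT : ∀ y ∈ N, ∀ v, adjointRightInverse (fderiv ℝ σ (Φ y).1) v ∈ tangentSpace M (φ y) := by
      intro y hy v
      rw [hN.tangentSpace_eq h.two_le hσ hAO hy]
      exact ⟨_, rfl⟩
    refine ⟨N, hN.isOpen_source, hxN, f, hf, ?_, ?_⟩
    · rintro _ ⟨y, hy, rfl⟩
      rw [hfN y hy]
      exact hT y hy _
    filter_upwards [hgN, (hN.ae_coord_iff hl ⟨_, (hN.mapsTo hxN).2⟩).2 hγ.ae_eq_mk,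
      ae_restrict_mem hN.isOpen_source.measurableSet] with y h1 h2 hyN
    have hA := hAO (hN.mapsTo hyN).1
    have hd := hσ.differentiableAt (by have := h.two_le; omega) hA
    have hgy : g y = ContinuousLinearMap.adjoint (fderiv ℝ φ y)
        (adjointRightInverse (fderiv ℝ σ (Φ y).1) (γ (Φ y).1)) := by
      rw [hN.adjoint_fderiv_projection hyN hd,
        adjoint_adjointRightInverse (hσ.injective_fderiv _ hA), h1]
    rw [hX y (hNΩ hyN) _ (hT y hyN _) hgy, hfN y hyN, ← h2]
    exact ⟨rfl, hgy⟩
  have hall : ∀ᵐ y ∂(volume.restrict Ω),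
      g y = ContinuousLinearMap.adjoint (fderiv ℝ φ y) (X y) := by
    rw [ae_iff, Measure.restrict_apply₀' h.isOpen.measurableSet.nullMeasurableSet]
    refine measure_null_of_locally_null _ fun x hx => ?_
    obtain ⟨N, hN, hxN, f, -, -, hf⟩ := key x hx.2
    refine ⟨_, inter_mem_nhdsWithin _ (hN.mem_nhds hxN), ?_⟩
    have := ae_iff.1 (hf.mono fun y hy => hy.2)
    rw [Measure.restrict_apply₀' hN.measurableSet.nullMeasurableSet] at this
    exact measure_mono_null (inter_subset_inter_left _ inter_subset_left) this
  obtain ⟨V, hV, hVT, hXV⟩ := h.exists_measurable_comp_ae_eq hsec (f := X) fun x hx => by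
    obtain ⟨N, hN, hxN, f, hf, hfT, hXf⟩ := key x hx
    exact ⟨N, hN, hxN, f, hf, hfT, hXf.mono fun y hy => hy.1⟩
  refine ⟨V, hV, hVT, ?_⟩
  filter_upwards [hall, hXV] with x h1 h2
  rwa [← h2]

/-- Pull-back of a weakly differentiable function on `φ(Ω)`. -/
theorem hasWeakGradient_comp (h : IsThinDomain k r M U φ Ω) {v : Euc l → ℝ} {V : Euc l → Euc l}
    (H : HasWeakGradientOn k r M (φ '' Ω) v V) :
    HasWeakGradient Ω (fun x => v (φ x))
      (fun x => ContinuousLinearMap.adjoint (fderiv ℝ φ x) (V (φ x))) := by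
  have hl : k + (l - k) = l := by have := h.lt; omega
  refine HasWeakGradient.of_forall_mem fun x hx => ?_
  obtain ⟨O, σ, N, A, B, Φ, Ψ, L, hσ, hN, hxN, -, hNΩ, hAO⟩ := h.exists_isFiberChart hx univ_mem
  have hAG : σ '' A ⊆ φ '' Ω := by
    rintro _ ⟨ξ, hξ, rfl⟩
    have hq : (ξ, (Φ x).2) ∈ A ×ˢ B := ⟨hξ, (hN.mapsTo hxN).2⟩
    exact ⟨_, hNΩ (hN.mapsTo_symm hq), hN.param_eq hq⟩
  have h1 := hN.hasWeakGradient_comp_coord hl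
    (H.chart A σ (hσ.restrict hN.isOpen_left hAO) hAG)
  refine ⟨N, hN.isOpen_source, hxN, h1.congr_ae ?_ ?_⟩
  · filter_upwards [ae_restrict_mem hN.isOpen_source.measurableSet] with y hy
    rw [hN.comp_eq y hy]
  · filter_upwards [ae_restrict_mem hN.isOpen_source.measurableSet] with y hy
    rw [hN.adjoint_fderiv_projection hy (hσ.differentiableAt (by have := h.two_le; omega)
      (hAO (hN.mapsTo hy).1)), hN.comp_eq y hy]

/-- Push-forward of a weakly differentiable function that is constant along the fibres. -/
theorem hasWeakGradient_chart (h : IsThinDomain k r M U φ Ω) {u v : Euc l → ℝ}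
    {g V : Euc l → Euc l} (H : HasWeakGradient Ω u g)
    (hg : ∀ᵐ x ∂(volume.restrict Ω), g x ∈ tangentSpace M (φ x))
    (huv : ∀ᵐ x ∂(volume.restrict Ω), u x = v (φ x))
    (hgV : ∀ᵐ x ∂(volume.restrict Ω),
      g x = ContinuousLinearMap.adjoint (fderiv ℝ φ x) (V (φ x)))
    {O : Set (Euc k)} {σ : Euc k → Euc l} (hσ : IsLocalParam r M O σ) (hO : σ '' O ⊆ φ '' Ω) :
    HasWeakGradient O (fun ξ => v (σ ξ))
      (fun ξ => ContinuousLinearMap.adjoint (fderiv ℝ σ ξ) (V (σ ξ))) := by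
  have hl : k + (l - k) = l := by have := h.lt; omega
  refine HasWeakGradient.of_forall_mem fun ξ₀ hξ₀ => ?_
  obtain ⟨x₀, hx₀, e⟩ := hO (mem_image_of_mem σ hξ₀)
  obtain ⟨N, A, B, Φ, Ψ, L, hN, hxN, hNΩ, hAO, hΦ, w, γ, hw, hu, hγ⟩ :=
    h.exists_isFiberChart_factor H hg hσ hx₀ hξ₀ e
  have hB : B.Nonempty := ⟨_, (hN.mapsTo hxN).2⟩
  refine ⟨A, hN.isOpen_left, hΦ ▸ (hN.mapsTo hxN).1, hw.congr_ae ?_ ?_⟩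
  · refine (hN.ae_coord_iff hl hB (P := fun ξ => w ξ = v (σ ξ))).1 ?_
    filter_upwards [hu, ae_restrict_of_ae_restrict_of_subset hNΩ huv,
      ae_restrict_mem hN.isOpen_source.measurableSet] with x h1 h2 hx
    rw [← h1, h2, hN.comp_eq x hx]
  · refine (hN.ae_coord_iff hl hB (P := fun ξ => γ ξ =
      ContinuousLinearMap.adjoint (fderiv ℝ σ ξ) (V (σ ξ)))).1 ?_
    filter_upwards [hγ, ae_restrict_of_ae_restrict_of_subset hNΩ hgV,
      ae_restrict_mem hN.isOpen_source.measurableSet] with x h1 h2 hx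
    -- The two candidates for the gradient of `w` have the same image under the adjoint of the
    -- coordinate derivative, which is injective because the coordinate is a submersion.
    refine ContinuousLinearMap.adjoint_injective_of_surjective (hN.fderiv_coord
      h.isNormalProjection h.two_le hσ (hNΩ.trans h.subset) hAO hx).1 ?_
    rw [← h1, h2, hN.adjoint_fderiv_projection hx (hσ.differentiableAt
      (by have := h.two_le; omega) (hAO (hN.mapsTo hx).1)), hN.comp_eq x hx]

end IsThinDomain

/-! ### The spaces `H¹_s(Ω)` and `L²_s(Ω)` -/

theorem ThinDomain.MemH1s.congr_ae {l : ℕ} {M Ω : Set (Euc l)} {φ : Euc l → Euc l}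
    {u u' : Euc l → ℝ} (h : MemH1s M φ Ω u) (hu : u =ᵐ[volume.restrict Ω] u') :
    MemH1s M φ Ω u' := by
  obtain ⟨h1, g, h2, h3, h4⟩ := h
  exact ⟨h1.ae_eq hu, g, h2.congr_ae hu (ae_eq_refl g), h3, h4⟩

namespace IsThinDomain

variable {k l r : ℕ} {M U Ω : Set (Euc l)} {φ : Euc l → Euc l}

/-- `φ` is controlled only on `U`, so the isometry of `L²` spaces is built from a measurable
representative. -/
theorem measurePreserving_mk (h : IsThinDomain k r M U φ Ω) :
    MeasurePreserving (h.aemeasurable.mk φ) (volume.restrict Ω) ((volume.restrict Ω).map φ) :=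
  ⟨h.aemeasurable.measurable_mk, (Measure.map_congr h.aemeasurable.ae_eq_mk).symm⟩

theorem isFiniteMeasure_restrict (h : IsThinDomain k r M U φ Ω) :
    IsFiniteMeasure (volume.restrict Ω) :=
  MeasureTheory.isFiniteMeasure_restrict.2 h.isBounded.measure_lt_top.ne

theorem memLp_adjoint_fderiv (h : IsThinDomain k r M U φ Ω) {W : Euc l → Euc l}
    (hW : MemLp W 2 ((volume.restrict Ω).map φ)) :
    MemLp (fun x => ContinuousLinearMap.adjoint (fderiv ℝ φ x) (W (φ x))) 2
      (volume.restrict Ω) := by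
  have hφ1 : ContDiffOn ℝ 1 φ U := fun x hx =>
    (h.isNormalProjection.contDiffAt h.two_le hx).contDiffWithinAt
  have hA : ContinuousOn (fun x => ContinuousLinearMap.adjoint (fderiv ℝ φ x)) U :=
    ContinuousLinearMap.adjoint.continuous.comp_continuousOn
      (hφ1.continuousOn_fderiv_of_isOpen h.isNormalProjection.isOpen le_rfl)
  obtain ⟨c, hc⟩ := h.isCompact_closure.exists_bound_of_continuousOn (hA.mono h.closure_subset)
  exact ((memLp_map_measure_iff hW.1 h.aemeasurable).1 hW).clm_apply_of_bound
    ((hA.mono h.subset).aestronglyMeasurable h.isOpen.measurableSet)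
    ((ae_restrict_mem h.isOpen.measurableSet).mono fun x hx => hc x (subset_closure hx))

/-- `∇(f ∘ φ) = Dφᵀ ∇f` is automatically tangential, even when `∇f` is not, and `Dφ` is bounded on
`Ω`. -/
theorem memH1s_comp_contDiff (h : IsThinDomain k r M U φ Ω) {f : Euc l → ℝ}
    (hf : ContDiff ℝ 1 f) (hc : HasCompactSupport f) : MemH1s M φ Ω fun x => f (φ x) := by
  have := h.isFiniteMeasure_restrict
  have hφd : ∀ x ∈ Ω, DifferentiableAt ℝ φ x := fun x hx =>
    (h.isNormalProjection.contDiffAt h.two_le (h.subset hx)).differentiableAt one_ne_zero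
  have hφ1 : ContDiffOn ℝ 1 φ Ω := fun x hx =>
    (h.isNormalProjection.contDiffAt h.two_le (h.subset hx)).contDiffWithinAt
  have hfν : MemLp f 2 ((volume.restrict Ω).map φ) :=
    hf.continuous.memLp_of_hasCompactSupport hc
  have hgν : MemLp (∇ f) 2 ((volume.restrict Ω).map φ) := by
    refine Continuous.memLp_of_hasCompactSupport ?_ ?_
    · exact (InnerProductSpace.toDual ℝ (Euc l)).symm.continuous.comp
        (hf.continuous_fderiv one_ne_zero)
    · exact (hc.fderiv ℝ).comp_left (g := (InnerProductSpace.toDual ℝ (Euc l)).symm) (map_zero _)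
  refine ⟨(memLp_map_measure_iff hfν.1 h.aemeasurable).1 hfν,
    fun x => ContinuousLinearMap.adjoint (fderiv ℝ φ x) (∇ f (φ x)), ?_,
    h.memLp_adjoint_fderiv hgν, ?_⟩
  · refine (HasWeakGradient.of_contDiffOn h.isOpen (hf.comp_contDiffOn hφ1)).congr_ae
      (ae_eq_refl _) ?_
    filter_upwards [ae_restrict_mem h.isOpen.measurableSet] with x hx
    exact gradient_comp_eq_adjoint (hf.differentiable one_ne_zero _) (hφd x hx)
  · filter_upwards [ae_restrict_mem h.isOpen.measurableSet] with x hx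
    exact normalProj_eq_zero_iff.2 (h.adjoint_fderiv_mem hx _)

/-- Smooth compactly supported functions are dense in `L²` of the image measure, and the isometry
given by composition with `φ` carries them into `H¹_s(Ω)`. -/
theorem memL2s_comp (h : IsThinDomain k r M U φ Ω) {v : Euc l → ℝ}
    (hv : MemLp v 2 ((volume.restrict Ω).map φ)) : MemL2s M φ Ω fun x => v (φ x) := by
  have := h.isFiniteMeasure_restrict
  have hu := (memLp_map_measure_iff hv.1 h.aemeasurable).1 hv
  refine ⟨hu, ?_⟩
  have hmp := h.measurePreserving_mk
  have hT : Lp.compMeasurePreserving _ hmp (hv.toLp v) = hu.toLp (v ∘ φ) := by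
    rw [Lp.toLp_compMeasurePreserving, MemLp.toLp_eq_toLp_iff]
    filter_upwards [h.aemeasurable.ae_eq_mk] with x hx
    simp [← hx]
  change hu.toLp (v ∘ φ) ∈ _
  rw [← hT]
  refine map_mem_closure (Lp.isometry_compMeasurePreserving hmp).continuous
    (Lp.dense_hasCompactSupport_contDiff (by simp) (hv.toLp v)) ?_
  rintro w ⟨f, hwf, hfc, hf⟩
  refine (h.memH1s_comp_contDiff (hf.of_le (by simp)) hfc).congr_ae ?_
  have h1 := hmp.quasiMeasurePreserving.ae_eq_comp hwf
  filter_upwards [Lp.coeFn_compMeasurePreserving w hmp, h1, h.aemeasurable.ae_eq_mk]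
    with x h1 h2 h3
  rw [h1, h2, Function.comp_apply, ← h3]

theorem memH1s_comp (h : IsThinDomain k r M U φ Ω) {v : Euc l → ℝ} {V : Euc l → Euc l}
    (hv : MemLp v 2 ((volume.restrict Ω).map φ)) (H : HasWeakGradientOn k r M (φ '' Ω) v V)
    (hV : MemLp V 2 ((volume.restrict Ω).map φ)) : MemH1s M φ Ω fun x => v (φ x) :=
  ⟨(memLp_map_measure_iff hv.1 h.aemeasurable).1 hv, _, h.hasWeakGradient_comp H,
    h.memLp_adjoint_fderiv hV, (ae_restrict_mem h.isOpen.measurableSet).mono fun _ hx =>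
      normalProj_eq_zero_iff.2 (h.adjoint_fderiv_mem hx _)⟩

/-- Composition with `φ` is an isometry between complete spaces, so its range is closed; it contains
`H¹_s(Ω)` and therefore the closure. -/
theorem exists_memLp_of_memL2s (h : IsThinDomain k r M U φ Ω)
    (hsec : HasConnectedNormalSections M φ Ω) {u : Euc l → ℝ} (hu : MemL2s M φ Ω u) :
    ∃ v : Euc l → ℝ, MemLp v 2 ((volume.restrict Ω).map φ) ∧
      ∀ᵐ x ∂(volume.restrict Ω), u x = v (φ x) := by
  obtain ⟨hu2, hu⟩ := hu
  have hmp := h.measurePreserving_mk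
  set T := Lp.compMeasurePreserving (E := ℝ) (p := 2) _ hmp
  have hT : Isometry T := Lp.isometry_compMeasurePreserving hmp
  have hcl : IsClosed (range T) := hT.isClosedEmbedding.isClosed_range
  have hsub : {f : Lp ℝ 2 (volume.restrict Ω) | MemH1s M φ Ω f} ⊆ range T := by
    rintro f ⟨hf, g, H, -, hg⟩
    obtain ⟨v, hv, hfv⟩ := h.exists_comp_ae_eq hsec H
      (hg.mono fun x hx => normalProj_eq_zero_iff.1 hx)
    have hvν : MemLp v 2 ((volume.restrict Ω).map φ) :=
      (memLp_map_measure_iff hv.aestronglyMeasurable h.aemeasurable).2 (hf.ae_eq hfv)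
    refine ⟨hvν.toLp v, ?_⟩
    simp only [T]
    rw [Lp.toLp_compMeasurePreserving]
    refine Lp.ext ((MemLp.coeFn_toLp _).trans ?_)
    filter_upwards [hfv, h.aemeasurable.ae_eq_mk] with x h1 h2
    rw [Function.comp_apply, h1, ← h2]
  obtain ⟨w, hw⟩ := (closure_minimal hsub hcl) hu
  refine ⟨w, Lp.memLp w, ?_⟩
  have h1 : T w =ᵐ[volume.restrict Ω] u := hw ▸ hu2.coeFn_toLp
  filter_upwards [h1, Lp.coeFn_compMeasurePreserving w hmp, h.aemeasurable.ae_eq_mk]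
    with x h1 h2 h3
  rw [← h1, h2, Function.comp_apply, ← h3]

theorem memH1Loc_of_memH1s (h : IsThinDomain k r M U φ Ω)
    (hsec : HasConnectedNormalSections M φ Ω) {u v : Euc l → ℝ} (hu : MemH1s M φ Ω u)
    (hv : MemLp v 2 ((volume.restrict Ω).map φ))
    (huv : ∀ᵐ x ∂(volume.restrict Ω), u x = v (φ x)) : MemH1Loc k r M (φ '' Ω) v := by
  obtain ⟨-, g, H, hg2, hg0⟩ := hu
  have hg := hg0.mono fun x hx => normalProj_eq_zero_iff.1 hx
  obtain ⟨V, hV, hVT, hgV⟩ := h.exists_tangent_field hsec H hg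
  obtain ⟨c, hc⟩ := h.isNormalProjection.exists_norm_le_adjoint h.two_le h.isSubmanifold
    h.isCompact_closure h.closure_subset
  have hVν : MemLp V 2 ((volume.restrict Ω).map φ) := by
    refine (memLp_map_measure_iff hV.aestronglyMeasurable h.aemeasurable).2 ?_
    refine hg2.of_le_mul (c := c) (hV.comp_aemeasurable h.aemeasurable).aestronglyMeasurable ?_
    filter_upwards [hgV, ae_restrict_mem h.isOpen.measurableSet] with x h1 hx
    rw [h1]
    exact hc x (subset_closure hx) _ (hVT _ ⟨x, hx, rfl⟩)
  exact ⟨V, h.memL2Loc_of_memLp_map hv, h.memL2Loc_of_memLp_map hVν, hVT, fun O σ hσ hO =>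
    h.hasWeakGradient_chart H hg huv hgV hσ hO⟩

theorem ae_eq_adjoint_fderiv (h : IsThinDomain k r M U φ Ω) {u v : Euc l → ℝ}
    {g V : Euc l → Euc l} (huv : ∀ᵐ x ∂(volume.restrict Ω), u x = v (φ x))
    (HV : HasWeakGradientOn k r M (φ '' Ω) v V) (H : HasWeakGradient Ω u g) :
    ∀ᵐ x ∂(volume.restrict Ω),
      g x = ContinuousLinearMap.adjoint (fderiv ℝ φ x) (V (φ x)) :=
  H.ae_eq h.isOpen ((h.hasWeakGradient_comp HV).congr_ae (huv.mono fun _ hx => hx.symm)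
    (ae_eq_refl _))

/-- By uniqueness of weak gradients any such `V` pulls back to the gradient of `u`, and the lower
bound for `Dφᵀ` on tangent vectors returns its integrability to `V`. -/
theorem memLp_grad_of_memH1s (h : IsThinDomain k r M U φ Ω) {u v : Euc l → ℝ}
    {V : Euc l → Euc l} (hu : MemH1s M φ Ω u)
    (huv : ∀ᵐ x ∂(volume.restrict Ω), u x = v (φ x))
    (HV : HasWeakGradientOn k r M (φ '' Ω) v V) :
    MemLp V 2 ((volume.restrict Ω).map φ) := by
  obtain ⟨-, g, H, hg2, -⟩ := hu
  obtain ⟨C, hC, h1, -⟩ := h.exists_map_comparable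
  obtain ⟨c, hc⟩ := h.isNormalProjection.exists_norm_le_adjoint h.two_le h.isSubmanifold
    h.isCompact_closure h.closure_subset
  have hVm : AEStronglyMeasurable V ((volume.restrict Ω).map φ) :=
    (HV.memL2Loc_grad.aestronglyMeasurable h.isSigmaCompact_image).mono_ac
      ((Measure.absolutelyContinuous_of_le_smul h1).trans (withDensity_absolutelyContinuous _ _))
  refine (memLp_map_measure_iff hVm h.aemeasurable).2 ?_
  refine hg2.of_le_mul (c := c) (hVm.comp_aemeasurable h.aemeasurable) ?_
  filter_upwards [h.ae_eq_adjoint_fderiv huv HV H, ae_restrict_mem h.isOpen.measurableSet]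
    with x h1 hx
  rw [h1]
  exact hc x (subset_closure hx) _ (HV.tangent _ ⟨x, hx, rfl⟩)

end IsThinDomain

end

theorem theorem3p3 (l k r : ℕ) (hk : 1 ≤ k) (hkl : k < l) (hr : 2 ≤ r)
    (M : Set (Euc l)) (hM : IsSubmanifold k r M)
    (U : Set (Euc l)) (φ : Euc l → Euc l) (hφ : IsNormalProjection r M U φ)
    (Ω : Set (Euc l)) (hΩo : IsOpen Ω) (hΩc : IsConnected Ω) (hΩb : Bornology.IsBounded Ω)
    (hΩU : closure Ω ⊆ U) (hsec : HasConnectedNormalSections M φ Ω) :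
    -- every function in `L²_s(Ω)` (in `H¹_s(Ω)`) comes from a function on `φ(Ω)`
    (∀ u : Euc l → ℝ, MemL2s M φ Ω u →
      ∃ v : Euc l → ℝ, MemL2Loc μHE[k] (φ '' Ω) v ∧
        (∀ᵐ x ∂(volume.restrict Ω), u x = v (φ x)) ∧
        MemLp (fun p => √(sectionMeasure k φ Ω p) * v p) 2 (μHE[k].restrict (φ '' Ω)) ∧
        (MemH1s M φ Ω u →
          MemH1Loc k r M (φ '' Ω) v ∧
          ∀ V : Euc l → Euc l, HasWeakGradientOn k r M (φ '' Ω) v V →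
            (∀ g : Euc l → Euc l, HasWeakGradient Ω u g →
              ∀ᵐ x ∂(volume.restrict Ω),
                g x = ContinuousLinearMap.adjoint (fderiv ℝ φ x) (V (φ x))) ∧
            MemLp (fun p => √(sectionMeasure k φ Ω p) • V p) 2 (μHE[k].restrict (φ '' Ω)))) ∧
    -- conversely, these functions on `φ(Ω)` give functions in `L²_s(Ω)` (in `H¹_s(Ω)`)
    (∀ v : Euc l → ℝ, MemL2Loc μHE[k] (φ '' Ω) v →
      MemLp (fun p => √(sectionMeasure k φ Ω p) * v p) 2 (μHE[k].restrict (φ '' Ω)) →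
        MemL2s M φ Ω (fun x => v (φ x)) ∧
        ∀ V : Euc l → Euc l, HasWeakGradientOn k r M (φ '' Ω) v V →
          MemLp (fun p => √(sectionMeasure k φ Ω p) • V p) 2 (μHE[k].restrict (φ '' Ω)) →
            MemH1s M φ Ω (fun x => v (φ x))) := by
  have h : IsThinDomain k r M U φ Ω := ⟨hkl, hr, hM, hφ, hΩo, hΩb, hΩU⟩
  refine ⟨fun u hu => ?_, fun v _ hv => ?_⟩
  · obtain ⟨v, hv, huv⟩ := h.exists_memLp_of_memL2s hsec hu
    refine ⟨v, h.memL2Loc_of_memLp_map hv, huv, h.memLp_sqrt_smul_iff.2 hv, fun hu1 => ?_⟩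
    exact ⟨h.memH1Loc_of_memH1s hsec hu1 hv huv, fun V HV =>
      ⟨fun g hg => h.ae_eq_adjoint_fderiv huv HV hg,
        h.memLp_sqrt_smul_iff.2 (h.memLp_grad_of_memH1s hu1 huv HV)⟩⟩
  · have hv' := h.memLp_sqrt_smul_iff.1 hv
    exact ⟨h.memL2s_comp hv', fun V HV hV => h.memH1s_comp hv' HV (h.memLp_sqrt_smul_iff.1 hV)⟩
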